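/- Let $V=\mathbb{C}^n$, let $G\leqslant \mathrm{GL}(V)$ be a finite group generated by pseudo-reflections (elements conjugate to $\mathrm{diag}(\zeta,1,\dots,1)$ with $\zeta\neq 1$ a root of unity), let $S=\mathrm{Sym}_{\mathbb{C}}V=\mathbb{C}[x_1,\dots,x_n]$ with the induced $G$-action and the standard grading, and let $R=S^G$. Let $f_1,\dots,f_n$ be basic invariants of $G$, that is, algebraically independent homogeneous polynomials, $f_i$ of degree $d_i\ge 1$, with $R=\mathbb{C}[f_1,\dots,f_n]$. Let $J=\det\left(\partial f_i/\partial x_j\right)_{i,j}$ be their Jacobian, let $z$ be the squarefree polynomial underlying $J$ (the squarefree polynomial with the same irreducible factors as $J$, unique up to a nonzero constant), and put $m=\sum_{i=1}^n(d_i-1)$ and $m_1=\deg z$ (the number of pseudo-reflections in $G$ and the number of their mirrors, respectively). Let $V_i$ be a finite-dimensional irreducible complex representation of $G$, and let $V_i'=V_i\otimes\det$, where $\det$ is the determinant of the defining representation $V$. Put $$S_i=\mathrm{Hom}_{\mathbb{C}G}(V_i,S),\qquad S_i'=\mathrm{Hom}_{\mathbb{C}G}(V_i',S),\qquad M_i=\mathrm{Hom}_{\mathbb{C}G}(V_i,S/(J)).$$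 Then the discriminant $\Delta=zJ$ lies in $R$, and $M_i$ is a module over $R/(\Delta)$. The Hilbert--Poincaré series of the graded $R$-modules $S_i$ and $S_i'$ have the form $$H_{S_i}(t)=\frac{K_{S_i}(t)}{\prod_{j=1}^n(1-t^{d_j})},\qquad H_{S_i'}(t)=\frac{K_{S_i'}(t)}{\prod_{j=1}^n(1-t^{d_j})}$$ with polynomials $K_{S_i},K_{S_i'}\in\mathbb{Z}[t]$ (the fake degree polynomials). If moreover $\Delta$ is irreducible in $R$, then the rank of $M_i$ over the domain $R/(\Delta)$ is finite and equals $$\mathrm{rank}_{R/(\Delta)}M_i=\frac{1}{m+m_1}\left(m\dim V_i'+\frac{dK_{S_i'}}{dt}(1)-\frac{dK_{S_i}}{dt}(1)\right).$$ If in addition $G$ is a true reflection group, that is, generated by elements conjugate to $\mathrm{diag}(-1,1,\dots,1)$, then $$\mathrm{rank}_{R/(\Delta)}M_i=\frac12\left(\dim V_i'+\frac{\frac{dK_{S_i'}}{dt}(1)-\frac{dK_{S_i}}{dt}(1)}{m}\right).$$ -/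

import Mathlib

open scoped Polynomial PowerSeries

namespace ReflGroup

section Groups

variable {n : ℕ}

/-- `g` is conjugate to `diag(ζ, 1, …, 1)`, the entry `ζ` standing in some position. -/
def IsConjToDiag (ζ : ℂ) (g : GL (Fin n) ℂ) : Prop :=
  ∃ (P : GL (Fin n) ℂ) (i : Fin n),
    (P * g * P⁻¹).val = Matrix.diagonal (Function.update (fun _ => (1 : ℂ)) i ζ)

/-- A pseudo-reflection: conjugate to `diag(ζ, 1, …, 1)` with `ζ ≠ 1` a root of unity. -/
def IsPseudoReflection (g : GL (Fin n) ℂ) : Prop :=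
  ∃ ζ : ℂ, ζ ≠ 1 ∧ (∃ k : ℕ, 0 < k ∧ ζ ^ k = 1) ∧ IsConjToDiag ζ g

/-- A (true) reflection: conjugate to `diag(-1, 1, …, 1)`. -/
def IsTrueReflection (g : GL (Fin n) ℂ) : Prop :=
  IsConjToDiag (-1) g

/-- `G` is generated by the pseudo-reflections that it contains. -/
def IsPseudoReflectionGroup (G : Subgroup (GL (Fin n) ℂ)) : Prop :=
  Subgroup.closure {g | g ∈ G ∧ IsPseudoReflection g} = G

/-- `G` is generated by the (true) reflections that it contains. -/
def IsTrueReflectionGroup (G : Subgroup (GL (Fin n) ℂ)) : Prop :=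
  Subgroup.closure {g | g ∈ G ∧ IsTrueReflection g} = G

end Groups

section Action

variable {n : ℕ}

/-- The action of `g` on `S = Sym(ℂⁿ) = ℂ[x₁, …, xₙ]`, where `x₁, …, xₙ` is the standard basis of
`V = ℂⁿ`: the algebra map that sends `xⱼ` to `g(xⱼ) = ∑ᵢ gᵢⱼ xᵢ`. -/
noncomputable def polyAct (g : GL (Fin n) ℂ) :
    MvPolynomial (Fin n) ℂ →ₐ[ℂ] MvPolynomial (Fin n) ℂ :=
  MvPolynomial.aeval fun j => ∑ i, MvPolynomial.C (g.val i j) * MvPolynomial.X i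

theorem polyAct_X (g : GL (Fin n) ℂ) (j : Fin n) :
    polyAct g (MvPolynomial.X j) = ∑ i, MvPolynomial.C (g.val i j) * MvPolynomial.X i := by
  simp [polyAct]

theorem polyAct_C (g : GL (Fin n) ℂ) (c : ℂ) :
    polyAct g (MvPolynomial.C c) = MvPolynomial.C c :=
  (polyAct g).commutes c

theorem polyAct_one : polyAct (1 : GL (Fin n) ℂ) = AlgHom.id ℂ _ := by
  apply MvPolynomial.algHom_ext
  intro j
  rw [polyAct_X, Finset.sum_eq_single j]
  · simp
  · intro i _ hij
    simp [hij]
  · simp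

theorem polyAct_mul (g h : GL (Fin n) ℂ) :
    polyAct (g * h) = (polyAct g).comp (polyAct h) := by
  apply MvPolynomial.algHom_ext
  intro j
  simp only [AlgHom.comp_apply, polyAct_X, map_sum, map_mul, polyAct_C]
  simp only [Units.val_mul, Matrix.mul_apply, map_sum, map_mul, Finset.sum_mul, Finset.mul_sum]
  rw [Finset.sum_comm]
  exact Finset.sum_congr rfl fun _ _ => Finset.sum_congr rfl fun _ _ => by ring

/-- The representation of `G` on `S = ℂ[x₁, …, xₙ]`. -/
noncomputable def polyRep (G : Subgroup (GL (Fin n) ℂ)) :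
    Representation ℂ G (MvPolynomial (Fin n) ℂ) where
  toFun g := (polyAct (g : GL (Fin n) ℂ)).toLinearMap
  map_one' := by
    refine LinearMap.ext fun p => ?_
    simp [polyAct_one]
  map_mul' g h := by
    refine LinearMap.ext fun p => ?_
    simp [polyAct_mul]

/-- The invariant ring `R = S^G`. -/
noncomputable def invariantRing (G : Subgroup (GL (Fin n) ℂ)) :
    Subalgebra ℂ (MvPolynomial (Fin n) ℂ) where
  carrier := {p | ∀ g ∈ G, polyAct g p = p}
  mul_mem' ha hb g hg := by rw [map_mul, ha g hg, hb g hg]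
  add_mem' ha hb g hg := by rw [map_add, ha g hg, hb g hg]
  algebraMap_mem' c g _ := (polyAct g).commutes c

/-- `f₁, …, fₙ` are basic invariants of `G`, of degrees `d₁, …, dₙ`: algebraically independent
homogeneous polynomials, `fᵢ` of degree `dᵢ ≥ 1`, with `S^G = ℂ[f₁, …, fₙ]`. -/
structure IsBasicInvariants (G : Subgroup (GL (Fin n) ℂ))
    (f : Fin n → MvPolynomial (Fin n) ℂ) (d : Fin n → ℕ) : Prop where
  one_le_degree : ∀ i, 1 ≤ d i
  isHomogeneous : ∀ i, (f i).IsHomogeneous (d i)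
  algebraicIndependent : AlgebraicIndependent ℂ f
  adjoin_eq : Algebra.adjoin ℂ (Set.range f) = invariantRing G

/-- The Jacobian determinant `J = det(∂fᵢ/∂xⱼ)`. -/
noncomputable def jacobian (f : Fin n → MvPolynomial (Fin n) ℂ) : MvPolynomial (Fin n) ℂ :=
  (Matrix.of fun i j => MvPolynomial.pderiv j (f i)).det

theorem pderiv_polyAct (g : GL (Fin n) ℂ) (k : Fin n) (p : MvPolynomial (Fin n) ℂ) :
    MvPolynomial.pderiv k (polyAct g p) =
      ∑ j, polyAct g (MvPolynomial.pderiv j p) * MvPolynomial.C (g.val k j) := by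
  induction p using MvPolynomial.induction_on with
  | C a => simp
  | add p q hp hq => simp only [map_add, hp, hq, add_mul, Finset.sum_add_distrib]
  | mul_X p i hp =>
    have hX : MvPolynomial.pderiv k (polyAct g (MvPolynomial.X i)) = MvPolynomial.C (g.val k i) := by
      rw [polyAct_X, map_sum, Finset.sum_eq_single k]
      · simp
      · intro j _ hj
        simp [MvPolynomial.pderiv_X_of_ne hj]
      · simp
    have h2 : ∀ j, polyAct g (MvPolynomial.pderiv j (MvPolynomial.X i : MvPolynomial (Fin n) ℂ))
        = if j = i then 1 else 0 := by
      intro j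
      split_ifs with h
      · subst h; simp
      · rw [MvPolynomial.pderiv_X_of_ne (Ne.symm h), map_zero]
    simp only [map_mul, map_add, Derivation.leibniz, smul_eq_mul, hX, hp, h2, add_mul,
      Finset.sum_add_distrib]
    simp only [mul_ite, mul_one, mul_zero, ite_mul, zero_mul, Finset.sum_ite_eq',
      Finset.mem_univ, if_true, Finset.mul_sum, mul_assoc]

/-- The Jacobian of a family of invariants transforms by the inverse determinant. -/
theorem polyAct_jacobian {f : Fin n → MvPolynomial (Fin n) ℂ} (g : GL (Fin n) ℂ)
    (hf : ∀ i, polyAct g (f i) = f i) :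
    polyAct g (jacobian f) * MvPolynomial.C g.val.det = jacobian f := by
  have h1 : (Matrix.of fun i j => MvPolynomial.pderiv j (f i)) =
      (Matrix.of fun i j => polyAct g (MvPolynomial.pderiv j (f i))) *
        (g.val.map (MvPolynomial.C (σ := Fin n))).transpose := by
    ext1 i k
    rw [Matrix.mul_apply]
    simp only [Matrix.of_apply, Matrix.transpose_apply, Matrix.map_apply]
    rw [← pderiv_polyAct, hf]
  conv_rhs => rw [jacobian, h1, Matrix.det_mul, Matrix.det_transpose]
  congr 1
  · rw [jacobian, AlgHom.map_det]
    rfl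
  · rw [RingHom.map_det]
    rfl

theorem IsBasicInvariants.polyAct_eq {G : Subgroup (GL (Fin n) ℂ)}
    {f : Fin n → MvPolynomial (Fin n) ℂ} {d : Fin n → ℕ} (hf : IsBasicInvariants G f d)
    (g : GL (Fin n) ℂ) (hg : g ∈ G) (i : Fin n) : polyAct g (f i) = f i := by
  have h : f i ∈ invariantRing G :=
    hf.adjoin_eq ▸ Algebra.subset_adjoin (Set.mem_range_self i)
  exact h g hg

/-- The ideal `(J)` of `S` is stable under `G`. -/
theorem IsBasicInvariants.span_jacobian_le_comap {G : Subgroup (GL (Fin n) ℂ)}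
    {f : Fin n → MvPolynomial (Fin n) ℂ} {d : Fin n → ℕ} (hf : IsBasicInvariants G f d) (g : G) :
    (Ideal.span {jacobian f}).restrictScalars ℂ ≤
      ((Ideal.span {jacobian f}).restrictScalars ℂ).comap (polyRep G g) := by
  intro p hp
  rw [Submodule.restrictScalars_mem, Ideal.mem_span_singleton] at hp
  rw [Submodule.mem_comap, Submodule.restrictScalars_mem, Ideal.mem_span_singleton]
  have hdvd : jacobian f ∣ polyAct (g : GL (Fin n) ℂ) (jacobian f) := by
    have h := polyAct_jacobian (g : GL (Fin n) ℂ) (hf.polyAct_eq g g.2)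
    have hdet : IsUnit (MvPolynomial.C (σ := Fin n) (g : GL (Fin n) ℂ).val.det) :=
      ((Matrix.isUnit_iff_isUnit_det _).1 (g : GL (Fin n) ℂ).isUnit).map MvPolynomial.C
    exact ((hdet.dvd_mul_right).1 (dvd_of_eq h.symm))
  exact hdvd.trans (map_dvd (polyAct (g : GL (Fin n) ℂ)) hp)

/-- The representation of `G` on `S/(J)` induced from that on `S`. -/
noncomputable def quotRep {G : Subgroup (GL (Fin n) ℂ)}
    {f : Fin n → MvPolynomial (Fin n) ℂ} {d : Fin n → ℕ} (hf : IsBasicInvariants G f d) :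
    Representation ℂ G (MvPolynomial (Fin n) ℂ ⧸ Ideal.span {jacobian f}) where
  toFun g := Submodule.mapQ ((Ideal.span {jacobian f}).restrictScalars ℂ)
    ((Ideal.span {jacobian f}).restrictScalars ℂ) (polyRep G g) (hf.span_jacobian_le_comap g)
  map_one' := by
    refine LinearMap.ext fun x => ?_
    obtain ⟨p, rfl⟩ := Submodule.Quotient.mk_surjective _ x
    simp
    rfl
  map_mul' g h := by
    refine LinearMap.ext fun x => ?_
    obtain ⟨p, rfl⟩ := Submodule.Quotient.mk_surjective _ x
    simp
    rfl

end Action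

section Covariants

universe u v

variable {n : ℕ}

/-- The representation `det` of `G` on `ℂ`, that is, the determinant of the defining
representation `V = ℂⁿ`. -/
noncomputable def detRep (G : Subgroup (GL (Fin n) ℂ)) : Representation ℂ G ℂ where
  toFun g := (g : GL (Fin n) ℂ).val.det • LinearMap.id
  map_one' := by
    ext
    simp
  map_mul' g h := by
    ext
    simp [mul_comm]

/-- `Hom_G(W, N)` as an `R`-module, for an `R`-module `N` on which `G` acts `R`-linearly. -/
def homRep {G : Type*} [Group G] {W : Type u} {N : Type v} [AddCommGroup W] [Module ℂ W]
    [AddCommGroup N] [Module ℂ N] (R : Type*) [CommRing R] [Module R N] [SMulCommClass ℂ R N]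
    (ρ : Representation ℂ G W) (σ : Representation ℂ G N)
    (hR : ∀ (g : G) (r : R) (x : N), σ g (r • x) = r • σ g x) :
    Submodule R (W →ₗ[ℂ] N) where
  carrier := {φ | ∀ (g : G) (w : W), φ (ρ g w) = σ g (φ w)}
  zero_mem' g w := by simp
  add_mem' ha hb g w := by simp [ha g w, hb g w]
  smul_mem' r φ hφ g w := by
    rw [LinearMap.smul_apply, LinearMap.smul_apply, hφ g w, hR]

/-- `Hom_G(W, N)` as a type of its own. -/
def HomRep {G : Type*} [Group G] {W : Type u} {N : Type v} [AddCommGroup W] [Module ℂ W]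
    [AddCommGroup N] [Module ℂ N] (R : Type*) [CommRing R] [Module R N] [SMulCommClass ℂ R N]
    (ρ : Representation ℂ G W) (σ : Representation ℂ G N)
    (hR : ∀ (g : G) (r : R) (x : N), σ g (r • x) = r • σ g x) : Type (max u v) :=
  homRep R ρ σ hR

section

variable {G : Type*} [Group G] {W : Type u} {N : Type v} [AddCommGroup W] [Module ℂ W]
  [AddCommGroup N] [Module ℂ N] (R : Type*) [CommRing R] [Module R N] [SMulCommClass ℂ R N]
  (ρ : Representation ℂ G W) (σ : Representation ℂ G N)
  (hR : ∀ (g : G) (r : R) (x : N), σ g (r • x) = r • σ g x)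

instance : AddCommGroup (HomRep R ρ σ hR) :=
  inferInstanceAs (AddCommGroup (homRep R ρ σ hR))

instance : Module R (HomRep R ρ σ hR) :=
  inferInstanceAs (Module R (homRep R ρ σ hR))

theorem isTorsionBy_homRep (a : R) (ha : ∀ x : N, a • x = 0) :
    Module.IsTorsionBy R (HomRep R ρ σ hR) a := by
  intro φ
  exact Subtype.ext (LinearMap.ext fun w => ha (φ.1 w))

end

theorem polyRep_smul (G : Subgroup (GL (Fin n) ℂ)) (g : G) (r : invariantRing G)
    (p : MvPolynomial (Fin n) ℂ) : polyRep G g (r • p) = r • polyRep G g p := by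
  change polyAct (g : GL (Fin n) ℂ) (r.1 * p) = r.1 * polyAct (g : GL (Fin n) ℂ) p
  rw [map_mul, r.2 g g.2]

theorem quotRep_smul {G : Subgroup (GL (Fin n) ℂ)}
    {f : Fin n → MvPolynomial (Fin n) ℂ} {d : Fin n → ℕ} (hf : IsBasicInvariants G f d)
    (g : G) (r : invariantRing G) (x : MvPolynomial (Fin n) ℂ ⧸ Ideal.span {jacobian f}) :
    quotRep hf g (r • x) = r • quotRep hf g x := by
  obtain ⟨p, rfl⟩ := Submodule.Quotient.mk_surjective _ x
  change Submodule.Quotient.mk (polyRep G g (r • p)) =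
    Submodule.Quotient.mk (r • polyRep G g p)
  rw [polyRep_smul]

variable {G : Subgroup (GL (Fin n) ℂ)} {W : Type u} [AddCommGroup W] [Module ℂ W]

/-- The homogeneous component of degree `k` of the graded `R`-module `Hom_G(W, S)`: the equivariant
maps with values in the homogeneous polynomials of degree `k`. -/
noncomputable def homPolyDegree (ρ : Representation ℂ G W) (k : ℕ) :
    Submodule ℂ (W →ₗ[ℂ] MvPolynomial (Fin n) ℂ) where
  carrier := {φ | (∀ (g : G) (w : W), φ (ρ g w) = polyRep G g (φ w)) ∧
    ∀ w, (φ w).IsHomogeneous k}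
  zero_mem' := ⟨fun g w => by simp, fun _ => MvPolynomial.isHomogeneous_zero _ _ _⟩
  add_mem' ha hb := ⟨fun g w => by simp [ha.1 g w, hb.1 g w], fun w => (ha.2 w).add (hb.2 w)⟩
  smul_mem' c φ hφ := by
    refine ⟨fun g w => ?_, fun w => ?_⟩
    · rw [LinearMap.smul_apply, LinearMap.smul_apply, hφ.1 g w, map_smul]
    · exact (MvPolynomial.homogeneousSubmodule (Fin n) ℂ k).smul_mem c (hφ.2 w)

/-- The Hilbert–Poincaré series of the graded module `Hom_G(W, S)`. -/
noncomputable def hilbertSeries (ρ : Representation ℂ G W) : ℤ⟦X⟧ :=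
  PowerSeries.mk fun k => (Module.finrank ℂ (homPolyDegree ρ k) : ℤ)

/-- `K` is the numerator polynomial of the Hilbert–Poincaré series of `Hom_G(W, S)` (the fake
degree polynomial), where `d₁, …, dₙ` are the degrees of the basic invariants:
`H(t) = K(t) / ∏ᵢ (1 - t ^ dᵢ)`. -/
def IsHilbertNumerator (d : Fin n → ℕ) (ρ : Representation ℂ G W) (K : ℤ[X]) : Prop :=
  hilbertSeries ρ * ∏ i, (1 - PowerSeries.X ^ d i) = (K : ℤ⟦X⟧)

variable {f : Fin n → MvPolynomial (Fin n) ℂ} {d : Fin n → ℕ}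

/-- `Δ = z J` annihilates `S/(J)`. -/
theorem smul_quot_eq_zero {z : MvPolynomial (Fin n) ℂ} {Δ : invariantRing G}
    (hΔ : (Δ : MvPolynomial (Fin n) ℂ) = z * jacobian f)
    (x : MvPolynomial (Fin n) ℂ ⧸ Ideal.span {jacobian f}) : Δ • x = 0 := by
  obtain ⟨p, rfl⟩ := Submodule.Quotient.mk_surjective _ x
  change Submodule.Quotient.mk ((Δ : MvPolynomial (Fin n) ℂ) * p) = 0
  rw [Submodule.Quotient.mk_eq_zero, hΔ, Ideal.mem_span_singleton]
  exact ⟨z * p, by ring⟩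

/-- `M = Hom_G(W, S/(J))`, a module over `R = S^G`. -/
abbrev HomQuot (hf : IsBasicInvariants G f d) (ρ : Representation ℂ G W) :=
  HomRep (invariantRing G) ρ (quotRep hf) (quotRep_smul hf)

/-- The rank over `A/(a)` of an `A`-module `M` that is annihilated by `a`; the `A/(a)`-module
structure is the one induced by the `A`-module structure. -/
noncomputable def rankOverQuotient {A : Type*} [CommRing A] {M : Type*} [AddCommGroup M]
    [Module A M] {a : A} (h : Module.IsTorsionBy A M a) : Cardinal :=
  letI : Module (A ⧸ Ideal.span {a}) M := h.module
  Module.rank (A ⧸ Ideal.span {a}) M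

/-- The rank of `M = Hom_G(W, S/(J))` over `R/(Δ)`, where `Δ = z J`. -/
noncomputable def rankHomQuot (hf : IsBasicInvariants G f d) (ρ : Representation ℂ G W)
    {z : MvPolynomial (Fin n) ℂ} {Δ : invariantRing G}
    (hΔ : (Δ : MvPolynomial (Fin n) ℂ) = z * jacobian f) : Cardinal :=
  rankOverQuotient (A := invariantRing G) (M := HomQuot hf ρ) (a := Δ)
    (isTorsionBy_homRep _ _ _ _ Δ (smul_quot_eq_zero hΔ))

end Covariants

section Discriminant

variable {n : ℕ}

/-- `z` is the squarefree polynomial underlying `J`: it is squarefree and has the same irreducible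
factors as `J`. This determines `z` up to a nonzero constant. -/
structure IsSquarefreePart (z J : MvPolynomial (Fin n) ℂ) : Prop where
  squarefree : Squarefree z
  dvd : z ∣ J
  dvd_pow : ∃ k : ℕ, J ∣ z ^ k

end Discriminant

end ReflGroup

/-!
Write `S = ℂ[x₁, …, xₙ]`, `R = S^G`, `Q = Hom_G(W, S)`, `m = deg J` and `m₁ = deg z`. The Jacobian
`J` transforms by the inverse of the determinant, so that multiplication by `J` identifies
`Hom_G(W ⊗ det, S)`, shifted by `m`, with the submodule `P` of `Q` of maps with values in `(J)`
(`hilb_divisibleCovariants`). As `G` is finite, equivariant maps to `S/(J)` lift to `S` by averaging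
(`toHomQuot_surjective`), so `M = Hom_G(W, S/(J))` is `Q/P`. The argument compares Hilbert series;
that `Q` is free over `R` is never needed.

*The discriminant.* Every pseudo-reflection `s` of `G` has a root, a linear form `α` such that `s`
acts trivially modulo `α` (`IsConjToDiag.exists_root`). A semi-invariant of `s` that is not
divisible by `α` is fixed by `s`. Hence `α` divides `J`, it divides the squarefree `z` exactly
once, and `z` transforms under `s` by `det s`. So `z J` is invariant (`discriminant_mem`).

*Numerators.* `R` is a polynomial ring on the basic invariants and `S` is finite over it, so a
Hilbert–Serre induction (`hilbert_serre`) gives the numerators `K`, `K'` as integer polynomials.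
Their values at `1` are `dim W` (`IsBasicInvariants.eval_one_numerator`): at a point with a free
orbit covariants can be prescribed arbitrarily, so there are `dim W` homogeneous covariants with
nonzero determinant; they span a free `R`-module, into which, by Cramer's rule and averaging, a
nonzero homogeneous invariant multiplies all of `Q`. This forces the numerators of the two Hilbert
series to agree at `1` (`eval_one_eq_zero_of_coeff_le`).

*The rank.* If `Δ` is irreducible, it is prime, since `R` is factorial. The rank `r` of `M` over
`R/(Δ)` is the size of a maximal independent set of homogeneous covariants modulo `P`, of degrees
`a₁, …, aᵣ` (`exists_finset_rankHomQuot`). Together with `P` they generate a module `P'`, and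
`P'/P` is a direct sum of shifts of `R/(Δ)`, with numerator `∑ t ^ aᵢ (1 - t ^ (m + m₁))`. The
quotient `Q/P'` is annihilated by `Δ` and by a homogeneous invariant `b` not divisible by `Δ`
(`exists_common_multiplier`); taking norms shows that `Δ` and `b` are coprime in `S`
(`isRelPrime_of_not_dvd`). By the Reynolds operator `Q/P'` is no larger than `Hom(W, S)/(Δ, b)`, so
its numerator vanishes to second order at `1` (`derivative_eval_one_eq_zero_of_coeff_le`).
Differentiating `K - t ^ m K' - ∑ t ^ aᵢ (1 - t ^ (m + m₁))` at `1` gives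
`r (m + m₁) = m dim W + dK'/dt(1) - dK/dt(1)`.

*True reflections.* Now `det` takes the values `±1`, so `z²` and `J/z` are invariants with product
`Δ`. As `Δ` is irreducible and `z` is not constant, `J/z` is constant and `m₁ = m`
(`totalDegree_eq_of_isTrueReflectionGroup`).
-/

namespace ReflGroup

/-! ### Graded vector spaces and Hilbert series -/

section VGrading

/-- An `ℕ`-grading with finite-dimensional pieces on a vector space `E`, given by its projections
onto the homogeneous pieces. -/
structure VGrading (k E : Type*) [Field k] [AddCommGroup E] [Module k E] where
  /-- The projection onto the piece of degree `i`. -/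
  proj : ℕ → E →ₗ[k] E
  proj_self : ∀ i x, proj i (proj i x) = proj i x
  proj_ne : ∀ i j x, i ≠ j → proj i (proj j x) = 0
  exists_sum : ∀ x, ∃ N, ∑ i ∈ Finset.range N, proj i x = x
  finite : ∀ i, FiniteDimensional k (LinearMap.range (proj i))

variable {k : Type*} [Field k] {E : Type*} [AddCommGroup E] [Module k E]
  {E' : Type*} [AddCommGroup E'] [Module k E']

namespace VGrading

/-- The homogeneous piece of degree `i`. -/
def piece (𝒢 : VGrading k E) (i : ℕ) : Submodule k E := LinearMap.range (𝒢.proj i)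

theorem mem_piece (𝒢 : VGrading k E) {i : ℕ} {x : E} : x ∈ 𝒢.piece i ↔ 𝒢.proj i x = x := by
  constructor
  · rintro ⟨y, rfl⟩
    exact 𝒢.proj_self i y
  · intro h
    exact ⟨x, h⟩

theorem proj_mem_piece (𝒢 : VGrading k E) (i : ℕ) (x : E) : 𝒢.proj i x ∈ 𝒢.piece i := ⟨x, rfl⟩

instance (𝒢 : VGrading k E) (i : ℕ) : FiniteDimensional k (𝒢.piece i) := 𝒢.finite i

instance (𝒢 : VGrading k E) (P : Submodule k E) (i : ℕ) :
    FiniteDimensional k (P ⊓ 𝒢.piece i : Submodule k E) :=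
  Submodule.finiteDimensional_of_le inf_le_right

/-- Homogeneous subspaces: those that contain the homogeneous components of their elements. -/
def IsHomog (𝒢 : VGrading k E) (P : Submodule k E) : Prop := ∀ i, ∀ x ∈ P, 𝒢.proj i x ∈ P

theorem isHomog_top (𝒢 : VGrading k E) : 𝒢.IsHomog ⊤ := fun _ _ _ => trivial

theorem isHomog_bot (𝒢 : VGrading k E) : 𝒢.IsHomog ⊥ := fun i x hx => by
  rw [Submodule.mem_bot] at hx ⊢
  rw [hx, map_zero]

theorem IsHomog.inf {𝒢 : VGrading k E} {P Q : Submodule k E} (hP : 𝒢.IsHomog P)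
    (hQ : 𝒢.IsHomog Q) : 𝒢.IsHomog (P ⊓ Q) := fun i x hx => ⟨hP i x hx.1, hQ i x hx.2⟩

theorem IsHomog.sup {𝒢 : VGrading k E} {P Q : Submodule k E} (hP : 𝒢.IsHomog P)
    (hQ : 𝒢.IsHomog Q) : 𝒢.IsHomog (P ⊔ Q) := fun i x hx => by
  obtain ⟨y, hy, z, hz, rfl⟩ := Submodule.mem_sup.1 hx
  rw [map_add]
  exact Submodule.add_mem_sup (hP i y hy) (hQ i z hz)

theorem _root_.ReflGroup.finrank_map_add_ker (A : Submodule k E) [FiniteDimensional k A]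
    (f : E →ₗ[k] E') :
    Module.finrank k (A.map f) + Module.finrank k (A ⊓ LinearMap.ker f : Submodule k E) =
      Module.finrank k A := by
  rw [← LinearMap.finrank_range_add_finrank_ker (f.domRestrict A), LinearMap.range_domRestrict,
    LinearMap.ker_domRestrict, ← Submodule.map_comap_subtype, Submodule.finrank_map_subtype_eq]

/-- Linear maps that are homogeneous of degree `a`. -/
def IsHomogMap (𝒢 : VGrading k E) (𝒢' : VGrading k E') (a : ℕ) (f : E →ₗ[k] E') : Prop :=
  ∀ i x, 𝒢'.proj (i + a) (f x) = f (𝒢.proj i x)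

theorem IsHomogMap.proj_lt {𝒢 : VGrading k E} {𝒢' : VGrading k E'} {a : ℕ} {f : E →ₗ[k] E'}
    (hf : IsHomogMap 𝒢 𝒢' a f) {j : ℕ} (hj : j < a) (x : E) : 𝒢'.proj j (f x) = 0 := by
  obtain ⟨N, hN⟩ := 𝒢.exists_sum x
  rw [← hN, map_sum, map_sum]
  refine Finset.sum_eq_zero fun i _ => ?_
  rw [← hf]
  exact 𝒢'.proj_ne _ _ _ (by omega)

theorem IsHomog.map {𝒢 : VGrading k E} {𝒢' : VGrading k E'} {a : ℕ} {f : E →ₗ[k] E'}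
    (hf : IsHomogMap 𝒢 𝒢' a f) {Q : Submodule k E} (hQ : 𝒢.IsHomog Q) :
    𝒢'.IsHomog (Q.map f) := by
  rintro j _ ⟨x, hx, rfl⟩
  rcases lt_or_ge j a with hj | hj
  · rw [hf.proj_lt hj]
    exact zero_mem _
  · obtain ⟨i, rfl⟩ := Nat.exists_eq_add_of_le' hj
    rw [hf]
    exact ⟨_, hQ i x hx, rfl⟩

theorem IsHomog.comap {𝒢 : VGrading k E} {𝒢' : VGrading k E'} {a : ℕ} {f : E →ₗ[k] E'}
    (hf : IsHomogMap 𝒢 𝒢' a f) {P : Submodule k E'} (hP : 𝒢'.IsHomog P) :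
    𝒢.IsHomog (P.comap f) := by
  intro i x hx
  rw [Submodule.mem_comap, ← hf]
  exact hP _ _ hx

/-- The Hilbert series of a homogeneous subspace. The coefficients are taken in `ℤ`, so that series
of subquotients `Q/P` can be written as differences. -/
noncomputable def hilb (𝒢 : VGrading k E) (P : Submodule k E) : ℤ⟦X⟧ :=
  PowerSeries.mk fun i => (Module.finrank k (P ⊓ 𝒢.piece i : Submodule k E) : ℤ)

theorem coeff_hilb (𝒢 : VGrading k E) (P : Submodule k E) (i : ℕ) :
    PowerSeries.coeff i (𝒢.hilb P) = Module.finrank k (P ⊓ 𝒢.piece i : Submodule k E) := by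
  simp [hilb]

theorem hilb_bot (𝒢 : VGrading k E) : 𝒢.hilb ⊥ = 0 := by
  ext i
  simp [coeff_hilb]

theorem coeff_hilb_mono (𝒢 : VGrading k E) {P Q : Submodule k E} (h : P ≤ Q) (i : ℕ) :
    PowerSeries.coeff i (𝒢.hilb P) ≤ PowerSeries.coeff i (𝒢.hilb Q) := by
  rw [coeff_hilb, coeff_hilb]
  exact_mod_cast Submodule.finrank_mono (inf_le_inf_right _ h)

/-- If `Q ∩ Z ≤ P` then `Q/P` is graded-dimensionwise at most `E/Z`. -/
theorem coeff_hilb_sub_le (𝒢 : VGrading k E) {P Q Z : Submodule k E} (h : Q ⊓ Z ≤ P) (i : ℕ) :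
    PowerSeries.coeff i (𝒢.hilb Q - 𝒢.hilb P) ≤ PowerSeries.coeff i (𝒢.hilb ⊤ - 𝒢.hilb Z) := by
  have h1 := Submodule.finrank_sup_add_finrank_inf_eq (Q ⊓ 𝒢.piece i) (Z ⊓ 𝒢.piece i)
  have h2 : Module.finrank k (Q ⊓ 𝒢.piece i ⊔ Z ⊓ 𝒢.piece i : Submodule k E) ≤
      Module.finrank k (⊤ ⊓ 𝒢.piece i : Submodule k E) :=
    Submodule.finrank_mono (sup_le (inf_le_inf_right _ le_top) (inf_le_inf_right _ le_top))
  have h3 : Module.finrank k ((Q ⊓ 𝒢.piece i) ⊓ (Z ⊓ 𝒢.piece i) : Submodule k E) ≤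
      Module.finrank k (P ⊓ 𝒢.piece i : Submodule k E) :=
    Submodule.finrank_mono fun x hx => ⟨h ⟨hx.1.1, hx.2.1⟩, hx.1.2⟩
  rw [map_sub, map_sub, coeff_hilb, coeff_hilb, coeff_hilb, coeff_hilb]
  omega

/-- The Hilbert series of `(P' + f(Q))/P'`, for `f` homogeneous of degree `a`, is that of
`Q/(Q ∩ f⁻¹(P'))` shifted by `a`. -/
theorem hilb_sup_map_sub {𝒢 : VGrading k E} {𝒢' : VGrading k E'} {a : ℕ} {f : E →ₗ[k] E'}
    (hf : IsHomogMap 𝒢 𝒢' a f) {Q : Submodule k E} (hQ : 𝒢.IsHomog Q) {P' : Submodule k E'}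
    (hP' : 𝒢'.IsHomog P') :
    𝒢'.hilb (P' ⊔ Q.map f) - 𝒢'.hilb P' =
      PowerSeries.X ^ a * (𝒢.hilb Q - 𝒢.hilb (Q ⊓ P'.comap f)) := by
  ext j
  rw [PowerSeries.coeff_X_pow_mul']
  split_ifs with hj
  · obtain ⟨i, rfl⟩ := Nat.exists_eq_add_of_le' hj
    rw [Nat.add_sub_cancel, map_sub, map_sub, coeff_hilb, coeff_hilb, coeff_hilb, coeff_hilb]
    have e1 : (P' ⊔ Q.map f) ⊓ 𝒢'.piece (i + a) =
        (P' ⊓ 𝒢'.piece (i + a)) ⊔ (Q ⊓ 𝒢.piece i).map f := by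
      apply le_antisymm
      · rintro x ⟨hx, hxp⟩
        obtain ⟨p, hp, _, ⟨q, hq, rfl⟩, rfl⟩ := Submodule.mem_sup.1 hx
        rw [← 𝒢'.mem_piece.1 hxp, map_add, hf]
        exact Submodule.add_mem_sup ⟨hP' _ _ hp, 𝒢'.proj_mem_piece _ _⟩
          ⟨_, ⟨hQ _ _ hq, 𝒢.proj_mem_piece _ _⟩, rfl⟩
      · refine sup_le (inf_le_inf_right _ le_sup_left) ?_
        rintro _ ⟨q, ⟨hq, hqp⟩, rfl⟩
        refine ⟨Submodule.mem_sup_right ⟨q, hq, rfl⟩, ?_⟩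
        exact 𝒢'.mem_piece.2 (by rw [hf, 𝒢.mem_piece.1 hqp])
    have e2 : (Q ⊓ 𝒢.piece i) ⊓ (P' ⊓ 𝒢'.piece (i + a)).comap f =
        (Q ⊓ P'.comap f) ⊓ 𝒢.piece i := by
      apply le_antisymm
      · rintro x ⟨⟨h1, h2⟩, h3, -⟩
        exact ⟨⟨h1, h3⟩, h2⟩
      · rintro x ⟨⟨h1, h3⟩, h2⟩
        refine ⟨⟨h1, h2⟩, h3, ?_⟩
        exact 𝒢'.mem_piece.2 (by rw [hf, 𝒢.mem_piece.1 h2])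
    rw [e1, ← e2]
    have h1 := Submodule.finrank_sup_add_finrank_inf_eq (P' ⊓ 𝒢'.piece (i + a))
      ((Q ⊓ 𝒢.piece i).map f)
    -- rank-nullity for `f` on `Q_i` and on `Q_i ∩ f⁻¹(P')`, which have the same kernel
    set A := Q ⊓ 𝒢.piece i with hA
    set B := P' ⊓ 𝒢'.piece (i + a) with hB
    have h2 : Module.finrank k (A.map f) + Module.finrank k (A ⊓ LinearMap.ker f : Submodule k E)
        = Module.finrank k A := finrank_map_add_ker A f
    have h3 : Module.finrank k ((A ⊓ B.comap f).map f) +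
        Module.finrank k (A ⊓ LinearMap.ker f : Submodule k E)
        = Module.finrank k (A ⊓ B.comap f : Submodule k E) := by
      rw [← finrank_map_add_ker (A ⊓ B.comap f) f]
      congr 1
      refine congrArg (fun C : Submodule k E => Module.finrank k C) ?_
      ext x
      simp only [Submodule.mem_inf, LinearMap.mem_ker, Submodule.mem_comap]
      constructor
      · rintro ⟨h1, h2⟩
        exact ⟨⟨h1, h2 ▸ zero_mem B⟩, h2⟩
      · rintro ⟨⟨h1, -⟩, h2⟩
        exact ⟨h1, h2⟩
    have h4 : (A ⊓ B.comap f).map f = B ⊓ A.map f := by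
      rw [← Submodule.map_inf_eq_map_inf_comap, inf_comm]
    rw [h4] at h3
    omega
  · have e1 : (P' ⊔ Q.map f) ⊓ 𝒢'.piece j = P' ⊓ 𝒢'.piece j := by
      refine le_antisymm ?_ (inf_le_inf_right _ le_sup_left)
      rintro x ⟨hx, hxp⟩
      refine ⟨?_, hxp⟩
      obtain ⟨p, hp, _, ⟨q, hq, rfl⟩, rfl⟩ := Submodule.mem_sup.1 hx
      rw [← 𝒢'.mem_piece.1 hxp, map_add, hf.proj_lt (by omega), add_zero]
      exact hP' _ _ hp
    rw [map_sub, coeff_hilb, coeff_hilb, e1, sub_self]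

end VGrading

end VGrading

/-! ### Rationality of Hilbert series -/

section HilbertSerre

variable {k : Type*} [Field k] {R : Type*} [CommRing R]
  {E : Type*} [AddCommGroup E] [Module k E] [Module R E]

/-- `k`-subspaces that are closed under the action of `R`. -/
def IsStable (R : Type*) [CommRing R] [Module R E] (P : Submodule k E) : Prop :=
  ∀ (r : R), ∀ x ∈ P, r • x ∈ P

theorem IsStable.sup {P Q : Submodule k E} (hP : IsStable R P) (hQ : IsStable R Q) :
    IsStable R (P ⊔ Q) := fun r x hx => by
  obtain ⟨y, hy, z, hz, rfl⟩ := Submodule.mem_sup.1 hx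
  rw [smul_add]
  exact Submodule.add_mem_sup (hP r y hy) (hQ r z hz)

/-- The `R`-submodule underlying a stable subspace. -/
def IsStable.toSubmodule {P : Submodule k E} (hP : IsStable R P) : Submodule R E :=
  { P.toAddSubmonoid with smul_mem' := fun r x hx => hP r x hx }

/-- A form of the Hilbert–Serre theorem: if `Q/P` is a finitely generated graded module over the
algebra `R = k[fᵢ]`, and `fᵢ` acts by zero on it unless `i ∈ s`, then the Hilbert series of `Q/P`
multiplied by `∏_{i ∈ s} (1 - t ^ dᵢ)` is a polynomial. -/
theorem hilbert_serre [Algebra k R] [IsScalarTower k R E] [IsNoetherian R E] {ι : Type*}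
    [DecidableEq ι] (f : ι → R) (d : ι → ℕ)
    (hgen : Algebra.adjoin k (Set.range f) = ⊤) (𝒢 : VGrading k E)
    (hf : ∀ i, 𝒢.IsHomogMap 𝒢 (d i) (Algebra.lsmul k k E (f i))) (s : Finset ι) :
    ∀ P Q : Submodule k E, 𝒢.IsHomog P → 𝒢.IsHomog Q → IsStable R P → IsStable R Q → P ≤ Q →
      (∀ i ∉ s, ∀ x ∈ Q, f i • x ∈ P) →
      ∃ p : ℤ[X], (𝒢.hilb Q - 𝒢.hilb P) * ∏ i ∈ s, (1 - PowerSeries.X ^ d i) = (p : ℤ⟦X⟧) := by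
  induction s using Finset.induction_on with
  | empty =>
    intro P Q hP hQ hPs hQs hPQ hz
    -- `R` acts on `Q/P` through its quotient `k`, so `Q/P` is finite-dimensional
    have hR : ∀ r : R, ∃ c : k, ∀ x ∈ Q, r • x - c • x ∈ P := by
      intro r
      have hr : r ∈ Algebra.adjoin k (Set.range f) := hgen ▸ Algebra.mem_top
      induction hr using Algebra.adjoin_induction with
      | mem r hr =>
        obtain ⟨i, rfl⟩ := hr
        exact ⟨0, fun x hx => by simpa using hz i (by simp) x hx⟩
      | algebraMap c => exact ⟨c, fun x hx => by simp⟩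
      | add a b _ _ ha hb =>
        obtain ⟨c, hc⟩ := ha
        obtain ⟨e, he⟩ := hb
        refine ⟨c + e, fun x hx => ?_⟩
        rw [show (a + b) • x - (c + e) • x = (a • x - c • x) + (b • x - e • x) by
          rw [add_smul, add_smul]; abel]
        exact add_mem (hc x hx) (he x hx)
      | mul a b _ _ ha hb =>
        obtain ⟨c, hc⟩ := ha
        obtain ⟨e, he⟩ := hb
        refine ⟨c * e, fun x hx => ?_⟩
        rw [show (a * b) • x - (c * e) • x = (a • (b • x) - c • (b • x)) +
            c • (b • x - e • x) by rw [mul_smul, mul_smul, smul_sub]; abel]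
        exact add_mem (hc _ (hQs b x hx)) (P.smul_mem c (he x hx))
    obtain ⟨T, hT⟩ := (isNoetherian_def.1 ‹_›) hQs.toSubmodule
    have hTQ : ∀ t ∈ T, t ∈ Q := fun t ht => by
      have : t ∈ hQs.toSubmodule := hT ▸ Submodule.subset_span ht
      exact this
    choose N hN using fun t => 𝒢.exists_sum t
    have hbig : ∀ t, ∀ j, N t ≤ j → 𝒢.proj j t = 0 := fun t j hj => by
      rw [← hN t, map_sum]
      refine Finset.sum_eq_zero fun i hi => 𝒢.proj_ne _ _ _ ?_
      have := Finset.mem_range.1 hi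
      omega
    set B := T.sup N with hB
    have hQP : ∀ j, B ≤ j → ∀ x ∈ Q, 𝒢.proj j x ∈ P := by
      intro j hj x hx
      have hx' : x ∈ Submodule.span R (T : Set E) := by
        rw [hT]
        exact hx
      induction hx' using Submodule.span_induction with
      | mem x h =>
        rw [hbig x j ((Finset.le_sup h).trans hj)]
        exact zero_mem _
      | zero =>
        rw [map_zero]
        exact zero_mem _
      | add x y hx' hy' h1 h2 =>
        rw [map_add]
        refine add_mem (h1 ?_) (h2 ?_)
        · rw [hT] at hx'
          exact hx'
        · rw [hT] at hy'
          exact hy'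
      | smul r x hx' h1 =>
        rw [hT] at hx'
        obtain ⟨c, hc⟩ := hR r
        rw [show r • x = (r • x - c • x) + c • x by abel, map_add, map_smul]
        exact add_mem (hP _ _ (hc x hx')) (P.smul_mem c (h1 hx'))
    have hcoef : ∀ j, B ≤ j → PowerSeries.coeff j (𝒢.hilb Q - 𝒢.hilb P) = 0 := by
      intro j hj
      have : Q ⊓ 𝒢.piece j = P ⊓ 𝒢.piece j := by
        refine le_antisymm ?_ (inf_le_inf_right _ hPQ)
        rintro x ⟨hx, hxj⟩
        refine ⟨?_, hxj⟩
        rw [← 𝒢.mem_piece.1 hxj]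
        exact hQP j hj x hx
      rw [map_sub, 𝒢.coeff_hilb, 𝒢.coeff_hilb, this, sub_self]
    refine ⟨PowerSeries.trunc B (𝒢.hilb Q - 𝒢.hilb P), ?_⟩
    rw [Finset.prod_empty, mul_one]
    ext j
    rw [Polynomial.coeff_coe, PowerSeries.coeff_trunc]
    split_ifs with h
    · rfl
    · exact hcoef j (not_lt.1 h)
  | insert a s ha ih =>
    intro P Q hP hQ hPs hQs hPQ hz
    set y : E →ₗ[k] E := Algebra.lsmul k k E (f a) with hy
    have hyx : ∀ x, y x = f a • x := fun x => rfl
    -- the kernel and the cokernel of `f a` on `Q/P` are `P₁/P` and `Q/Q₁`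
    set Q₁ := P ⊔ Q.map y with hQ₁
    set P₁ := Q ⊓ P.comap y with hP₁
    have hshift : 𝒢.hilb Q₁ - 𝒢.hilb P = PowerSeries.X ^ d a * (𝒢.hilb Q - 𝒢.hilb P₁) :=
      VGrading.hilb_sup_map_sub (hf a) hQ hP
    have hQ₁Q : Q₁ ≤ Q := by
      refine sup_le hPQ ?_
      rintro _ ⟨x, hx, rfl⟩
      exact hQs _ _ hx
    have hPP₁ : P ≤ P₁ := fun x hx => ⟨hPQ hx, hPs _ _ hx⟩
    have hQ₁s : IsStable R Q₁ := by
      refine hPs.sup ?_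
      rintro r _ ⟨x, hx, rfl⟩
      exact ⟨r • x, hQs _ _ hx, by rw [hyx, hyx, smul_comm]⟩
    have hP₁s : IsStable R P₁ := by
      rintro r x ⟨hx, hx'⟩
      refine ⟨hQs _ _ hx, ?_⟩
      have h2 : f a • x ∈ P := hx'
      change f a • r • x ∈ P
      rw [smul_comm]
      exact hPs _ _ h2
    obtain ⟨p, hp⟩ := ih Q₁ Q (hP.sup (hQ.map (hf a))) hQ hQ₁s hQs hQ₁Q (by
      intro i hi x hx
      by_cases hia : i = a
      · subst hia
        exact Submodule.mem_sup_right ⟨x, hx, rfl⟩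
      · exact Submodule.mem_sup_left (hz i (by simp [hia, hi]) x hx))
    obtain ⟨q, hq⟩ := ih P P₁ hP (hQ.inf (hP.comap (hf a))) hPs hP₁s hPP₁ (by
      rintro i hi x ⟨hx, hx'⟩
      by_cases hia : i = a
      · subst hia
        exact hx'
      · exact hz i (by simp [hia, hi]) x hx)
    refine ⟨p - Polynomial.X ^ d a * q, ?_⟩
    rw [Finset.prod_insert ha, Polynomial.coe_sub, Polynomial.coe_mul, Polynomial.coe_pow,
      Polynomial.coe_X, ← hp, ← hq]
    linear_combination (∏ i ∈ s, (1 - PowerSeries.X ^ d i)) * hshift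

end HilbertSerre

/-! ### Values at `t = 1` from coefficientwise inequalities -/

section Analysis

/-- `q` is absolutely summable at `t`, with sum `v`. -/
def HasEval (t : ℝ) (q : ℤ⟦X⟧) (v : ℝ) : Prop :=
  (Summable fun i => ‖((PowerSeries.coeff i q : ℤ) : ℝ) * t ^ i‖) ∧
    HasSum (fun i => ((PowerSeries.coeff i q : ℤ) : ℝ) * t ^ i) v

theorem HasEval.mul {t : ℝ} {p q : ℤ⟦X⟧} {u v : ℝ} (hp : HasEval t p u) (hq : HasEval t q v) :
    HasEval t (p * q) (u * v) := by
  have h : ∀ i, ((PowerSeries.coeff i (p * q) : ℤ) : ℝ) * t ^ i =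
      ∑ kl ∈ Finset.HasAntidiagonal.antidiagonal i,
        (((PowerSeries.coeff kl.1 p : ℤ) : ℝ) * t ^ kl.1) *
        (((PowerSeries.coeff kl.2 q : ℤ) : ℝ) * t ^ kl.2) := by
    intro i
    rw [PowerSeries.coeff_mul]
    push_cast
    rw [Finset.sum_mul]
    refine Finset.sum_congr rfl fun kl hkl => ?_
    rw [← Finset.HasAntidiagonal.mem_antidiagonal.1 hkl, pow_add]
    ring
  set a : ℕ → ℝ := fun i => ((PowerSeries.coeff i p : ℤ) : ℝ) * t ^ i
  set b : ℕ → ℝ := fun i => ((PowerSeries.coeff i q : ℤ) : ℝ) * t ^ i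
  have hs : Summable fun i => ‖((PowerSeries.coeff i (p * q) : ℤ) : ℝ) * t ^ i‖ :=
    (summable_norm_sum_mul_antidiagonal_of_summable_norm (f := a) (g := b) hp.1 hq.1).congr
      fun i => by rw [h i]
  refine ⟨hs, ?_⟩
  have key := tsum_mul_tsum_eq_tsum_sum_antidiagonal_of_summable_norm (f := a) (g := b) hp.1 hq.1
  rw [show ∑' i, a i = u from hp.2.tsum_eq, show ∑' i, b i = v from hq.2.tsum_eq] at key
  rw [key, ← tsum_congr h]
  exact hs.of_norm.hasSum

theorem hasEval_coe (t : ℝ) (p : ℤ[X]) : HasEval t (p : ℤ⟦X⟧) (Polynomial.aeval t p) := by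
  have h0 : ∀ i ∉ Finset.range (p.natDegree + 1),
      ((PowerSeries.coeff i (p : ℤ⟦X⟧) : ℤ) : ℝ) * t ^ i = 0 := by
    intro i hi
    rw [Polynomial.coeff_coe, Polynomial.coeff_eq_zero_of_natDegree_lt]
    · simp
    · simpa using hi
  constructor
  · exact summable_of_ne_finset_zero (s := Finset.range (p.natDegree + 1))
      fun i hi => by rw [h0 i hi, norm_zero]
  · rw [Polynomial.aeval_eq_sum_range]
    have h := hasSum_sum_of_ne_finset_zero (L := .unconditional ℕ) h0
    simp only [Polynomial.coeff_coe] at h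
    simpa only [Polynomial.coeff_coe, zsmul_eq_mul] using h

/-- The series `1 / (1 - t ^ d)` converges to a positive value on `(0, 1)`. -/
theorem exists_hasEval_inv {t : ℝ} (h0 : 0 < t) (h1 : t < 1) {d : ℕ} (hd : 1 ≤ d) :
    ∃ (q : ℤ⟦X⟧) (v : ℝ), 0 < v ∧ HasEval t q v ∧ (1 - PowerSeries.X ^ d) * q = 1 := by
  have hs : Summable fun i => ‖((PowerSeries.coeff i
      (PowerSeries.mk fun i => if d ∣ i then (1 : ℤ) else 0) : ℤ) : ℝ) * t ^ i‖ := by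
    refine Summable.of_nonneg_of_le (fun _ => norm_nonneg _) (fun i => ?_)
      (summable_geometric_of_lt_one h0.le h1)
    rw [PowerSeries.coeff_mk]
    split_ifs
    · simp [abs_of_pos h0]
    · simp [h0.le]
  refine ⟨PowerSeries.mk fun i => if d ∣ i then (1 : ℤ) else 0, _, ?_,
    ⟨hs, hs.of_norm.hasSum⟩, ?_⟩
  · refine hs.of_norm.tsum_pos (fun i => ?_) 0 ?_
    · rw [PowerSeries.coeff_mk]
      split_ifs <;> simp [h0.le]
    · simp
  · ext i
    rw [sub_mul, one_mul, map_sub, PowerSeries.coeff_X_pow_mul', PowerSeries.coeff_mk,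
      PowerSeries.coeff_one]
    rcases lt_or_ge i d with hid | hid
    · rw [if_neg (not_le.2 hid), sub_zero]
      refine if_congr ⟨fun h => Nat.eq_zero_of_dvd_of_lt h hid, ?_⟩ rfl rfl
      rintro rfl
      exact dvd_zero d
    · rw [if_pos hid, PowerSeries.coeff_mk, if_neg (by omega : ¬i = 0)]
      have : d ∣ i - d ↔ d ∣ i := by
        rw [Nat.dvd_sub_iff_left hid (dvd_refl d)]
      rw [if_congr this rfl rfl, sub_self]

theorem exists_hasEval_prod_inv {t : ℝ} (h0 : 0 < t) (h1 : t < 1) {ι : Type*} (d : ι → ℕ)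
    (hd : ∀ i, 1 ≤ d i) (s : Finset ι) :
    ∃ (q : ℤ⟦X⟧) (v : ℝ), 0 < v ∧ HasEval t q v ∧ (∏ i ∈ s, (1 - PowerSeries.X ^ d i)) * q = 1 := by
  classical
  induction s using Finset.induction_on with
  | empty =>
    refine ⟨1, 1, one_pos, ?_, by simp⟩
    simpa using hasEval_coe t 1
  | insert a s ha ih =>
    obtain ⟨q, v, hv, hq, h⟩ := ih
    obtain ⟨q', v', hv', hq', h'⟩ := exists_hasEval_inv h0 h1 (hd a)
    refine ⟨q' * q, v' * v, mul_pos hv' hv, hq'.mul hq, ?_⟩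
    rw [Finset.prod_insert ha]
    calc _ = ((1 - PowerSeries.X ^ d a) * q') *
          ((∏ i ∈ s, (1 - PowerSeries.X ^ d i)) * q) := by ring
      _ = 1 := by rw [h, h', one_mul]

/-- If `p / ∏ (1 - t ^ dᵢ)` has nonnegative coefficients, then `p ≥ 0` on `(0, 1)`. -/
theorem aeval_nonneg_of_coeff_nonneg {ι : Type*} [Fintype ι] (d : ι → ℕ) (hd : ∀ i, 1 ≤ d i)
    {h : ℤ⟦X⟧} {p : ℤ[X]} (hp : h * ∏ i, (1 - PowerSeries.X ^ d i) = (p : ℤ⟦X⟧))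
    (hh : ∀ i, 0 ≤ PowerSeries.coeff i h) {t : ℝ} (h0 : 0 < t) (h1 : t < 1) :
    0 ≤ Polynomial.aeval t p := by
  obtain ⟨q, v, hv, hq, hinv⟩ := exists_hasEval_prod_inv h0 h1 d hd Finset.univ
  have e : h = p * q := by rw [← hp, mul_assoc, hinv, mul_one]
  have h2 := (hasEval_coe t p).mul hq
  rw [← e] at h2
  have h3 : 0 ≤ Polynomial.aeval t p * v := by
    refine h2.2.nonneg fun i => mul_nonneg ?_ (pow_nonneg h0.le i)
    exact_mod_cast hh i
  exact nonneg_of_mul_nonneg_left h3 hv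

theorem eval_one_eq_zero_of_le {L U : ℝ → ℝ} (hL : Continuous L) (hU : Continuous U)
    (h0 : ∀ t, 0 < t → t < 1 → 0 ≤ L t) (h1 : ∀ t, 0 < t → t < 1 → L t ≤ (1 - t) * U t) :
    L 1 = 0 := by
  have hne : (nhdsWithin (1 : ℝ) (Set.Ioo 0 1)).NeBot := by
    rw [← mem_closure_iff_nhdsWithin_neBot, closure_Ioo (by norm_num)]
    simp
  have t1 : Filter.Tendsto L (nhdsWithin (1 : ℝ) (Set.Ioo 0 1)) (nhds (L 1)) :=
    hL.continuousAt.tendsto.mono_left nhdsWithin_le_nhds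
  have t2 : Filter.Tendsto (fun t => (1 - t) * U t) (nhdsWithin (1 : ℝ) (Set.Ioo 0 1))
      (nhds ((1 - 1) * U 1)) :=
    (((continuous_const.sub continuous_id).mul hU).continuousAt.tendsto).mono_left
      nhdsWithin_le_nhds
  refine le_antisymm ?_ ?_
  · have := le_of_tendsto_of_tendsto t1 t2
      (Filter.eventually_of_mem self_mem_nhdsWithin fun t ht => h1 t ht.1 ht.2)
    simpa using this
  · exact ge_of_tendsto t1
      (Filter.eventually_of_mem self_mem_nhdsWithin fun t ht => h0 t ht.1 ht.2)

theorem one_sub_pow_eq (t : ℝ) (e : ℕ) : 1 - t ^ e = (1 - t) * ∑ i ∈ Finset.range e, t ^ i :=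
  (mul_neg_geom_sum t e).symm

/-- First comparison principle. A series with nonnegative coefficients that is coefficientwise at
most `(1 - t ^ e)` times another one has a pole of smaller order at `1`, so its numerator vanishes
there. -/
theorem eval_one_eq_zero_of_coeff_le {ι : Type*} [Fintype ι] (d : ι → ℕ) (hd : ∀ i, 1 ≤ d i)
    {h h' : ℤ⟦X⟧} {p p' : ℤ[X]} (hp : h * ∏ i, (1 - PowerSeries.X ^ d i) = (p : ℤ⟦X⟧))
    (hp' : h' * ∏ i, (1 - PowerSeries.X ^ d i) = (p' : ℤ⟦X⟧)) (e : ℕ)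
    (hh : ∀ i, 0 ≤ PowerSeries.coeff i h)
    (hle : ∀ i, PowerSeries.coeff i h ≤ PowerSeries.coeff i ((1 - PowerSeries.X ^ e) * h')) :
    p.eval 1 = 0 := by
  have key := eval_one_eq_zero_of_le (L := fun t => Polynomial.aeval t p)
    (U := fun t => (∑ i ∈ Finset.range e, t ^ i) * Polynomial.aeval t p')
    (Polynomial.continuous_aeval p) (by fun_prop)
    (fun t h0 h1 => aeval_nonneg_of_coeff_nonneg d hd hp hh h0 h1) (by
      intro t h0 h1
      have := aeval_nonneg_of_coeff_nonneg d hd (h := (1 - PowerSeries.X ^ e) * h' - h)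
        (p := (1 - Polynomial.X ^ e) * p' - p) (by
          push_cast
          rw [← hp, ← hp']
          ring) (fun i => by rw [map_sub]; exact sub_nonneg.2 (hle i)) h0 h1
      simp only [map_sub, map_mul, map_one, map_pow, Polynomial.aeval_X] at this
      rw [one_sub_pow_eq] at this
      linarith)
  simp only [Polynomial.aeval_def, algebraMap_int_eq] at key
  rw [← Int.cast_one, Polynomial.eval₂_at_intCast, eq_intCast] at key
  exact_mod_cast key

/-- Second comparison principle. A series with nonnegative coefficients that is coefficientwise at
most `(1 - t ^ e) (1 - t ^ e')` times another one has a numerator that vanishes to second order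
at `1`; this is the Hilbert series of a module supported in codimension two. -/
theorem derivative_eval_one_eq_zero_of_coeff_le {ι : Type*} [Fintype ι] (d : ι → ℕ)
    (hd : ∀ i, 1 ≤ d i) {h h' : ℤ⟦X⟧} {p p' : ℤ[X]}
    (hp : h * ∏ i, (1 - PowerSeries.X ^ d i) = (p : ℤ⟦X⟧))
    (hp' : h' * ∏ i, (1 - PowerSeries.X ^ d i) = (p' : ℤ⟦X⟧)) (e e' : ℕ)
    (hh : ∀ i, 0 ≤ PowerSeries.coeff i h)
    (hle : ∀ i, PowerSeries.coeff i h ≤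
      PowerSeries.coeff i ((1 - PowerSeries.X ^ e) * ((1 - PowerSeries.X ^ e') * h'))) :
    p.derivative.eval 1 = 0 := by
  have hp'' : ((1 - PowerSeries.X ^ e') * h') * ∏ i, (1 - PowerSeries.X ^ d i) =
      (((1 - Polynomial.X ^ e') * p' : ℤ[X]) : ℤ⟦X⟧) := by
    push_cast
    rw [← hp']
    ring
  have hz := eval_one_eq_zero_of_coeff_le d hd hp hp'' e hh hle
  obtain ⟨L, hL⟩ := Polynomial.dvd_iff_isRoot.2 hz
  have hd1 : p.derivative.eval 1 = L.eval 1 := by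
    rw [hL]
    simp
  rw [hd1]
  have hpt : ∀ t : ℝ, Polynomial.aeval t p = (t - 1) * Polynomial.aeval t L := by
    intro t
    rw [hL]
    simp
  have key := eval_one_eq_zero_of_le (L := fun t => - Polynomial.aeval t L)
    (U := fun t => (∑ i ∈ Finset.range e, t ^ i) * ((∑ i ∈ Finset.range e', t ^ i) *
      Polynomial.aeval t p'))
    (Polynomial.continuous_aeval L).neg (by fun_prop)
    (fun t h0 h1 => by
      have := aeval_nonneg_of_coeff_nonneg d hd hp hh h0 h1
      rw [hpt] at this
      nlinarith) (by
      intro t h0 h1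
      have := aeval_nonneg_of_coeff_nonneg d hd
        (h := (1 - PowerSeries.X ^ e) * ((1 - PowerSeries.X ^ e') * h') - h)
        (p := (1 - Polynomial.X ^ e) * ((1 - Polynomial.X ^ e') * p') - p) (by
          push_cast
          rw [← hp, ← hp']
          ring) (fun i => by rw [map_sub]; exact sub_nonneg.2 (hle i)) h0 h1
      simp only [map_sub, map_mul, map_one, map_pow, Polynomial.aeval_X] at this
      rw [one_sub_pow_eq, one_sub_pow_eq, hpt] at this
      have h2 : 0 ≤ (1 - t) * ((1 - t) * ((∑ i ∈ Finset.range e, t ^ i) *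
          ((∑ i ∈ Finset.range e', t ^ i) * Polynomial.aeval t p')) + Polynomial.aeval t L) := by
        linarith
      have h3 := nonneg_of_mul_nonneg_right h2 (by linarith)
      linarith)
  simp only [Polynomial.aeval_def, neg_eq_zero, algebraMap_int_eq] at key
  rw [← Int.cast_one, Polynomial.eval₂_at_intCast, eq_intCast] at key
  exact_mod_cast key

end Analysis

/-! ### The gradings on polynomials, invariants and covariants -/

section Gradings

variable {n : ℕ}

theorem homogeneousComponent_mul_of_isHomogeneous {p : MvPolynomial (Fin n) ℂ} {a : ℕ}
    (hp : p.IsHomogeneous a) (i : ℕ)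
    (q : MvPolynomial (Fin n) ℂ) : MvPolynomial.homogeneousComponent (i + a) (p * q) =
      p * MvPolynomial.homogeneousComponent i q := by
  have h1 : ∀ j, MvPolynomial.homogeneousComponent (i + a)
      (p * MvPolynomial.homogeneousComponent j q) =
      if i = j then p * MvPolynomial.homogeneousComponent j q else 0 := by
    intro j
    rw [MvPolynomial.homogeneousComponent_of_mem
      (hp.mul (MvPolynomial.homogeneousComponent_isHomogeneous j q))]
    exact if_congr ⟨fun h => by omega, fun h => by omega⟩ rfl rfl
  conv_lhs => rw [← MvPolynomial.sum_homogeneousComponent q, Finset.mul_sum, map_sum]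
  simp only [h1, Finset.sum_ite_eq, Finset.mem_range]
  split_ifs with h
  · rfl
  · rw [MvPolynomial.homogeneousComponent_eq_zero _ _ (by omega), mul_zero]

theorem isHomogeneous_iff_homogeneousComponent {p : MvPolynomial (Fin n) ℂ} {i : ℕ} :
    MvPolynomial.homogeneousComponent i p = p ↔ p.IsHomogeneous i :=
  ⟨fun h => h ▸ MvPolynomial.homogeneousComponent_isHomogeneous i p,
    MvPolynomial.homogeneousComponent_eq_self⟩

theorem finite_range_homogeneousComponent (i : ℕ) :
    FiniteDimensional ℂ (LinearMap.range
      (MvPolynomial.homogeneousComponent (σ := Fin n) (R := ℂ) i)) := by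
  have : LinearMap.range (MvPolynomial.homogeneousComponent (σ := Fin n) (R := ℂ) i) ≤
      MvPolynomial.restrictTotalDegree (Fin n) ℂ i := by
    rintro _ ⟨p, rfl⟩
    rw [MvPolynomial.mem_restrictTotalDegree]
    exact (MvPolynomial.homogeneousComponent_isHomogeneous i p).totalDegree_le
  exact Submodule.finiteDimensional_of_le this

theorem homogeneousComponent_self (i : ℕ) (p : MvPolynomial (Fin n) ℂ) :
    MvPolynomial.homogeneousComponent i (MvPolynomial.homogeneousComponent i p) =
      MvPolynomial.homogeneousComponent i p :=
  MvPolynomial.homogeneousComponent_eq_self (MvPolynomial.homogeneousComponent_isHomogeneous i p)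

theorem homogeneousComponent_ne {i j : ℕ} (h : i ≠ j) (p : MvPolynomial (Fin n) ℂ) :
    MvPolynomial.homogeneousComponent i (MvPolynomial.homogeneousComponent j p) = 0 := by
  rw [MvPolynomial.homogeneousComponent_of_mem
    (MvPolynomial.homogeneousComponent_isHomogeneous j p), if_neg h]

theorem sum_homogeneousComponent_of_lt {p : MvPolynomial (Fin n) ℂ} {N : ℕ}
    (h : p.totalDegree < N) :
    ∑ i ∈ Finset.range N, MvPolynomial.homogeneousComponent i p = p := by
  conv_rhs => rw [← MvPolynomial.sum_homogeneousComponent p]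
  refine (Finset.sum_subset (Finset.range_mono h) fun i _ hi => ?_).symm
  exact MvPolynomial.homogeneousComponent_eq_zero _ _ (by simpa using hi)

theorem polyAct_isHomogeneous (g : GL (Fin n) ℂ) {p : MvPolynomial (Fin n) ℂ} {i : ℕ}
    (hp : p.IsHomogeneous i) :
    (polyAct g p).IsHomogeneous i := by
  have h := hp.aeval (fun j => ∑ i, MvPolynomial.C (g.val i j) * MvPolynomial.X i) (n := 1)
    fun j => MvPolynomial.IsHomogeneous.sum _ _ _ fun i _ =>
      (MvPolynomial.isHomogeneous_X ℂ i).C_mul _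
  rwa [one_mul] at h

theorem polyAct_homogeneousComponent (g : GL (Fin n) ℂ) (i : ℕ) (p : MvPolynomial (Fin n) ℂ) :
    polyAct g (MvPolynomial.homogeneousComponent i p) =
      MvPolynomial.homogeneousComponent i (polyAct g p) := by
  conv_rhs => rw [← MvPolynomial.sum_homogeneousComponent p, map_sum, map_sum]
  have h1 : ∀ j, MvPolynomial.homogeneousComponent i
      (polyAct g (MvPolynomial.homogeneousComponent j p)) =
      if i = j then polyAct g (MvPolynomial.homogeneousComponent j p) else 0 := fun j =>
    MvPolynomial.homogeneousComponent_of_mem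
      (polyAct_isHomogeneous g (MvPolynomial.homogeneousComponent_isHomogeneous j p))
  simp only [h1, Finset.sum_ite_eq, Finset.mem_range]
  split_ifs with h
  · rfl
  · rw [MvPolynomial.homogeneousComponent_eq_zero _ _ (by omega), map_zero]

theorem homogeneousComponent_mem_invariantRing {G : Subgroup (GL (Fin n) ℂ)}
    {p : MvPolynomial (Fin n) ℂ}
    (hp : p ∈ invariantRing G) (i : ℕ) :
    MvPolynomial.homogeneousComponent i p ∈ invariantRing G := fun g hg => by
  rw [polyAct_homogeneousComponent, hp g hg]

/-- The grading of the invariant ring by degree. -/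
noncomputable def invGrading (G : Subgroup (GL (Fin n) ℂ)) : VGrading ℂ (invariantRing G) where
  proj i := (MvPolynomial.homogeneousComponent i).restrict
    (p := Subalgebra.toSubmodule (invariantRing G)) (q := Subalgebra.toSubmodule (invariantRing G))
    fun _ hp => homogeneousComponent_mem_invariantRing hp i
  proj_self i x := Subtype.ext (homogeneousComponent_self i x.1)
  proj_ne i j x h := Subtype.ext (homogeneousComponent_ne h x.1)
  exists_sum x := ⟨x.1.totalDegree + 1, Subtype.ext <| by
    rw [AddSubmonoidClass.coe_finsetSum]
    exact MvPolynomial.sum_homogeneousComponent x.1⟩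
  finite i := by
    have := finite_range_homogeneousComponent (n := n) i
    refine Module.Finite.of_injective
      (N := LinearMap.range (MvPolynomial.homogeneousComponent (σ := Fin n) (R := ℂ) i))
      (LinearMap.restrict (Subalgebra.toSubmodule (invariantRing G)).subtype
        (q := LinearMap.range (MvPolynomial.homogeneousComponent (σ := Fin n) (R := ℂ) i)) ?_) ?_
    · rintro _ ⟨y, rfl⟩
      exact ⟨y.1, rfl⟩
    · intro x y h
      have h' := congrArg (fun u : LinearMap.range
        (MvPolynomial.homogeneousComponent (σ := Fin n) (R := ℂ) i) => u.1) h
      exact Subtype.ext (Subtype.ext h')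

theorem invGrading_proj_val {G : Subgroup (GL (Fin n) ℂ)} (i : ℕ) (x : invariantRing G) :
    ((invGrading G).proj i x : MvPolynomial (Fin n) ℂ) =
      MvPolynomial.homogeneousComponent i (x : MvPolynomial (Fin n) ℂ) := rfl

/-- The homogeneous component of degree `i` of a linear map with values in `S`. -/
noncomputable def homComponent (n : ℕ) (W : Type*) [AddCommGroup W] [Module ℂ W] (i : ℕ) :
    (W →ₗ[ℂ] MvPolynomial (Fin n) ℂ) →ₗ[ℂ] (W →ₗ[ℂ] MvPolynomial (Fin n) ℂ) where
  toFun φ := (MvPolynomial.homogeneousComponent i).comp φ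
  map_add' _ _ := LinearMap.comp_add _ _ _
  map_smul' _ _ := LinearMap.comp_smul _ _ _

/-- The grading of `Hom(W, S)` by the degree of the values. -/
noncomputable def homGrading (n : ℕ) (W : Type*) [AddCommGroup W] [Module ℂ W]
    [FiniteDimensional ℂ W] : VGrading ℂ (W →ₗ[ℂ] MvPolynomial (Fin n) ℂ) where
  proj := homComponent n W
  proj_self i x := LinearMap.ext fun w => homogeneousComponent_self i (x w)
  proj_ne i j x h := LinearMap.ext fun w => homogeneousComponent_ne h (x w)
  exists_sum x := by
    let b := Module.finBasis ℂ W
    refine ⟨(Finset.univ.sup fun j => (x (b j)).totalDegree) + 1, b.ext fun j => ?_⟩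
    rw [LinearMap.sum_apply]
    exact sum_homogeneousComponent_of_lt (Nat.lt_succ_of_le
      (Finset.le_sup (f := fun j => (x (b j)).totalDegree) (Finset.mem_univ j)))
  finite i := by
    have := finite_range_homogeneousComponent (n := n) i
    let F : LinearMap.range (homComponent n W i) →ₗ[ℂ]
        (W →ₗ[ℂ] LinearMap.range (MvPolynomial.homogeneousComponent (σ := Fin n) (R := ℂ) i)) :=
      { toFun := fun φ => φ.1.codRestrict _ fun w => by
          obtain ⟨ψ, hψ⟩ := φ.2
          exact ⟨ψ w, LinearMap.congr_fun hψ w⟩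
        map_add' := fun _ _ => rfl
        map_smul' := fun _ _ => rfl }
    refine Module.Finite.of_injective F fun x y h => ?_
    refine Subtype.ext (LinearMap.ext fun w => ?_)
    exact congrArg Subtype.val (LinearMap.congr_fun h w)

variable {W : Type*} [AddCommGroup W] [Module ℂ W]

/-- The map `R → Hom(W, S)`, `r ↦ r φ`. -/
noncomputable def orbitMap (G : Subgroup (GL (Fin n) ℂ)) (φ : W →ₗ[ℂ] MvPolynomial (Fin n) ℂ) :
    invariantRing G →ₗ[ℂ] (W →ₗ[ℂ] MvPolynomial (Fin n) ℂ) :=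
  (LinearMap.toSpanSingleton (invariantRing G) (W →ₗ[ℂ] MvPolynomial (Fin n) ℂ) φ).restrictScalars ℂ

theorem orbitMap_apply (G : Subgroup (GL (Fin n) ℂ)) (φ : W →ₗ[ℂ] MvPolynomial (Fin n) ℂ)
    (r : invariantRing G) :
    orbitMap G φ r = r • φ := rfl

variable [FiniteDimensional ℂ W]

theorem homGrading_proj_apply (i : ℕ) (φ : W →ₗ[ℂ] MvPolynomial (Fin n) ℂ) (w : W) :
    (homGrading n W).proj i φ w = MvPolynomial.homogeneousComponent i (φ w) := rfl

theorem mem_homGrading_piece {i : ℕ} {φ : W →ₗ[ℂ] MvPolynomial (Fin n) ℂ} :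
    φ ∈ (homGrading n W).piece i ↔ ∀ w, (φ w).IsHomogeneous i := by
  rw [VGrading.mem_piece]
  constructor
  · intro h w
    rw [← isHomogeneous_iff_homogeneousComponent]
    exact LinearMap.congr_fun h w
  · intro h
    exact LinearMap.ext fun w => isHomogeneous_iff_homogeneousComponent.2 (h w)

theorem mem_invGrading_piece {G : Subgroup (GL (Fin n) ℂ)} {i : ℕ} {x : invariantRing G} :
    x ∈ (invGrading G).piece i ↔ (x : MvPolynomial (Fin n) ℂ).IsHomogeneous i := by
  rw [VGrading.mem_piece, ← isHomogeneous_iff_homogeneousComponent, Subtype.ext_iff]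
  rfl

theorem isHomogMap_lsmul_inv {G : Subgroup (GL (Fin n) ℂ)} (r : invariantRing G) {a : ℕ}
    (hr : (r : MvPolynomial (Fin n) ℂ).IsHomogeneous a) : (invGrading G).IsHomogMap (invGrading G) a
      (Algebra.lsmul ℂ ℂ (invariantRing G) r) := fun i x =>
  Subtype.ext (homogeneousComponent_mul_of_isHomogeneous hr i x.1)

theorem isHomogMap_lsmul_hom {G : Subgroup (GL (Fin n) ℂ)} (r : invariantRing G) {a : ℕ}
    (hr : (r : MvPolynomial (Fin n) ℂ).IsHomogeneous a) :
    (homGrading n W).IsHomogMap (homGrading n W) a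
      (Algebra.lsmul ℂ ℂ (W →ₗ[ℂ] MvPolynomial (Fin n) ℂ) r) := fun i x =>
  LinearMap.ext fun w => homogeneousComponent_mul_of_isHomogeneous hr i (x w)

theorem isHomogMap_orbitMap (G : Subgroup (GL (Fin n) ℂ)) {φ : W →ₗ[ℂ] MvPolynomial (Fin n) ℂ}
    {a : ℕ}
    (hφ : φ ∈ (homGrading n W).piece a) :
    (invGrading G).IsHomogMap (homGrading n W) a (orbitMap G φ) := fun i x =>
  LinearMap.ext fun w => by
    rw [homGrading_proj_apply, orbitMap_apply, orbitMap_apply]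
    change MvPolynomial.homogeneousComponent (i + a) (x.1 * φ w) =
      MvPolynomial.homogeneousComponent i x.1 * φ w
    rw [mul_comm, homogeneousComponent_mul_of_isHomogeneous (mem_homGrading_piece.1 hφ w),
      mul_comm]

end Gradings

/-! ### The invariant ring -/

section InvariantRing

variable {n : ℕ} {G : Subgroup (GL (Fin n) ℂ)}

/-- The action of `G` on `S` by ring automorphisms. -/
@[reducible] noncomputable def polyMulSemiringAction (G : Subgroup (GL (Fin n) ℂ)) :
    MulSemiringAction G (MvPolynomial (Fin n) ℂ) where
  smul g p := polyAct (g : GL (Fin n) ℂ) p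
  one_smul p := by
    exact DFunLike.congr_fun polyAct_one p
  mul_smul g h p := by
    exact DFunLike.congr_fun (polyAct_mul (g : GL (Fin n) ℂ) (h : GL (Fin n) ℂ)) p
  smul_zero g := map_zero (polyAct (g : GL (Fin n) ℂ))
  smul_add g := map_add (polyAct (g : GL (Fin n) ℂ))
  smul_one g := map_one (polyAct (g : GL (Fin n) ℂ))
  smul_mul g := map_mul (polyAct (g : GL (Fin n) ℂ))

/-- `S` is a finite module over `R`. -/
theorem finite_invariantRing [Finite G] :
    Module.Finite (invariantRing G) (MvPolynomial (Fin n) ℂ) := by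
  let := polyMulSemiringAction G
  have : Algebra.IsInvariant (invariantRing G) (MvPolynomial (Fin n) ℂ) G :=
    ⟨fun b hb => ⟨⟨b, fun g hg => hb ⟨g, hg⟩⟩, rfl⟩⟩
  have : Algebra.IsIntegral (invariantRing G) (MvPolynomial (Fin n) ℂ) :=
    Algebra.IsInvariant.isIntegral _ _ G
  have : Algebra.FiniteType (invariantRing G) (MvPolynomial (Fin n) ℂ) :=
    Algebra.FiniteType.of_restrictScalars_finiteType ℂ _ _
  exact Algebra.IsIntegral.finite

variable {f : Fin n → MvPolynomial (Fin n) ℂ} {d : Fin n → ℕ}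

namespace IsBasicInvariants

/-- The basic invariants as elements of `R`. -/
def inv (hf : IsBasicInvariants G f d) (i : Fin n) : invariantRing G :=
  ⟨f i, fun g hg => hf.polyAct_eq g hg i⟩

/-- `R` is a polynomial ring. -/
noncomputable def equiv (hf : IsBasicInvariants G f d) :
    MvPolynomial (Fin n) ℂ ≃ₐ[ℂ] invariantRing G :=
  hf.algebraicIndependent.aevalEquiv.trans (Subalgebra.equivOfEq _ _ hf.adjoin_eq)

theorem equiv_X (hf : IsBasicInvariants G f d) (i : Fin n) :
    hf.equiv (MvPolynomial.X i) = hf.inv i := by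
  refine Subtype.ext ?_
  have := hf.algebraicIndependent.algebraMap_aevalEquiv (MvPolynomial.X i)
  rw [MvPolynomial.aeval_X] at this
  exact this

theorem adjoin_inv (hf : IsBasicInvariants G f d) :
    Algebra.adjoin ℂ (Set.range hf.inv) = ⊤ := by
  have h : Set.range hf.inv = hf.equiv.toAlgHom '' Set.range MvPolynomial.X := by
    rw [← Set.range_comp]
    exact congrArg Set.range (funext fun i => (hf.equiv_X i).symm)
  rw [h, ← AlgHom.map_adjoin, MvPolynomial.adjoin_range_X, Algebra.map_top, AlgHom.range_eq_top]
  exact hf.equiv.surjective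

theorem isNoetherianRing (hf : IsBasicInvariants G f d) : IsNoetherianRing (invariantRing G) :=
  isNoetherianRing_of_ringEquiv (MvPolynomial (Fin n) ℂ) hf.equiv.toRingEquiv

theorem uniqueFactorizationMonoid (hf : IsBasicInvariants G f d) :
    UniqueFactorizationMonoid (invariantRing G) :=
  hf.equiv.toMulEquiv.uniqueFactorizationMonoid inferInstance

theorem isNoetherian_hom [Finite G] (hf : IsBasicInvariants G f d) (W : Type*) [AddCommGroup W]
    [Module ℂ W] [FiniteDimensional ℂ W] : IsNoetherian (invariantRing G)
      (W →ₗ[ℂ] MvPolynomial (Fin n) ℂ) := by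
  have := hf.isNoetherianRing
  have := finite_invariantRing (G := G)
  let b := Module.finBasis ℂ W
  let F : (W →ₗ[ℂ] MvPolynomial (Fin n) ℂ) →ₗ[invariantRing G]
      (Fin (Module.finrank ℂ W) → MvPolynomial (Fin n) ℂ) :=
    { toFun := fun φ j => φ (b j)
      map_add' := fun _ _ => rfl
      map_smul' := fun _ _ => rfl }
  exact isNoetherian_of_injective F fun x y h => b.ext fun j => congrFun h j

/-- The ideal of `R` generated by the basic invariants with index in `s`, as a subspace. -/
noncomputable def idealOf (hf : IsBasicInvariants G f d) (s : Finset (Fin n)) :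
    Submodule ℂ (invariantRing G) :=
  (Ideal.span (hf.inv '' s)).restrictScalars ℂ

theorem mem_idealOf_equiv (hf : IsBasicInvariants G f d) (s : Finset (Fin n))
    (p : MvPolynomial (Fin n) ℂ) :
    hf.equiv p ∈ hf.idealOf s ↔
      p ∈ Ideal.span (MvPolynomial.X '' (s : Set (Fin n)) : Set (MvPolynomial (Fin n) ℂ)) := by
  have h : Ideal.span (hf.inv '' s) =
      (Ideal.span (MvPolynomial.X '' (s : Set (Fin n)) :
        Set (MvPolynomial (Fin n) ℂ))).map hf.equiv.toRingEquiv := by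
    rw [Ideal.map_span, ← Set.image_comp]
    exact congrArg Ideal.span (Set.image_congr fun i _ => (hf.equiv_X i).symm)
  rw [idealOf, Submodule.restrictScalars_mem, h]
  exact Ideal.mem_map_of_equiv hf.equiv.toRingEquiv _ |>.trans
    ⟨fun ⟨x, hx, hxp⟩ => hf.equiv.injective hxp ▸ hx, fun hp => ⟨p, hp, rfl⟩⟩

/-- The basic invariants form a regular sequence in `R`. -/
theorem comap_idealOf (hf : IsBasicInvariants G f d) {s : Finset (Fin n)} {a : Fin n}
    (ha : a ∉ s) :
    (hf.idealOf s).comap (Algebra.lsmul ℂ ℂ (invariantRing G) (hf.inv a)) = hf.idealOf s := by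
  refine le_antisymm (fun x hx => ?_) fun x hx => Ideal.mul_mem_left _ _ hx
  obtain ⟨p, rfl⟩ := hf.equiv.surjective x
  have hx' : hf.inv a * hf.equiv p ∈ hf.idealOf s := hx
  rw [← hf.equiv_X, ← map_mul, mem_idealOf_equiv, MvPolynomial.mem_ideal_span_X_image] at hx'
  rw [mem_idealOf_equiv, MvPolynomial.mem_ideal_span_X_image]
  intro m hm
  obtain ⟨i, hi, hmi⟩ := hx' (Finsupp.single a 1 + m) (by
    rw [MvPolynomial.mem_support_iff, MvPolynomial.coeff_X_mul]
    exact MvPolynomial.mem_support_iff.1 hm)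
  refine ⟨i, hi, ?_⟩
  have : i ≠ a := fun h => ha (h ▸ hi)
  rwa [Finsupp.add_apply, Finsupp.single_apply, if_neg (Ne.symm this), zero_add] at hmi

theorem idealOf_insert (hf : IsBasicInvariants G f d) (s : Finset (Fin n)) (a : Fin n) :
    hf.idealOf (insert a s) =
      hf.idealOf s ⊔ (⊤ : Submodule ℂ _).map (Algebra.lsmul ℂ ℂ (invariantRing G) (hf.inv a)) := by
  ext x
  rw [idealOf, Finset.coe_insert, Set.image_insert_eq, Submodule.restrictScalars_mem,
    Ideal.mem_span_insert, Submodule.mem_sup]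
  constructor
  · rintro ⟨c, z, hz, rfl⟩
    exact ⟨z, hz, _, ⟨c, trivial, rfl⟩, by
      change z + hf.inv a * c = _
      ring⟩
  · rintro ⟨z, hz, _, ⟨c, -, rfl⟩, rfl⟩
    exact ⟨c, z, hz, by
      change z + hf.inv a * c = _
      ring⟩

theorem isHomog_idealOf (hf : IsBasicInvariants G f d) (s : Finset (Fin n)) :
    (invGrading G).IsHomog (hf.idealOf s) := by
  induction s using Finset.induction_on with
  | empty =>
    have : hf.idealOf ∅ = ⊥ := by
      ext
      simp [idealOf]
    rw [this]
    exact VGrading.isHomog_bot _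
  | insert a s ha ih =>
    rw [idealOf_insert]
    exact ih.sup ((VGrading.isHomog_top _).map (isHomogMap_lsmul_inv _ (hf.isHomogeneous a)))

/-- Induction along the regular sequence of basic invariants. -/
theorem hilb_top_sub_idealOf (hf : IsBasicInvariants G f d) (s : Finset (Fin n)) :
    (invGrading G).hilb ⊤ - (invGrading G).hilb (hf.idealOf s) =
      (invGrading G).hilb ⊤ * ∏ i ∈ s, (1 - PowerSeries.X ^ d i) := by
  induction s using Finset.induction_on with
  | empty =>
    have : hf.idealOf ∅ = ⊥ := by
      ext
      simp [idealOf]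
    rw [this, VGrading.hilb_bot]
    simp
  | insert a s ha ih =>
    have h := VGrading.hilb_sup_map_sub (isHomogMap_lsmul_inv (hf.inv a) (hf.isHomogeneous a))
      (VGrading.isHomog_top _) (hf.isHomog_idealOf s)
    rw [← idealOf_insert, hf.comap_idealOf ha, top_inf_eq] at h
    rw [Finset.prod_insert ha]
    linear_combination (1 - PowerSeries.X ^ d a) * ih - h

theorem exists_sub_mem_idealOf (hf : IsBasicInvariants G f d) (x : invariantRing G) :
    ∃ c : ℂ, x - algebraMap ℂ _ c ∈ hf.idealOf Finset.univ := by
  obtain ⟨p, rfl⟩ := hf.equiv.surjective x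
  refine ⟨MvPolynomial.coeff 0 p, ?_⟩
  rw [← hf.equiv.commutes, ← map_sub, mem_idealOf_equiv, MvPolynomial.mem_ideal_span_X_image]
  intro m hm
  by_contra hcon
  push Not at hcon
  have hm0 : m = 0 := Finsupp.ext fun i => hcon i (by simp)
  rw [MvPolynomial.mem_support_iff, hm0, MvPolynomial.coeff_sub, MvPolynomial.algebraMap_eq,
    MvPolynomial.coeff_C, if_pos rfl, sub_self] at hm
  exact hm rfl

theorem coeff_zero_of_mem_idealOf (hf : IsBasicInvariants G f d) (s : Finset (Fin n))
    {x : invariantRing G} (hx : x ∈ hf.idealOf s) :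
    MvPolynomial.coeff 0 (x : MvPolynomial (Fin n) ℂ) = 0 := by
  have h : Ideal.span (hf.inv '' s) ≤ RingHom.ker
      ((MvPolynomial.constantCoeff (σ := Fin n) (R := ℂ)).comp
        (invariantRing G).val.toRingHom) := by
    rw [Ideal.span_le]
    rintro _ ⟨i, -, rfl⟩
    change MvPolynomial.coeff 0 (f i) = 0
    refine (hf.isHomogeneous i).coeff_eq_zero ?_
    have := hf.one_le_degree i
    simp only [map_zero]
    omega
  exact h hx

/-- The Hilbert series of `R` is `1 / ∏ (1 - t ^ dᵢ)`. -/
theorem hilb_invariantRing (hf : IsBasicInvariants G f d) :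
    (invGrading G).hilb ⊤ * ∏ i, (1 - PowerSeries.X ^ d i) = 1 := by
  rw [← hf.hilb_top_sub_idealOf]
  ext j
  rw [map_sub, VGrading.coeff_hilb, VGrading.coeff_hilb, PowerSeries.coeff_one]
  split_ifs with hj
  · subst hj
    have h1 : hf.idealOf Finset.univ ⊓ (invGrading G).piece 0 = ⊥ := by
      rw [eq_bot_iff]
      rintro x ⟨hx, hx0⟩
      have h2 := ((invGrading G).mem_piece).1 hx0
      rw [Subtype.ext_iff, invGrading_proj_val, MvPolynomial.homogeneousComponent_zero,
        hf.coeff_zero_of_mem_idealOf _ hx, map_zero] at h2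
      exact Subtype.ext h2.symm
    have h3 : ⊤ ⊓ (invGrading G).piece 0 = Submodule.span ℂ {1} := by
      ext x
      rw [top_inf_eq, Submodule.mem_span_singleton, VGrading.mem_piece, Subtype.ext_iff,
        invGrading_proj_val, MvPolynomial.homogeneousComponent_zero]
      constructor
      · intro h
        exact ⟨_, Subtype.ext (by
          rw [← h, ← mul_one (MvPolynomial.C _), ← MvPolynomial.smul_eq_C_mul]
          rfl)⟩
      · rintro ⟨c, rfl⟩
        change MvPolynomial.C (MvPolynomial.coeff 0 (c • (1 : MvPolynomial (Fin n) ℂ))) =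
          c • (1 : MvPolynomial (Fin n) ℂ)
        rw [MvPolynomial.smul_eq_C_mul, mul_one, MvPolynomial.coeff_C, if_pos rfl]
    rw [h1, h3, finrank_bot, finrank_span_singleton one_ne_zero]
    simp
  · have : hf.idealOf Finset.univ ⊓ (invGrading G).piece j = ⊤ ⊓ (invGrading G).piece j := by
      refine le_antisymm (inf_le_inf_right _ le_top) ?_
      rintro x ⟨-, hxj⟩
      refine ⟨?_, hxj⟩
      obtain ⟨c, hc⟩ := hf.exists_sub_mem_idealOf x
      have h2 := hf.isHomog_idealOf _ j _ hc
      rw [map_sub, ((invGrading G).mem_piece).1 hxj] at h2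
      have h3 : (invGrading G).proj j (algebraMap ℂ _ c) = 0 := by
        refine Subtype.ext ?_
        rw [invGrading_proj_val]
        change MvPolynomial.homogeneousComponent j (MvPolynomial.C c) = 0
        rw [MvPolynomial.homogeneousComponent_of_mem (MvPolynomial.isHomogeneous_C _ c), if_neg hj]
      rwa [h3, sub_zero] at h2
    rw [this, sub_self]

end IsBasicInvariants

end InvariantRing

/-! ### The Jacobian and the discriminant -/

section Discriminant

variable {n : ℕ} {G : Subgroup (GL (Fin n) ℂ)}

/-- The product of the lowest components of two polynomials is a component of the product. -/
theorem exists_homogeneousComponent_mul_ne_zero {p q : MvPolynomial (Fin n) ℂ} (hp : p ≠ 0)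
    (hq : q ≠ 0) :
    ∃ i j, (∀ i' < i, MvPolynomial.homogeneousComponent i' p = 0) ∧
      MvPolynomial.homogeneousComponent i p ≠ 0 ∧ MvPolynomial.homogeneousComponent j q ≠ 0 ∧
      MvPolynomial.homogeneousComponent (i + j) (p * q) =
        MvPolynomial.homogeneousComponent i p * MvPolynomial.homogeneousComponent j q := by
  classical
  have hex : ∀ {r : MvPolynomial (Fin n) ℂ}, r ≠ 0 →
      ∃ i, MvPolynomial.homogeneousComponent i r ≠ 0 := by
    intro r hr
    by_contra hcon
    push Not at hcon
    refine hr ?_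
    rw [← MvPolynomial.sum_homogeneousComponent r]
    exact Finset.sum_eq_zero fun i _ => hcon i
  have hi := Nat.find_spec (hex hp)
  have hi' := fun i => Nat.find_min (m := i) (hex hp)
  have hj := Nat.find_spec (hex hq)
  have hj' := fun j => Nat.find_min (m := j) (hex hq)
  set i := Nat.find (hex hp)
  set j := Nat.find (hex hq)
  refine ⟨i, j, fun i' h => not_not.1 (hi' i' h), hi, hj, ?_⟩
  have hle : ∀ {r : MvPolynomial (Fin n) ℂ} {l : ℕ}, MvPolynomial.homogeneousComponent l r ≠ 0 →
      l < r.totalDegree + 1 :=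
    fun {r l} h => by
      by_contra hcon
      exact h (MvPolynomial.homogeneousComponent_eq_zero _ _ (by omega))
  have hterm : ∀ a b, MvPolynomial.homogeneousComponent (i + j)
      (MvPolynomial.homogeneousComponent a p * MvPolynomial.homogeneousComponent b q) =
      if a = i then if b = j then
        MvPolynomial.homogeneousComponent i p * MvPolynomial.homogeneousComponent j q
      else 0 else 0 := by
    intro a b
    rw [MvPolynomial.homogeneousComponent_of_mem
      ((MvPolynomial.homogeneousComponent_isHomogeneous a p).mul
        (MvPolynomial.homogeneousComponent_isHomogeneous b q))]
    split_ifs with h1 h2 h3 h2 h3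
    · rw [h2, h3]
    · omega
    · rcases lt_or_gt_of_ne h2 with h | h
      · rw [not_not.1 (hi' a h), zero_mul]
      · rw [not_not.1 (hj' b (by omega)), mul_zero]
    · omega
    · rfl
    · rfl
  conv_lhs => rw [← MvPolynomial.sum_homogeneousComponent p,
    ← MvPolynomial.sum_homogeneousComponent q, Finset.sum_mul_sum]
  simp only [map_sum, hterm]
  rw [Finset.sum_eq_single_of_mem i (Finset.mem_range.2 (hle hi)) (fun a _ ha => by simp [ha]),
    Finset.sum_eq_single_of_mem j (Finset.mem_range.2 (hle hj)) (fun a _ ha => by simp [ha])]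
  simp

/-- A factor of a nonzero homogeneous polynomial is homogeneous. -/
theorem isHomogeneous_of_dvd {p r : MvPolynomial (Fin n) ℂ} {N : ℕ} (hr : r.IsHomogeneous N)
    (hr0 : r ≠ 0)
    (h : p ∣ r) : p.IsHomogeneous p.totalDegree := by
  obtain ⟨q, rfl⟩ := h
  have hp : p ≠ 0 := left_ne_zero_of_mul hr0
  have hq : q ≠ 0 := right_ne_zero_of_mul hr0
  have hdeg := MvPolynomial.totalDegree_mul_of_isDomain hp hq
  rw [hr.totalDegree hr0] at hdeg
  have hp' : ∀ i, MvPolynomial.homogeneousComponent i p ≠ 0 → i = p.totalDegree := by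
    -- any component of `p` has degree between the lowest and the highest one; these agree
    obtain ⟨i₀, j₀, hmin, hi₀, hj₀, he⟩ := exists_homogeneousComponent_mul_ne_zero hp hq
    have hle : ∀ {r : MvPolynomial (Fin n) ℂ} {l : ℕ}, MvPolynomial.homogeneousComponent l r ≠ 0 →
        l ≤ r.totalDegree :=
      fun {r l} h => by
        by_contra hcon
        exact h (MvPolynomial.homogeneousComponent_eq_zero _ _ (by omega))
    have hN : i₀ + j₀ = N := by
      by_contra hcon
      rw [MvPolynomial.homogeneousComponent_of_mem hr, if_neg hcon] at he
      exact mul_ne_zero hi₀ hj₀ he.symm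
    intro i hi
    have h1 := hle hi₀
    have h2 := hle hj₀
    have h3 := hle hi
    have h4 : i₀ ≤ i := by
      by_contra hcon
      exact hi (hmin i (by omega))
    omega
  rw [← isHomogeneous_iff_homogeneousComponent]
  conv_rhs => rw [← MvPolynomial.sum_homogeneousComponent p]
  rw [Finset.sum_eq_single_of_mem p.totalDegree (by simp) fun i _ hi => by
    by_contra hcon
    exact hi (hp' i hcon)]

variable {f : Fin n → MvPolynomial (Fin n) ℂ} {d : Fin n → ℕ}

namespace IsBasicInvariants

theorem isHomogeneous_jacobian (hf : IsBasicInvariants G f d) :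
    (jacobian f).IsHomogeneous (∑ i, (d i - 1)) := by
  rw [jacobian, Matrix.det_apply]
  refine MvPolynomial.IsHomogeneous.sum _ _ _ fun σ _ => ?_
  have h : (∏ i, (Matrix.of fun i j => MvPolynomial.pderiv j (f i)) (σ i) i).IsHomogeneous
      (∑ i, (d i - 1)) := by
    rw [← Equiv.sum_comp σ fun i => d i - 1]
    exact MvPolynomial.IsHomogeneous.prod _ _ _ fun i _ => (hf.isHomogeneous (σ i)).pderiv
  rcases Int.units_eq_one_or (Equiv.Perm.sign σ) with h1 | h1
  · rw [h1, one_smul]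
    exact h
  · rw [h1, Units.neg_smul, one_smul]
    exact h.neg

end IsBasicInvariants

theorem polyAct_inv_apply (g : GL (Fin n) ℂ) (p : MvPolynomial (Fin n) ℂ) :
    polyAct g⁻¹ (polyAct g p) = p := by
  rw [← AlgHom.comp_apply, ← polyAct_mul, inv_mul_cancel, polyAct_one]
  rfl

theorem polyAct_apply_inv (g : GL (Fin n) ℂ) (p : MvPolynomial (Fin n) ℂ) :
    polyAct g (polyAct g⁻¹ p) = p := by
  rw [← AlgHom.comp_apply, ← polyAct_mul, mul_inv_cancel, polyAct_one]
  rfl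

/-- The action of `g` on `S`, as an automorphism. -/
noncomputable def polyActEquiv (g : GL (Fin n) ℂ) :
    MvPolynomial (Fin n) ℂ ≃ₐ[ℂ] (MvPolynomial (Fin n) ℂ) :=
  AlgEquiv.ofAlgHom (polyAct g) (polyAct g⁻¹)
    (AlgHom.ext fun p => polyAct_apply_inv g p) (AlgHom.ext fun p => polyAct_inv_apply g p)

/-- An element conjugate to `diag(ζ, 1, …, 1)` scales a linear form, its root, by `ζ`, and acts
trivially modulo that root. -/
theorem IsConjToDiag.exists_root {ζ : ℂ} {s : GL (Fin n) ℂ} (hs : IsConjToDiag ζ s) :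
    ∃ α : MvPolynomial (Fin n) ℂ, Prime α ∧ polyAct s α = MvPolynomial.C ζ * α ∧
      (∀ p, α ∣ polyAct s p - p) := by
  obtain ⟨P, i, hP⟩ := hs
  set D := P * s * P⁻¹ with hD
  have hDX : ∀ j, polyAct D (MvPolynomial.X j : MvPolynomial (Fin n) ℂ) =
      MvPolynomial.C (Function.update (fun _ => (1 : ℂ)) i ζ j) * MvPolynomial.X j := by
    intro j
    rw [polyAct_X, Finset.sum_eq_single j]
    · rw [hP, Matrix.diagonal_apply_eq]
    · intro k _ hk
      rw [hP, Matrix.diagonal_apply_ne _ hk, map_zero, zero_mul]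
    · simp
  have hsD : ∀ p, polyAct s (polyAct P⁻¹ p) = polyAct P⁻¹ (polyAct D p) := by
    intro p
    rw [← AlgHom.comp_apply, ← polyAct_mul, ← AlgHom.comp_apply, ← polyAct_mul]
    congr 2
    rw [hD]
    group
  have hmod : ∀ p : MvPolynomial (Fin n) ℂ, MvPolynomial.X i ∣ polyAct D p - p := by
    have h : (Ideal.Quotient.mkₐ ℂ (Ideal.span {(MvPolynomial.X i : MvPolynomial (Fin n) ℂ)})).comp
        (polyAct D) =
        Ideal.Quotient.mkₐ ℂ (Ideal.span {(MvPolynomial.X i : MvPolynomial (Fin n) ℂ)}) := by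
      refine MvPolynomial.algHom_ext fun j => ?_
      rw [AlgHom.comp_apply, hDX]
      by_cases hj : j = i
      · subst hj
        have : (Ideal.Quotient.mkₐ ℂ (Ideal.span {(MvPolynomial.X j : MvPolynomial (Fin n) ℂ)}))
          (MvPolynomial.X j) = 0 :=
          Ideal.Quotient.eq_zero_iff_mem.2 (Ideal.mem_span_singleton_self _)
        rw [map_mul, this, mul_zero]
      · rw [Function.update_of_ne hj, map_one, one_mul]
    intro p
    rw [← Ideal.mem_span_singleton]
    exact Ideal.Quotient.eq.1 (DFunLike.congr_fun h p)
  refine ⟨polyAct P⁻¹ (MvPolynomial.X i), ?_, ?_, ?_⟩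
  · exact (MulEquiv.prime_iff (polyActEquiv P⁻¹).toMulEquiv).2 MvPolynomial.X_prime
  · rw [hsD, hDX, Function.update_self, map_mul, polyAct_C]
  · intro p
    have h := map_dvd (polyAct P⁻¹) (hmod (polyAct P p))
    rwa [map_sub, ← hsD, polyAct_inv_apply] at h

theorem IsConjToDiag.det_eq {ζ : ℂ} {s : GL (Fin n) ℂ} (hs : IsConjToDiag ζ s) :
    s.val.det = ζ := by
  obtain ⟨P, i, hP⟩ := hs
  have h := congrArg Matrix.det hP
  have hPP : P.val.det * (P⁻¹).val.det = 1 := by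
    rw [← Matrix.det_mul, ← Units.val_mul, mul_inv_cancel, Units.val_one, Matrix.det_one]
  rw [Units.val_mul, Units.val_mul, Matrix.det_mul, Matrix.det_mul, Matrix.det_diagonal,
    Finset.prod_update_of_mem (Finset.mem_univ i)] at h
  simp only [Finset.prod_const_one, mul_one] at h
  linear_combination h - s.val.det * hPP

/-- A semi-invariant not divisible by the root of `s` is fixed by `s`. -/
theorem eq_one_of_not_dvd {s : GL (Fin n) ℂ} {α p : MvPolynomial (Fin n) ℂ} (hα : Prime α)
    (hmod : ∀ p, α ∣ polyAct s p - p) {c : ℂ} (hp : polyAct s p = MvPolynomial.C c * p)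
    (h : ¬ α ∣ p) : c = 1 := by
  have h1 := hmod p
  rw [hp, show MvPolynomial.C c * p - p = MvPolynomial.C (c - 1) * p by
    rw [map_sub, map_one]; ring] at h1
  by_contra hc
  have hu : IsUnit (MvPolynomial.C (σ := Fin n) (c - 1)) :=
    (IsUnit.mk0 _ (sub_ne_zero.2 hc)).map MvPolynomial.C
  exact (hα.dvd_or_dvd h1).elim (fun h2 => hα.not_isUnit (isUnit_of_dvd_unit h2 hu)) h

namespace IsSquarefreePart

variable {z J : MvPolynomial (Fin n) ℂ}

theorem ne_zero (hz : IsSquarefreePart z J) : z ≠ 0 := hz.squarefree.ne_zero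

theorem jacobian_ne_zero (hz : IsSquarefreePart z J) : J ≠ 0 := by
  rintro rfl
  obtain ⟨k, hk⟩ := hz.dvd_pow
  exact pow_ne_zero k hz.ne_zero (zero_dvd_iff.1 hk)

theorem polyAct_dvd (hz : IsSquarefreePart z J) (g : GL (Fin n) ℂ) (hJ : polyAct g J ∣ J) :
    polyAct g z ∣ z := by
  obtain ⟨k, hk⟩ := hz.dvd_pow
  have hsq : Squarefree (polyAct g z) := by
    intro x hx
    have h1 := map_dvd (polyAct g⁻¹) hx
    rw [map_mul, polyAct_inv_apply] at h1
    have h2 := (hz.squarefree _ h1).map (polyAct g)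
    rwa [polyAct_apply_inv] at h2
  exact hsq.isRadical k z (((map_dvd (polyAct g) hz.dvd).trans hJ).trans hk)

/-- `z` is a semi-invariant of every `g` for which `J` is one. -/
theorem exists_semiinvariant (hz : IsSquarefreePart z J) (g : GL (Fin n) ℂ) {c : ℂ}
    (hJ : polyAct g J * MvPolynomial.C c = J) :
    ∃ χ : ℂ, polyAct g z = MvPolynomial.C χ * z := by
  have hJ' : polyAct g⁻¹ J = J * MvPolynomial.C c := by
    conv_lhs => rw [← hJ]
    rw [map_mul, polyAct_inv_apply, polyAct_C]
  have hc : c ≠ 0 := by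
    rintro rfl
    rw [map_zero, mul_zero] at hJ
    exact hz.jacobian_ne_zero hJ.symm
  have hu : IsUnit (MvPolynomial.C (σ := Fin n) c) := (IsUnit.mk0 _ hc).map MvPolynomial.C
  have h1 : polyAct g z ∣ z := hz.polyAct_dvd g (Dvd.intro _ hJ)
  have h2 : z ∣ polyAct g z := by
    have := map_dvd (polyAct g) (hz.polyAct_dvd g⁻¹ (by rw [hJ']; exact hu.mul_right_dvd.2 dvd_rfl))
    rwa [polyAct_apply_inv] at this
  obtain ⟨u, hu⟩ := associated_of_dvd_dvd h2 h1
  obtain ⟨χ, -, hχ⟩ := MvPolynomial.isUnit_iff_eq_C_of_isReduced.1 u.isUnit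
  exact ⟨χ, by rw [← hu, hχ, mul_comm]⟩

/-- A pseudo-reflection that scales `J` by the inverse of its determinant scales `z` by its
determinant: its root divides `J`, hence `z`, and it divides `z` only once. -/
theorem polyAct_eq_of_isConjToDiag (hz : IsSquarefreePart z J) {s : GL (Fin n) ℂ} {ζ : ℂ}
    (hζ : ζ ≠ 1) (hζ0 : ζ ≠ 0) (hs : IsConjToDiag ζ s)
    (hJ : polyAct s J * MvPolynomial.C s.val.det = J) :
    polyAct s z = MvPolynomial.C s.val.det * z := by
  obtain ⟨α, hα, hsα, hmod⟩ := hs.exists_root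
  obtain ⟨χ, hχ⟩ := hz.exists_semiinvariant s hJ
  obtain ⟨k, hk⟩ := hz.dvd_pow
  have hCζ : MvPolynomial.C (σ := Fin n) ζ * MvPolynomial.C ζ⁻¹ = 1 := by
    rw [← map_mul, mul_inv_cancel₀ hζ0, map_one]
  rw [hs.det_eq] at hJ ⊢
  have hαJ : α ∣ J := by
    by_contra hcon
    refine hζ (inv_eq_one.1 (eq_one_of_not_dvd hα hmod (c := ζ⁻¹) ?_ hcon))
    calc polyAct s J = polyAct s J * (MvPolynomial.C ζ * MvPolynomial.C ζ⁻¹) := by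
          rw [hCζ, mul_one]
      _ = MvPolynomial.C ζ⁻¹ * (polyAct s J * MvPolynomial.C ζ) := by ring
      _ = _ := by rw [hJ]
  obtain ⟨q, rfl⟩ := hα.dvd_of_dvd_pow (hαJ.trans hk)
  have hαq : ¬ α ∣ q := fun h => hα.not_isUnit (hz.squarefree α (mul_dvd_mul_left α h))
  have hq : polyAct s q = MvPolynomial.C (χ * ζ⁻¹) * q := by
    rw [map_mul, hsα] at hχ
    refine mul_left_cancel₀ hα.ne_zero ?_
    rw [map_mul]
    linear_combination MvPolynomial.C ζ⁻¹ * hχ - α * polyAct s q * hCζ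
  have := eq_one_of_not_dvd hα hmod hq hαq
  rw [hχ, show χ = ζ by rw [← mul_inv_eq_one₀ hζ0]; exact this]

end IsSquarefreePart

/-- The squarefree part `z` of the Jacobian transforms by the determinant, which is checked on the
generating pseudo-reflections. -/
theorem polyAct_squarefreePart {f : Fin n → MvPolynomial (Fin n) ℂ} {d : Fin n → ℕ}
    {z : MvPolynomial (Fin n) ℂ}
    (hG : IsPseudoReflectionGroup G) (hf : IsBasicInvariants G f d)
    (hz : IsSquarefreePart z (jacobian f)) {g : GL (Fin n) ℂ} (hg : g ∈ G) :
    polyAct g z = MvPolynomial.C g.val.det * z := by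
  rw [← hG] at hg
  induction hg using Subgroup.closure_induction with
  | mem s hs =>
    obtain ⟨hsG, ζ, hζ, ⟨k, hk, hζk⟩, hs⟩ := hs
    refine hz.polyAct_eq_of_isConjToDiag hζ ?_ hs (polyAct_jacobian s (hf.polyAct_eq s hsG))
    rintro rfl
    rw [zero_pow hk.ne'] at hζk
    exact zero_ne_one hζk
  | one => simp [polyAct_one]
  | mul a b _ _ ha hb =>
    rw [polyAct_mul, AlgHom.comp_apply, hb, map_mul, polyAct_C, ha, Units.val_mul, Matrix.det_mul,
      map_mul]
    ring
  | inv a _ ha =>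
    have h1 : a⁻¹.val.det * a.val.det = 1 := by
      rw [← Matrix.det_mul, ← Units.val_mul, inv_mul_cancel, Units.val_one, Matrix.det_one]
    have h2 := congrArg (polyAct a⁻¹) ha
    rw [polyAct_inv_apply, map_mul, polyAct_C] at h2
    rw [h2, ← mul_assoc, ← map_mul, h1, map_one, one_mul, ← h2]

/-- The discriminant `Δ = z J` is an invariant. -/
theorem discriminant_mem {f : Fin n → MvPolynomial (Fin n) ℂ} {d : Fin n → ℕ}
    {z : MvPolynomial (Fin n) ℂ}
    (hG : IsPseudoReflectionGroup G) (hf : IsBasicInvariants G f d)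
    (hz : IsSquarefreePart z (jacobian f)) : z * jacobian f ∈ invariantRing G := by
  intro g hg
  rw [map_mul, polyAct_squarefreePart hG hf hz hg]
  linear_combination z * polyAct_jacobian g (hf.polyAct_eq g hg)

theorem isUnit_of_isUnit_val {x : invariantRing G} (hx : IsUnit (x : MvPolynomial (Fin n) ℂ)) :
    IsUnit x := by
  obtain ⟨c, hc, hxc⟩ := MvPolynomial.isUnit_iff_eq_C_of_isReduced.1 hx
  have : x = algebraMap ℂ _ c := Subtype.ext hxc
  rw [this]
  exact hc.map _

/-- If `G` is generated by reflections of order two and `Δ` is irreducible in `R`, then `J` has the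
same degree as `z`: the polynomials `z²` and `J/z` are invariants, and their product is `Δ`. -/
theorem totalDegree_eq_of_isTrueReflectionGroup {f : Fin n → MvPolynomial (Fin n) ℂ} {d : Fin n → ℕ}
    {z : MvPolynomial (Fin n) ℂ}
    (hG : IsPseudoReflectionGroup G) (hG' : IsTrueReflectionGroup G) (hf : IsBasicInvariants G f d)
    (hz : IsSquarefreePart z (jacobian f)) {Δ : invariantRing G}
    (hΔ : (Δ : MvPolynomial (Fin n) ℂ) = z * jacobian f)
    (hirr : Irreducible Δ) : z.totalDegree = (jacobian f).totalDegree := by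
  have hdet : ∀ g ∈ G, g.val.det * g.val.det = 1 := by
    intro g hg
    rw [← hG'] at hg
    induction hg using Subgroup.closure_induction with
    | mem s hs => rw [IsConjToDiag.det_eq hs.2]; norm_num
    | one => simp
    | mul a b _ _ ha hb =>
      rw [Units.val_mul, Matrix.det_mul]
      linear_combination b.val.det * b.val.det * ha + hb
    | inv a _ ha =>
      have h1 : a⁻¹.val.det * a.val.det = 1 := by
        rw [← Matrix.det_mul, ← Units.val_mul, inv_mul_cancel, Units.val_one, Matrix.det_one]
      linear_combination (a⁻¹.val.det * a.val.det + 1) * h1 - a⁻¹.val.det * a⁻¹.val.det * ha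
  have hCdet : ∀ g ∈ G, MvPolynomial.C (σ := Fin n) g.val.det * MvPolynomial.C g.val.det = 1 :=
    fun g hg => by rw [← map_mul, hdet g hg, map_one]
  have hz2 : z * z ∈ invariantRing G := by
    intro g hg
    rw [map_mul, polyAct_squarefreePart hG hf hz hg]
    linear_combination z * z * hCdet g hg
  obtain ⟨q, hq⟩ := hz.dvd
  have hq' : q ∈ invariantRing G := by
    intro g hg
    have h1 := polyAct_jacobian g (hf.polyAct_eq g hg)
    rw [hq, map_mul, polyAct_squarefreePart hG hf hz hg] at h1
    refine mul_left_cancel₀ hz.ne_zero ?_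
    linear_combination h1 - z * polyAct g q * hCdet g hg
  have hprod : Δ = ⟨z * z, hz2⟩ * ⟨q, hq'⟩ := Subtype.ext (by
    rw [hΔ, hq]
    change z * (z * q) = z * z * q
    ring)
  -- if `z²` were a unit, then so would be `J`, which divides a power of `z`, and hence `Δ`
  rcases hirr.isUnit_or_isUnit hprod with h | h
  · exfalso
    have h1 : IsUnit (z * z) := h.map (invariantRing G).val
    have h2 : IsUnit z := isUnit_of_mul_isUnit_left h1
    obtain ⟨k, hk⟩ := hz.dvd_pow
    have h3 : IsUnit (jacobian f) := isUnit_of_dvd_unit hk (h2.pow k)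
    exact hirr.not_isUnit (isUnit_of_isUnit_val (by rw [hΔ]; exact h2.mul h3))
  · have h1 : IsUnit q := h.map (invariantRing G).val
    obtain ⟨c, hc, rfl⟩ := MvPolynomial.isUnit_iff_eq_C_of_isReduced.1 h1
    rw [hq, MvPolynomial.totalDegree_mul_of_isDomain hz.ne_zero h1.ne_zero,
      MvPolynomial.totalDegree_C, add_zero]

/-- The norm from `S` to `R`, that is, the product over the conjugates. -/
noncomputable def invNorm (G : Subgroup (GL (Fin n) ℂ)) [Fintype G] :
    MvPolynomial (Fin n) ℂ →* invariantRing G where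
  toFun p := ⟨∏ g : G, polyAct (g : GL (Fin n) ℂ) p, fun h hh => by
    rw [map_prod]
    refine Fintype.prod_equiv (Equiv.mulLeft (⟨h, hh⟩ : G)) _ _ fun g => ?_
    rw [← AlgHom.comp_apply, ← polyAct_mul]
    rfl⟩
  map_one' := Subtype.ext (by simp)
  map_mul' p q := Subtype.ext (by simp [Finset.prod_mul_distrib])

theorem invNorm_val [Fintype G] (p : MvPolynomial (Fin n) ℂ) :
    (invNorm G p : MvPolynomial (Fin n) ℂ) = ∏ g : G, polyAct (g : GL (Fin n) ℂ) p := rfl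

theorem dvd_invNorm [Fintype G] (p : MvPolynomial (Fin n) ℂ) :
    p ∣ (invNorm G p : MvPolynomial (Fin n) ℂ) := by
  rw [invNorm_val]
  have := Finset.dvd_prod_of_mem (fun g : G => polyAct (g : GL (Fin n) ℂ) p) (Finset.mem_univ 1)
  simpa [polyAct_one] using this

theorem invNorm_coe [Fintype G] (x : invariantRing G) :
    invNorm G (x : MvPolynomial (Fin n) ℂ) = x ^ Fintype.card G := by
  refine Subtype.ext ?_
  rw [invNorm_val, Finset.prod_congr rfl fun (g : G) _ => x.2 g g.2]
  simp

/-- An invariant that is not divisible by the prime invariant `Δ` is coprime to it in `S`. -/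
theorem isRelPrime_of_not_dvd [Finite G] {Δ b : invariantRing G} (hΔ : Prime Δ) (hb : ¬ Δ ∣ b) :
    IsRelPrime (Δ : MvPolynomial (Fin n) ℂ) (b : MvPolynomial (Fin n) ℂ) := by
  have := Fintype.ofFinite G
  intro c hcΔ hcb
  have h1 := map_dvd (invNorm G) hcΔ
  have h2 := map_dvd (invNorm G) hcb
  rw [invNorm_coe] at h1 h2
  obtain ⟨i, -, hi⟩ := (dvd_prime_pow hΔ _).1 h1
  rcases i with _ | i
  · rw [pow_zero, associated_one_iff_isUnit] at hi
    exact isUnit_of_dvd_unit (dvd_invNorm (G := G) c) (hi.map (invariantRing G).val)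
  · exact absurd (hΔ.dvd_of_dvd_pow
      (((dvd_pow_self Δ i.succ_ne_zero).trans hi.symm.dvd).trans h2)) hb

end Discriminant

/-! ### Covariants and the Reynolds operator -/

section Covariants

variable {n : ℕ} {G : Subgroup (GL (Fin n) ℂ)} {W : Type*} [AddCommGroup W] [Module ℂ W]

/-- The covariants of type `W`, that is, the equivariant maps `W → S`. -/
noncomputable def covariants (ρ : Representation ℂ G W) :
    Submodule ℂ (W →ₗ[ℂ] MvPolynomial (Fin n) ℂ) where
  carrier := {φ | ∀ (g : G) (w : W), φ (ρ g w) = polyRep G g (φ w)}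
  zero_mem' g w := by simp
  add_mem' ha hb g w := by simp [ha g w, hb g w]
  smul_mem' c φ hφ g w := by
    rw [LinearMap.smul_apply, LinearMap.smul_apply, hφ g w, map_smul]

theorem polyRep_apply (g : G) (p : MvPolynomial (Fin n) ℂ) :
    polyRep G g p = polyAct (g : GL (Fin n) ℂ) p := rfl

theorem isStable_covariants (ρ : Representation ℂ G W) :
    IsStable (invariantRing G) (covariants ρ) := fun r φ hφ g w => by
  rw [LinearMap.smul_apply, LinearMap.smul_apply, hφ g w, polyRep_smul]

theorem isHomog_covariants [FiniteDimensional ℂ W] (ρ : Representation ℂ G W) :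
    (homGrading n W).IsHomog (covariants ρ) := fun i φ hφ g w => by
  rw [homGrading_proj_apply, homGrading_proj_apply, hφ g w, polyRep_apply, polyRep_apply,
    polyAct_homogeneousComponent]

theorem hilbertSeries_eq [FiniteDimensional ℂ W] (ρ : Representation ℂ G W) :
    hilbertSeries ρ = (homGrading n W).hilb (covariants ρ) := by
  ext k
  rw [VGrading.coeff_hilb, hilbertSeries, PowerSeries.coeff_mk]
  refine congrArg (fun A : Submodule ℂ (W →ₗ[ℂ] MvPolynomial (Fin n) ℂ) =>
    (Module.finrank ℂ A : ℤ)) ?_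
  ext φ
  rw [Submodule.mem_inf, mem_homGrading_piece]
  rfl

/-- The Reynolds operator on `Hom(W, S)`. -/
noncomputable def reynolds [Fintype G] (ρ : Representation ℂ G W)
    (φ : W →ₗ[ℂ] MvPolynomial (Fin n) ℂ) :
    W →ₗ[ℂ] MvPolynomial (Fin n) ℂ :=
  (Fintype.card G : ℂ)⁻¹ • ∑ g : G, (polyRep G g) ∘ₗ φ ∘ₗ (ρ g⁻¹)

variable [Fintype G] (ρ : Representation ℂ G W)

theorem reynolds_apply (φ : W →ₗ[ℂ] MvPolynomial (Fin n) ℂ) (w : W) :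
    reynolds ρ φ w = (Fintype.card G : ℂ)⁻¹ • ∑ g : G, polyRep G g (φ (ρ g⁻¹ w)) := by
  simp [reynolds]

theorem reynolds_mem (φ : W →ₗ[ℂ] MvPolynomial (Fin n) ℂ) : reynolds ρ φ ∈ covariants ρ := by
  intro h w
  rw [reynolds_apply, reynolds_apply, map_smul, map_sum]
  refine congrArg ((Fintype.card G : ℂ)⁻¹ • ·) ?_
  refine (Fintype.sum_equiv (Equiv.mulLeft h) (fun g => polyRep G h (polyRep G g (φ (ρ g⁻¹ w))))
    (fun g => polyRep G g (φ (ρ g⁻¹ (ρ h w)))) fun g => ?_).symm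
  have h1 : ρ (h * g)⁻¹ (ρ h w) = ρ g⁻¹ w := by
    rw [← Module.End.mul_apply, ← map_mul, mul_inv_rev, inv_mul_cancel_right]
  rw [Equiv.coe_mulLeft, h1, map_mul, Module.End.mul_apply]

theorem card_cast_ne_zero : (Fintype.card G : ℂ) ≠ 0 :=
  Nat.cast_ne_zero.2 Fintype.card_ne_zero

variable {ρ} in
theorem reynolds_eq {φ : W →ₗ[ℂ] MvPolynomial (Fin n) ℂ} (hφ : φ ∈ covariants ρ) :
    reynolds ρ φ = φ := by
  refine LinearMap.ext fun w => ?_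
  rw [reynolds_apply]
  have : ∀ g : G, polyRep G g (φ (ρ g⁻¹ w)) = φ w := fun g => by
    rw [← hφ g, ← Module.End.mul_apply, ← map_mul, mul_inv_cancel, map_one, Module.End.one_apply]
  simp only [this, Finset.sum_const, Finset.card_univ]
  rw [← Nat.cast_smul_eq_nsmul ℂ, smul_smul, inv_mul_cancel₀ card_cast_ne_zero, one_smul]

theorem reynolds_add (φ ψ : W →ₗ[ℂ] MvPolynomial (Fin n) ℂ) :
    reynolds ρ (φ + ψ) = reynolds ρ φ + reynolds ρ ψ := by
  refine LinearMap.ext fun w => ?_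
  simp only [LinearMap.add_apply, reynolds_apply, map_add, Finset.sum_add_distrib, smul_add]

theorem reynolds_sum {ι : Type*} (s : Finset ι) (φ : ι → W →ₗ[ℂ] MvPolynomial (Fin n) ℂ) :
    reynolds ρ (∑ i ∈ s, φ i) = ∑ i ∈ s, reynolds ρ (φ i) := by
  classical
  induction s using Finset.induction_on with
  | empty =>
    refine LinearMap.ext fun w => ?_
    simp [reynolds_apply]
  | insert a s ha ih => rw [Finset.sum_insert ha, Finset.sum_insert ha, reynolds_add, ih]

theorem reynolds_smul (r : invariantRing G) (φ : W →ₗ[ℂ] MvPolynomial (Fin n) ℂ) :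
    reynolds ρ (r • φ) = r • reynolds ρ φ := by
  refine LinearMap.ext fun w => ?_
  rw [LinearMap.smul_apply, reynolds_apply, reynolds_apply]
  simp only [LinearMap.smul_apply, polyRep_smul]
  rw [← Finset.smul_sum, smul_comm]

/-- The average of a polynomial over `G`. -/
noncomputable def average (G : Subgroup (GL (Fin n) ℂ)) [Fintype G] (p : MvPolynomial (Fin n) ℂ) :
    invariantRing G :=
  ⟨(Fintype.card G : ℂ)⁻¹ • ∑ g : G, polyRep G g p, fun h hh => by
    rw [map_smul, map_sum]
    refine congrArg ((Fintype.card G : ℂ)⁻¹ • ·) ?_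
    refine Fintype.sum_equiv (Equiv.mulLeft (⟨h, hh⟩ : G))
      (fun g => polyAct h (polyRep G g p)) (fun g => polyRep G g p) fun g => ?_
    exact (LinearMap.congr_fun (map_mul (polyRep G) (⟨h, hh⟩ : G) g) p).symm⟩

variable {ρ} in
/-- The Reynolds operator maps the `S`-multiples of a covariant to its `R`-multiples. -/
theorem reynolds_smul_of_mem {φ : W →ₗ[ℂ] MvPolynomial (Fin n) ℂ} (hφ : φ ∈ covariants ρ)
    (p : MvPolynomial (Fin n) ℂ) :
    reynolds ρ (p • φ) = average G p • φ := by
  refine LinearMap.ext fun w => ?_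
  rw [reynolds_apply, LinearMap.smul_apply]
  have : ∀ g : G, polyRep G g ((p • φ) (ρ g⁻¹ w)) = polyRep G g p * φ w := fun g => by
    rw [LinearMap.smul_apply, hφ g⁻¹ w, smul_eq_mul]
    change polyAct _ (p * polyAct _ (φ w)) = polyAct _ p * φ w
    rw [map_mul]
    congr 1
    exact polyAct_apply_inv (g : GL (Fin n) ℂ) (φ w)
  simp only [this]
  rw [← Finset.sum_mul, ← smul_mul_assoc]
  rfl

end Covariants

/-! ### Numerators of Hilbert series of covariants -/

section Numerators

variable {n : ℕ} {G : Subgroup (GL (Fin n) ℂ)} {W : Type*} [AddCommGroup W] [Module ℂ W]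
  {f : Fin n → MvPolynomial (Fin n) ℂ} {d : Fin n → ℕ}

/-- The Hilbert series of a graded `R`-subquotient of `Hom(W, S)` has a polynomial numerator. -/
theorem IsBasicInvariants.exists_numerator [FiniteDimensional ℂ W] [Finite G]
    (hf : IsBasicInvariants G f d)
    {P Q : Submodule ℂ (W →ₗ[ℂ] MvPolynomial (Fin n) ℂ)} (hP : (homGrading n W).IsHomog P)
    (hQ : (homGrading n W).IsHomog Q) (hPs : IsStable (invariantRing G) P)
    (hQs : IsStable (invariantRing G) Q) (hPQ : P ≤ Q) :
    ∃ p : ℤ[X], ((homGrading n W).hilb Q - (homGrading n W).hilb P) *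
      ∏ i, (1 - PowerSeries.X ^ d i) = (p : ℤ⟦X⟧) := by
  have := hf.isNoetherian_hom W
  exact hilbert_serre hf.inv d hf.adjoin_inv (homGrading n W)
    (fun i => isHomogMap_lsmul_hom (hf.inv i) (hf.isHomogeneous i)) Finset.univ P Q hP hQ hPs hQs
    hPQ (fun i hi => absurd (Finset.mem_univ i) hi)

theorem isStable_bot :
    IsStable (invariantRing G) (⊥ : Submodule ℂ (W →ₗ[ℂ] MvPolynomial (Fin n) ℂ)) :=
  fun r x hx => by
    rw [Submodule.mem_bot] at hx ⊢
    rw [hx, smul_zero]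

theorem IsBasicInvariants.exists_isHilbertNumerator [FiniteDimensional ℂ W] [Finite G]
    (hf : IsBasicInvariants G f d) (ρ : Representation ℂ G W) :
    ∃ K : ℤ[X], IsHilbertNumerator d ρ K := by
  obtain ⟨K, hK⟩ := hf.exists_numerator (VGrading.isHomog_bot _) (isHomog_covariants ρ)
    isStable_bot (isStable_covariants ρ) bot_le
  refine ⟨K, ?_⟩
  rw [IsHilbertNumerator, hilbertSeries_eq, ← hK, VGrading.hilb_bot, sub_zero]

/-- The `R`-submodule generated by `P` and the `x i` with `i ∈ s`. -/
noncomputable def adjoinSpan (P : Submodule ℂ (W →ₗ[ℂ] MvPolynomial (Fin n) ℂ)) {ι : Type*}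
    (x : ι → W →ₗ[ℂ] MvPolynomial (Fin n) ℂ)
    (s : Finset ι) (G : Subgroup (GL (Fin n) ℂ)) : Submodule ℂ (W →ₗ[ℂ] MvPolynomial (Fin n) ℂ) :=
  P ⊔ ⨆ i ∈ s, (⊤ : Submodule ℂ (invariantRing G)).map (orbitMap G (x i))

section adjoinSpan

variable {P : Submodule ℂ (W →ₗ[ℂ] MvPolynomial (Fin n) ℂ)} {ι : Type*}
  {x : ι → W →ₗ[ℂ] MvPolynomial (Fin n) ℂ}

theorem sum_update_smul [DecidableEq ι] {s : Finset ι} {a : ι} (ha : a ∉ s)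
    (r : ι → invariantRing G) (c : invariantRing G) :
    ∑ i ∈ s, Function.update r a c i • x i = ∑ i ∈ s, r i • x i :=
  Finset.sum_congr rfl fun i hi => by rw [Function.update_of_ne (fun h => ha (h ▸ hi) : i ≠ a)]

theorem adjoinSpan_empty : adjoinSpan P x ∅ G = P := by simp [adjoinSpan]

theorem le_adjoinSpan (s : Finset ι) : P ≤ adjoinSpan P x s G := le_sup_left

theorem adjoinSpan_insert [DecidableEq ι] (s : Finset ι) (a : ι) :
    adjoinSpan P x (insert a s) G = adjoinSpan P x s G ⊔
      (⊤ : Submodule ℂ (invariantRing G)).map (orbitMap G (x a)) := by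
  rw [adjoinSpan, adjoinSpan, Finset.iSup_insert, sup_assoc, sup_comm (_ : Submodule _ _) (iSup _)]

theorem mem_adjoinSpan {s : Finset ι} {y : W →ₗ[ℂ] MvPolynomial (Fin n) ℂ} :
    y ∈ adjoinSpan P x s G ↔ ∃ p ∈ P, ∃ r : ι → invariantRing G, y = p + ∑ i ∈ s, r i • x i := by
  classical
  induction s using Finset.induction_on generalizing y with
  | empty => simp [adjoinSpan_empty]
  | insert a s ha ih =>
    rw [adjoinSpan_insert, Submodule.mem_sup]
    constructor
    · rintro ⟨u, hu, _, ⟨c, -, rfl⟩, rfl⟩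
      obtain ⟨p, hp, r, rfl⟩ := ih.1 hu
      refine ⟨p, hp, Function.update r a c, ?_⟩
      rw [Finset.sum_insert ha, Function.update_self, orbitMap_apply, sum_update_smul ha]
      abel
    · rintro ⟨p, hp, r, rfl⟩
      refine ⟨_, ih.2 ⟨p, hp, r, rfl⟩, _, ⟨r a, trivial, rfl⟩, ?_⟩
      rw [Finset.sum_insert ha, orbitMap_apply]
      abel

theorem isStable_adjoinSpan (hP : IsStable (invariantRing G) P) (s : Finset ι) :
    IsStable (invariantRing G) (adjoinSpan P x s G) := by
  intro c y hy
  obtain ⟨p, hp, r, rfl⟩ := mem_adjoinSpan.1 hy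
  refine mem_adjoinSpan.2 ⟨c • p, hP c p hp, fun i => c * r i, ?_⟩
  rw [smul_add, Finset.smul_sum]
  simp only [mul_smul]

variable [FiniteDimensional ℂ W] {a : ι → ℕ}

theorem isHomog_adjoinSpan (hP : (homGrading n W).IsHomog P)
    (hx : ∀ i, x i ∈ (homGrading n W).piece (a i)) (s : Finset ι) :
    (homGrading n W).IsHomog (adjoinSpan P x s G) := by
  classical
  induction s using Finset.induction_on with
  | empty => rwa [adjoinSpan_empty]
  | insert b s hb ih =>
    rw [adjoinSpan_insert]
    exact ih.sup ((VGrading.isHomog_top _).map (isHomogMap_orbitMap G (hx b)))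

/-- If the `x i` are independent modulo `P` over `R/I`, then they generate modulo `P` a direct sum
of shifted copies of `R/I`. -/
theorem hilb_adjoinSpan_sub {I : Submodule ℂ (invariantRing G)}
    (hP : (homGrading n W).IsHomog P)
    (hx : ∀ i, x i ∈ (homGrading n W).piece (a i)) (hI : ∀ r ∈ I, ∀ i, r • x i ∈ P)
    (s : Finset ι) (hind : ∀ r : ι → invariantRing G, ∑ i ∈ s, r i • x i ∈ P → ∀ i ∈ s, r i ∈ I) :
    (homGrading n W).hilb (adjoinSpan P x s G) - (homGrading n W).hilb P =
      (∑ i ∈ s, PowerSeries.X ^ a i) * ((invGrading G).hilb ⊤ - (invGrading G).hilb I) := by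
  classical
  induction s using Finset.induction_on with
  | empty => simp [adjoinSpan_empty]
  | insert b s hb ih =>
    have ih' := ih fun r hr i hi => by
      have := hind (Function.update r b 0) (by
        rw [Finset.sum_insert hb, Function.update_self, zero_smul, zero_add,
          sum_update_smul hb]
        exact hr) i (Finset.mem_insert_of_mem hi)
      rwa [Function.update_of_ne (fun h => hb (h ▸ hi) : i ≠ b)] at this
    have h := VGrading.hilb_sup_map_sub (isHomogMap_orbitMap G (hx b)) (VGrading.isHomog_top _)
      (isHomog_adjoinSpan (G := G) hP hx s)
    have hcomap : (adjoinSpan P x s G).comap (orbitMap G (x b)) = I := by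
      ext r
      rw [Submodule.mem_comap, orbitMap_apply]
      constructor
      · intro hr
        obtain ⟨p, hp, t, ht⟩ := mem_adjoinSpan.1 hr
        have := hind (Function.update (fun i => - t i) b r) (by
          rw [Finset.sum_insert hb, Function.update_self, sum_update_smul hb, ht]
          have hneg : ∑ i ∈ s, (-t i) • x i = -∑ i ∈ s, t i • x i := by
            rw [← Finset.sum_neg_distrib]
            exact Finset.sum_congr rfl fun i _ => neg_smul (t i) (x i)
          rw [hneg, add_neg_cancel_right]
          exact hp) b (Finset.mem_insert_self b s)
        rwa [Function.update_self] at this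
      · intro hr
        exact le_adjoinSpan s (hI r hr b)
    rw [hcomap, top_inf_eq, ← adjoinSpan_insert] at h
    rw [Finset.sum_insert hb]
    linear_combination h + ih'

end adjoinSpan

/-- The Hilbert series of `b Q`, for a nonzero homogeneous invariant `b`. -/
theorem hilb_map_lsmul [FiniteDimensional ℂ W] {b : invariantRing G} (hb0 : b ≠ 0) {e : ℕ}
    (hb : (b : MvPolynomial (Fin n) ℂ).IsHomogeneous e)
    {Q : Submodule ℂ (W →ₗ[ℂ] MvPolynomial (Fin n) ℂ)}
    (hQ : (homGrading n W).IsHomog Q) :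
    (homGrading n W).hilb (Q.map (Algebra.lsmul ℂ ℂ (W →ₗ[ℂ] MvPolynomial (Fin n) ℂ) b)) =
      PowerSeries.X ^ e * (homGrading n W).hilb Q := by
  have h := VGrading.hilb_sup_map_sub (isHomogMap_lsmul_hom (W := W) b hb) hQ
    (VGrading.isHomog_bot _)
  have hc : (⊥ : Submodule ℂ (W →ₗ[ℂ] MvPolynomial (Fin n) ℂ)).comap
      (Algebra.lsmul ℂ ℂ (W →ₗ[ℂ] MvPolynomial (Fin n) ℂ) b) = ⊥ := by
    rw [eq_bot_iff]
    intro φ hφ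
    refine LinearMap.ext fun w => ?_
    have h1 : (b : MvPolynomial (Fin n) ℂ) * φ w = 0 := LinearMap.congr_fun hφ w
    exact (mul_eq_zero.1 h1).resolve_left fun h => hb0 (Subtype.ext h)
  rwa [bot_sup_eq, hc, inf_bot_eq, VGrading.hilb_bot, sub_zero, sub_zero] at h

end Numerators

/-! ### The value at `1` of the numerators -/

section FreeOrbit

variable {n : ℕ} {G : Subgroup (GL (Fin n) ℂ)}

theorem exists_polyAct_X_ne {g : GL (Fin n) ℂ} (hg : g ≠ 1) :
    ∃ j, polyAct g (MvPolynomial.X j : MvPolynomial (Fin n) ℂ) ≠ MvPolynomial.X j := by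
  by_contra hcon
  push Not at hcon
  refine hg (Units.ext (Matrix.ext fun i j => ?_))
  have h := congrArg (MvPolynomial.coeff (Finsupp.single i 1)) (hcon j)
  rw [polyAct_X, MvPolynomial.coeff_sum] at h
  simp only [MvPolynomial.coeff_C_mul, MvPolynomial.coeff_X] at h
  simp only [Finsupp.single_left_inj one_ne_zero, mul_ite, mul_one, mul_zero,
    Finset.sum_ite_eq', Finset.mem_univ, if_true] at h
  rw [h, Units.val_one, Matrix.one_apply]
  exact if_congr eq_comm rfl rfl

/-- There is a point with a free `G`-orbit, and a polynomial that vanishes on this orbit except at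
the point itself. -/
theorem exists_eval_polyAct [Fintype G] [DecidableEq G] :
    ∃ (v : Fin n → ℂ) (p : MvPolynomial (Fin n) ℂ),
    ∀ g : G, MvPolynomial.eval v (polyAct (g : GL (Fin n) ℂ) p) = if g = 1 then 1 else 0 := by
  choose j hj using fun g : {g : G // g ≠ 1} =>
    exists_polyAct_X_ne (fun h => g.2 (Subtype.ext h) : ((g : G) : GL (Fin n) ℂ) ≠ 1)
  obtain ⟨v, hv⟩ : ∃ v, MvPolynomial.eval v (∏ g : {g : G // g ≠ 1},
      (MvPolynomial.X (j g) - polyAct ((g : G) : GL (Fin n) ℂ) (MvPolynomial.X (j g)))) ≠ 0 := by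
    by_contra hcon
    push Not at hcon
    have h0 : (∏ g : {g : G // g ≠ 1}, (MvPolynomial.X (j g) -
        polyAct ((g : G) : GL (Fin n) ℂ) (MvPolynomial.X (j g)))) = 0 :=
      MvPolynomial.funext fun v => by rw [hcon v, map_zero]
    obtain ⟨g, -, hg⟩ := Finset.prod_eq_zero_iff.1 h0
    exact hj g (sub_eq_zero.1 hg).symm
  rw [map_prod, Finset.prod_ne_zero_iff] at hv
  set c : {g : G // g ≠ 1} → ℂ := fun g =>
    MvPolynomial.eval v (polyAct ((g : G) : GL (Fin n) ℂ) (MvPolynomial.X (j g))) with hc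
  have hv' : ∀ g, v (j g) - c g ≠ 0 := fun g => by
    have := hv g (Finset.mem_univ g)
    rwa [map_sub, MvPolynomial.eval_X] at this
  -- the product over `g ≠ 1` of linear forms that are `1` at `v` and vanish at the image of `v`
  refine ⟨v, ∏ g, MvPolynomial.C (v (j g) - c g)⁻¹ * (MvPolynomial.X (j g) - MvPolynomial.C (c g)),
    fun g => ?_⟩
  rw [map_prod, map_prod]
  split_ifs with hg
  · refine Finset.prod_eq_one fun h _ => ?_
    rw [hg]
    change MvPolynomial.eval v (polyAct 1 _) = 1
    rw [polyAct_one, AlgHom.id_apply, map_mul, map_sub, MvPolynomial.eval_X, MvPolynomial.eval_C,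
      MvPolynomial.eval_C, inv_mul_cancel₀ (hv' h)]
  · refine Finset.prod_eq_zero (Finset.mem_univ ⟨g, hg⟩) ?_
    rw [map_mul, map_sub, polyAct_C, polyAct_C, map_mul, map_sub, MvPolynomial.eval_C,
      MvPolynomial.eval_C, hc, sub_self, mul_zero]

end FreeOrbit

section ValueAtOne

theorem coe_sum_X_pow {ι : Type*} (s : Finset ι) (a : ι → ℕ) :
    ((∑ i ∈ s, Polynomial.X ^ a i : ℤ[X]) : ℤ⟦X⟧) = ∑ i ∈ s, PowerSeries.X ^ a i := by
  rw [← Polynomial.coeToPowerSeries.ringHom_apply, map_sum]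
  simp

variable {n : ℕ} {G : Subgroup (GL (Fin n) ℂ)} {W : Type*} [AddCommGroup W] [Module ℂ W]

/-- Evaluation of `φ : W → S` at a point of `ℂⁿ`. -/
noncomputable def evalAt (v : Fin n → ℂ) : (W →ₗ[ℂ] MvPolynomial (Fin n) ℂ) →ₗ[ℂ]
    Module.Dual ℂ W where
  toFun φ := (MvPolynomial.aeval v : MvPolynomial (Fin n) ℂ →ₐ[ℂ] ℂ).toLinearMap ∘ₗ φ
  map_add' _ _ := LinearMap.comp_add _ _ _
  map_smul' _ _ := LinearMap.comp_smul _ _ _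

theorem evalAt_apply (v : Fin n → ℂ) (φ : W →ₗ[ℂ] MvPolynomial (Fin n) ℂ) (w : W) :
    evalAt v φ w = MvPolynomial.eval v (φ w) := by
  rw [← MvPolynomial.coe_aeval_eq_eval]
  rfl

/-- Covariants can be prescribed at a point with a free orbit. -/
theorem exists_evalAt_surjective [Finite G] (ρ : Representation ℂ G W) :
    ∃ v : Fin n → ℂ, ∀ ψ : Module.Dual ℂ W, ∃ φ ∈ covariants ρ, evalAt v φ = ψ := by
  classical
  have := Fintype.ofFinite G
  obtain ⟨v, p, hp⟩ := exists_eval_polyAct (G := G)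
  refine ⟨v, fun ψ => ?_⟩
  refine ⟨reynolds ρ ((LinearMap.toSpanSingleton ℂ (MvPolynomial (Fin n) ℂ)
      ((Fintype.card G : ℂ) • p)) ∘ₗ ψ),
    reynolds_mem ρ _, LinearMap.ext fun w => ?_⟩
  have h : ∀ g : G, MvPolynomial.eval v (polyRep G g
      (((LinearMap.toSpanSingleton ℂ (MvPolynomial (Fin n) ℂ) ((Fintype.card G : ℂ) • p)) ∘ₗ ψ)
        (ρ g⁻¹ w))) =
      if g = 1 then ψ w * Fintype.card G else 0 := by
    intro g
    rw [LinearMap.comp_apply, LinearMap.toSpanSingleton_apply, map_smul,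
      MvPolynomial.smul_eval, map_smul, MvPolynomial.smul_eval, polyRep_apply, hp]
    split_ifs with hg
    · rw [hg, inv_one, map_one, Module.End.one_apply, mul_one]
    · simp
  rw [evalAt_apply, reynolds_apply, MvPolynomial.smul_eval, map_sum]
  simp only [h, Finset.sum_ite_eq', Finset.mem_univ, if_true]
  have := card_cast_ne_zero (G := G)
  field_simp

variable [FiniteDimensional ℂ W]

/-- There are homogeneous covariants of type `W`, as many as the dimension of `W`, whose matrix with
respect to a basis of `W` is nonsingular. -/
theorem exists_det_ne_zero [Finite G] (ρ : Representation ℂ G W) :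
    ∃ (x : Fin (Module.finrank ℂ W) → (W →ₗ[ℂ] MvPolynomial (Fin n) ℂ))
      (a : Fin (Module.finrank ℂ W) → ℕ),
      (∀ j, x j ∈ covariants ρ) ∧ (∀ j, x j ∈ (homGrading n W).piece (a j)) ∧
      (Matrix.of fun i j => x j (Module.finBasis ℂ W i)).det ≠ 0 := by
  obtain ⟨v, hv⟩ := exists_evalAt_surjective ρ
  set H : Set (W →ₗ[ℂ] MvPolynomial (Fin n) ℂ) :=
    {φ | φ ∈ covariants ρ ∧ ∃ a, φ ∈ (homGrading n W).piece a}
  have hspan : Submodule.span ℂ (evalAt v '' H) = ⊤ := by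
    rw [eq_top_iff]
    intro ψ _
    obtain ⟨φ, hφ, rfl⟩ := hv ψ
    obtain ⟨N, hN⟩ := (homGrading n W).exists_sum φ
    rw [← hN, map_sum]
    exact Submodule.sum_mem _ fun i _ => Submodule.subset_span
      ⟨_, ⟨isHomog_covariants ρ i φ hφ, i, (homGrading n W).proj_mem_piece i φ⟩, rfl⟩
  obtain ⟨B, hBH, hBspan, hB⟩ := exists_linearIndependent ℂ (evalAt v '' H)
  rw [hspan] at hBspan
  let bas : Module.Basis B ℂ (Module.Dual ℂ W) := Module.Basis.mk hB (by simp [hBspan])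
  have : Fintype B := FiniteDimensional.fintypeBasisIndex bas
  have hcard : Fintype.card B = Module.finrank ℂ W := by
    rw [← Module.finrank_eq_card_basis bas, Subspace.dual_finrank_eq]
  let e : Fin (Module.finrank ℂ W) ≃ B := (Fintype.equivFinOfCardEq hcard).symm
  choose x hx hxe using fun j => hBH (e j).2
  choose a ha using fun j => (hx j).2
  refine ⟨x, a, fun j => (hx j).1, ha, fun hdet => ?_⟩
  have h1 : LinearIndependent ℂ fun j => evalAt v (x j) := by
    simp only [hxe]
    exact hB.comp e e.injective
  have h2 : LinearIndependent ℂ fun j => (fun i => evalAt v (x j) (Module.finBasis ℂ W i)) :=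
    h1.map' ((Module.finBasis ℂ W).constr ℂ).symm.toLinearMap (LinearEquiv.ker _)
  have h3 := (Matrix.linearIndependent_rows_iff_isUnit (A := Matrix.of
    fun j i => evalAt v (x j) (Module.finBasis ℂ W i))).1 h2
  rw [Matrix.isUnit_iff_isUnit_det, ← Matrix.det_transpose] at h3
  refine h3.ne_zero ?_
  have h4 := congrArg (MvPolynomial.eval v) hdet
  rw [RingHom.map_det, map_zero] at h4
  rw [← h4]
  congr 1

/-- Cramer's rule and averaging: a nonzero homogeneous invariant multiplies every covariant into
the `R`-span of the given ones. -/
theorem exists_smul_eq_sum [Finite G] {ρ : Representation ℂ G W} {ι : Type*} [Fintype ι]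
    [DecidableEq ι] (bas : Module.Basis ι ℂ W) {x : ι → (W →ₗ[ℂ] MvPolynomial (Fin n) ℂ)}
    {a : ι → ℕ}
    (hx : ∀ j, x j ∈ covariants ρ) (ha : ∀ j, x j ∈ (homGrading n W).piece (a j))
    (hdet : (Matrix.of fun i j => x j (bas i)).det ≠ 0) :
    ∃ (b : invariantRing G) (e : ℕ), b ≠ 0 ∧ (b : MvPolynomial (Fin n) ℂ).IsHomogeneous e ∧
      ∀ φ ∈ covariants ρ, ∃ r : ι → invariantRing G, b • φ = ∑ j, r j • x j := by
  have := Fintype.ofFinite G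
  set A : Matrix ι ι (MvPolynomial (Fin n) ℂ) := Matrix.of fun i j => x j (bas i) with hA
  have hδ : A.det.IsHomogeneous (∑ j, a j) := by
    rw [Matrix.det_apply]
    refine MvPolynomial.IsHomogeneous.sum _ _ _ fun σ _ => ?_
    have h : (∏ i, A (σ i) i).IsHomogeneous (∑ j, a j) :=
      MvPolynomial.IsHomogeneous.prod _ _ _ fun i _ => mem_homGrading_piece.1 (ha i) _
    rcases Int.units_eq_one_or (Equiv.Perm.sign σ) with h1 | h1
    · rw [h1, one_smul]
      exact h
    · rw [h1, Units.neg_smul, one_smul]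
      exact h.neg
  refine ⟨invNorm G A.det, ∑ _g : G, ∑ j, a j, ?_, ?_, ?_⟩
  · intro h
    have h1 : (∏ g : G, polyAct (g : GL (Fin n) ℂ) A.det) = 0 := congrArg Subtype.val h
    obtain ⟨g, -, hg⟩ := Finset.prod_eq_zero_iff.1 h1
    refine hdet ?_
    rw [← polyAct_inv_apply (g : GL (Fin n) ℂ) A.det, hg, map_zero]
  · exact MvPolynomial.IsHomogeneous.prod _ _ _ fun g _ => polyAct_isHomogeneous _ hδ
  · intro φ hφ
    obtain ⟨q, hq⟩ := dvd_invNorm (G := G) A.det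
    have hcr := A.mulVec_cramer fun i => φ (bas i)
    have h1 : invNorm G A.det • φ =
        ∑ j, (q * A.cramer (fun i => φ (bas i)) j) • x j := by
      refine bas.ext fun i => ?_
      have h2 := congrFun hcr i
      simp only [Matrix.mulVec, dotProduct, Pi.smul_apply, smul_eq_mul] at h2
      rw [LinearMap.sum_apply]
      change (invNorm G A.det : MvPolynomial (Fin n) ℂ) * φ (bas i) = _
      rw [hq, mul_comm A.det, mul_assoc, ← h2, Finset.mul_sum]
      refine Finset.sum_congr rfl fun j _ => ?_
      rw [LinearMap.smul_apply, smul_eq_mul, hA, Matrix.of_apply]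
      ring
    refine ⟨fun j => average G (q * A.cramer (fun i => φ (bas i)) j), ?_⟩
    rw [← reynolds_eq (isStable_covariants ρ (invNorm G A.det) φ hφ), h1, reynolds_sum]
    exact Finset.sum_congr rfl fun j _ => reynolds_smul_of_mem (hx j) _

/-- The value at `1` of the numerator of the Hilbert series of the covariants of type `W` is the
dimension of `W`. -/
theorem IsBasicInvariants.eval_one_numerator [Finite G] {f : Fin n → MvPolynomial (Fin n) ℂ}
    {d : Fin n → ℕ}
    (hf : IsBasicInvariants G f d) {ρ : Representation ℂ G W} {K : ℤ[X]}
    (hK : IsHilbertNumerator d ρ K) : K.eval 1 = Module.finrank ℂ W := by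
  obtain ⟨x, a, hx, ha, hdet⟩ := exists_det_ne_zero ρ
  obtain ⟨b, e, hb0, hb, hbx⟩ := exists_smul_eq_sum (Module.finBasis ℂ W) hx ha hdet
  rw [IsHilbertNumerator, hilbertSeries_eq] at hK
  set F := adjoinSpan (⊥ : Submodule ℂ (W →ₗ[ℂ] MvPolynomial (Fin n) ℂ)) x Finset.univ G with hF
  have hind : ∀ r : Fin (Module.finrank ℂ W) → invariantRing G,
      ∑ i, r i • x i ∈ (⊥ : Submodule ℂ (W →ₗ[ℂ] MvPolynomial (Fin n) ℂ)) → ∀ i ∈ Finset.univ,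
        r i ∈ (⊥ : Submodule ℂ (invariantRing G)) := by
    intro r hr i _
    have h1 : (Matrix.of fun i j => x j (Module.finBasis ℂ W i)).mulVec
        (fun j => (r j : MvPolynomial (Fin n) ℂ)) = 0 := by
      ext1 i
      have h2 := LinearMap.congr_fun ((Submodule.mem_bot ℂ).1 hr) (Module.finBasis ℂ W i)
      rw [LinearMap.sum_apply, LinearMap.zero_apply] at h2
      rw [Pi.zero_apply, ← h2]
      change ∑ j, x j (Module.finBasis ℂ W i) * (r j : MvPolynomial (Fin n) ℂ) =
        ∑ j, (r j : MvPolynomial (Fin n) ℂ) * x j (Module.finBasis ℂ W i)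
      exact Finset.sum_congr rfl fun j _ => mul_comm (x j (Module.finBasis ℂ W i))
        (r j : MvPolynomial (Fin n) ℂ)
    have h3 := Matrix.eq_zero_of_mulVec_eq_zero hdet h1
    exact Subtype.ext (congrFun h3 i)
  have hFser := hilb_adjoinSpan_sub (G := G) (VGrading.isHomog_bot _) ha (I := ⊥)
    (fun r hr i => by
      rw [Submodule.mem_bot] at hr ⊢
      rw [hr, zero_smul]) Finset.univ hind
  rw [VGrading.hilb_bot, VGrading.hilb_bot, sub_zero, sub_zero, ← hF] at hFser
  have hFQ : F ≤ covariants ρ := by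
    intro y hy
    obtain ⟨p, hp, r, rfl⟩ := mem_adjoinSpan.1 hy
    rw [(Submodule.mem_bot ℂ).1 hp, zero_add]
    exact Submodule.sum_mem _ fun i _ => isStable_covariants ρ (r i) _ (hx i)
  have hbF : (covariants ρ).map (Algebra.lsmul ℂ ℂ (W →ₗ[ℂ] MvPolynomial (Fin n) ℂ) b) ≤ F := by
    rintro _ ⟨φ, hφ, rfl⟩
    obtain ⟨r, hr⟩ := hbx φ hφ
    exact mem_adjoinSpan.2 ⟨0, zero_mem _, r, by rw [zero_add]; exact hr⟩
  have key := eval_one_eq_zero_of_coeff_le d hf.one_le_degree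
    (h := (homGrading n W).hilb (covariants ρ) - (homGrading n W).hilb F)
    (h' := (homGrading n W).hilb (covariants ρ)) (p := K - ∑ i, Polynomial.X ^ a i) (p' := K)
    (by
      have h1 := hf.hilb_invariantRing
      rw [hFser, sub_mul, hK, mul_assoc, h1, mul_one, Polynomial.coe_sub, coe_sum_X_pow]) hK e
    (fun i => by
      rw [map_sub]
      exact sub_nonneg.2 ((homGrading n W).coeff_hilb_mono hFQ i))
    (fun i => by
      rw [sub_mul, one_mul, ← hilb_map_lsmul hb0 hb (isHomog_covariants ρ), map_sub, map_sub]
      exact sub_le_sub_left ((homGrading n W).coeff_hilb_mono hbF i) _)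
  rw [Polynomial.eval_sub, Polynomial.eval_finsetSum] at key
  simpa [sub_eq_zero] using key

end ValueAtOne

/-! ### Rank over the quotient by a prime element -/

section Rank

/-- The rank over `A/(a)` of an `A/(a)`-module generated by the `v i` is the cardinality of a
maximal independent subfamily, and every `v i` is torsion modulo that subfamily. -/
theorem exists_finset_rankOverQuotient {A M ι : Type*} [CommRing A] [AddCommGroup M] [Module A M]
    [IsNoetherian A M] {a : A} (ha : Prime a) (h : Module.IsTorsionBy A M a) (v : ι → M)
    (hv : Submodule.span A (Set.range v) = ⊤) :
    ∃ s : Finset ι, rankOverQuotient h = s.card ∧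
      (∀ r : ι → A, ∑ i ∈ s, r i • v i = 0 → ∀ i ∈ s, a ∣ r i) ∧
      ∀ i, ∃ c : A, ¬ a ∣ c ∧ c • v i ∈ Submodule.span A (v '' s) := by
  let : Module (A ⧸ Ideal.span {a}) M := h.module
  have hsm : ∀ (r : A) (x : M), (Ideal.Quotient.mk (Ideal.span {a}) r) • x = r • x :=
    fun r x => rfl
  have : (Ideal.span {a}).IsPrime := (Ideal.span_singleton_prime ha.ne_zero).2 ha
  have : IsScalarTower A (A ⧸ Ideal.span {a}) M := ⟨fun r b x => by
    obtain ⟨b, rfl⟩ := Ideal.Quotient.mk_surjective b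
    rw [hsm, ← mul_smul, ← hsm]
    rfl⟩
  have : IsNoetherian (A ⧸ Ideal.span {a}) M := isNoetherian_of_tower A inferInstance
  obtain ⟨I, hI, hmax⟩ := exists_maximal_linearIndepOn (A ⧸ Ideal.span {a}) v
  have hfin : I.Finite := by
    have : Finite I := LinearIndependent.finite_of_isNoetherian hI
    exact Set.toFinite I
  obtain ⟨s, rfl⟩ := hfin.exists_finset_coe
  have hspan : ∀ y ∈ Submodule.span (A ⧸ Ideal.span {a}) (v '' s),
      y ∈ Submodule.span A (v '' (s : Set ι)) := by
    intro y hy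
    induction hy using Submodule.span_induction with
    | mem x hx => exact Submodule.subset_span hx
    | zero => exact zero_mem _
    | add x y _ _ hx hy => exact add_mem hx hy
    | smul b x _ hx =>
      obtain ⟨b, rfl⟩ := Ideal.Quotient.mk_surjective b
      exact Submodule.smul_mem _ b hx
  have hmk : ∀ c : A, Ideal.Quotient.mk (Ideal.span {a}) c = 0 ↔ a ∣ c := fun c => by
    rw [Ideal.Quotient.eq_zero_iff_mem, Ideal.mem_span_singleton]
  have htors : ∀ i, ∃ c : A ⧸ Ideal.span {a}, c ≠ 0 ∧
      c • v i ∈ Submodule.span (A ⧸ Ideal.span {a}) (v '' s) := by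
    intro i
    by_cases hi : i ∈ (s : Set ι)
    · exact ⟨1, one_ne_zero, by
        rw [one_smul]
        exact Submodule.subset_span ⟨i, hi, rfl⟩⟩
    · exact hmax i hi
  refine ⟨s, ?_, ?_, ?_⟩
  · have h1 := rank_quotient_add_rank_of_isDomain
      (Submodule.span (A ⧸ Ideal.span {a}) (v '' (s : Set ι)))
    have h2 : Module.rank (A ⧸ Ideal.span {a})
        (M ⧸ Submodule.span (A ⧸ Ideal.span {a}) (v '' (s : Set ι))) = 0 := by
      rw [rank_eq_zero_iff]
      intro x
      obtain ⟨y, rfl⟩ := Submodule.Quotient.mk_surjective _ x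
      have hy : y ∈ Submodule.span A (Set.range v) := hv ▸ Submodule.mem_top
      have key : ∃ c : A ⧸ Ideal.span {a}, c ≠ 0 ∧
          c • y ∈ Submodule.span (A ⧸ Ideal.span {a}) (v '' (s : Set ι)) := by
        induction hy using Submodule.span_induction with
        | mem x hx =>
          obtain ⟨i, rfl⟩ := hx
          exact htors i
        | zero => exact ⟨1, one_ne_zero, by rw [smul_zero]; exact zero_mem _⟩
        | add x y _ _ hx hy =>
          obtain ⟨c, hc, hcx⟩ := hx
          obtain ⟨e, he, hey⟩ := hy
          refine ⟨c * e, mul_ne_zero hc he, ?_⟩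
          rw [smul_add]
          refine add_mem ?_ ?_
          · rw [mul_comm, mul_smul]
            exact Submodule.smul_mem _ _ hcx
          · rw [mul_smul]
            exact Submodule.smul_mem _ _ hey
        | smul r x _ hx =>
          obtain ⟨c, hc, hcx⟩ := hx
          refine ⟨c, hc, ?_⟩
          rw [← hsm, smul_comm]
          exact Submodule.smul_mem _ _ hcx
      obtain ⟨c, hc, hcy⟩ := key
      refine ⟨c, hc, ?_⟩
      rw [← Submodule.Quotient.mk_smul, Submodule.Quotient.mk_eq_zero]
      exact hcy
    rw [h2, zero_add] at h1
    change Module.rank (A ⧸ Ideal.span {a}) M = _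
    rw [← h1]
    have hI' : LinearIndependent (A ⧸ Ideal.span {a}) fun i : (s : Set ι) => v i := hI
    have h3 := rank_span hI'
    have h4 : Set.range (fun i : (s : Set ι) => v i) = v '' (s : Set ι) := by
      rw [Set.image_eq_range]
    rw [h4] at h3
    classical
    rw [h3, ← Finset.coe_image]
    exact (Cardinal.mk_coe_finset (s := s.image v)).trans
      (by rw [Finset.card_image_of_injOn hI.injOn])
  · intro r hr i hi
    rw [← hmk]
    exact linearIndepOn_finset_iff.1 hI (fun i => Ideal.Quotient.mk _ (r i)) hr i hi
  · intro i
    obtain ⟨c, hc, hcv⟩ := htors i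
    obtain ⟨c, rfl⟩ := Ideal.Quotient.mk_surjective c
    exact ⟨c, fun h => hc ((hmk c).2 h), hspan _ hcv⟩

end Rank

/-! ### Covariants divisible by the Jacobian -/

section Divisible

variable {n : ℕ} {G : Subgroup (GL (Fin n) ℂ)} {W : Type*} [AddCommGroup W] [Module ℂ W]

theorem exists_eq_smul_of_dvd {p : MvPolynomial (Fin n) ℂ} (hp : p ≠ 0)
    {φ : W →ₗ[ℂ] MvPolynomial (Fin n) ℂ} (h : ∀ w, p ∣ φ w) :
    ∃ u : W →ₗ[ℂ] MvPolynomial (Fin n) ℂ, φ = p • u := by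
  choose u hu using h
  refine ⟨{ toFun := u, map_add' := fun x y => ?_, map_smul' := fun c x => ?_ }, ?_⟩
  · refine mul_left_cancel₀ hp ?_
    rw [mul_add, ← hu, ← hu, ← hu, map_add]
  · refine mul_left_cancel₀ hp ?_
    rw [RingHom.id_apply, mul_smul_comm, ← hu, ← hu, map_smul]
  · exact LinearMap.ext hu

/-- The covariants whose values are divisible by `J`. -/
noncomputable def divisibleCovariants (ρ : Representation ℂ G W) (J : MvPolynomial (Fin n) ℂ) :
    Submodule ℂ (W →ₗ[ℂ] MvPolynomial (Fin n) ℂ) where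
  carrier := {φ | φ ∈ covariants ρ ∧ ∀ w, J ∣ φ w}
  zero_mem' := ⟨zero_mem _, fun w => dvd_zero J⟩
  add_mem' ha hb := ⟨add_mem ha.1 hb.1, fun w => dvd_add (ha.2 w) (hb.2 w)⟩
  smul_mem' c φ hφ := ⟨(covariants ρ).smul_mem c hφ.1, fun w => by
    rw [LinearMap.smul_apply, MvPolynomial.smul_eq_C_mul]
    exact (hφ.2 w).mul_left _⟩

theorem isStable_divisibleCovariants (ρ : Representation ℂ G W) (J : MvPolynomial (Fin n) ℂ) :
    IsStable (invariantRing G) (divisibleCovariants ρ J) := fun r φ hφ =>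
  ⟨isStable_covariants ρ r φ hφ.1, fun w => (hφ.2 w).mul_left (r : MvPolynomial (Fin n) ℂ)⟩

/-- Multiplication by `J`, from covariants of type `W ⊗ det` to covariants of type `W`. -/
noncomputable def twistMap (W : Type*) [AddCommGroup W] [Module ℂ W] (J : MvPolynomial (Fin n) ℂ) :
    (TensorProduct ℂ W ℂ →ₗ[ℂ] MvPolynomial (Fin n) ℂ) →ₗ[ℂ] (W →ₗ[ℂ] MvPolynomial (Fin n) ℂ) where
  toFun φ := LinearMap.mulLeft ℂ J ∘ₗ φ ∘ₗ (TensorProduct.rid ℂ W).symm.toLinearMap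
  map_add' _ _ := LinearMap.ext fun _ => mul_add J _ _
  map_smul' c _ := LinearMap.ext fun _ => mul_smul_comm c J _

theorem twistMap_apply (J : MvPolynomial (Fin n) ℂ)
    (φ : TensorProduct ℂ W ℂ →ₗ[ℂ] MvPolynomial (Fin n) ℂ) (w : W) :
    twistMap W J φ w = J * φ (w ⊗ₜ[ℂ] 1) := rfl

theorem tprod_detRep_apply (ρ : Representation ℂ G W) (g : G) (w : W) :
    ρ.tprod (detRep G) g (w ⊗ₜ[ℂ] (1 : ℂ)) =
      (g : GL (Fin n) ℂ).val.det • (ρ g w ⊗ₜ[ℂ] (1 : ℂ)) := by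
  rw [← TensorProduct.tmul_smul]
  rfl

theorem exists_tmul_one (x : TensorProduct ℂ W ℂ) : ∃ w : W, x = w ⊗ₜ[ℂ] (1 : ℂ) :=
  ⟨TensorProduct.rid ℂ W x, ((TensorProduct.rid ℂ W).symm_apply_apply x).symm⟩

theorem map_twistMap_covariants {J : MvPolynomial (Fin n) ℂ} (hJ0 : J ≠ 0)
    (hJ : ∀ g ∈ G, polyAct g J * MvPolynomial.C g.val.det = J) (ρ : Representation ℂ G W) :
    (covariants (ρ.tprod (detRep G))).map (twistMap W J) = divisibleCovariants ρ J := by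
  refine le_antisymm ?_ ?_
  · rintro _ ⟨φ, hφ, rfl⟩
    refine ⟨fun g w => ?_, fun w => Dvd.intro _ rfl⟩
    have h1 := hφ g (w ⊗ₜ[ℂ] (1 : ℂ))
    rw [tprod_detRep_apply, map_smul, polyRep_apply, MvPolynomial.smul_eq_C_mul] at h1
    rw [twistMap_apply, twistMap_apply, polyRep_apply, map_mul, ← h1]
    linear_combination (- φ ((ρ g) w ⊗ₜ[ℂ] 1)) * hJ g g.2
  · rintro φ ⟨hφ, hdvd⟩
    obtain ⟨u, rfl⟩ := exists_eq_smul_of_dvd hJ0 hdvd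
    refine ⟨u ∘ₗ (TensorProduct.rid ℂ W).toLinearMap, fun g x => ?_, LinearMap.ext fun w => ?_⟩
    · obtain ⟨w, rfl⟩ := exists_tmul_one x
      have h1 := hφ g w
      rw [LinearMap.smul_apply, LinearMap.smul_apply, polyRep_apply, smul_eq_mul, smul_eq_mul,
        map_mul] at h1
      refine mul_left_cancel₀ hJ0 ?_
      rw [tprod_detRep_apply, map_smul, polyRep_apply, MvPolynomial.smul_eq_C_mul]
      simp only [LinearMap.comp_apply, LinearEquiv.coe_coe, TensorProduct.rid_tmul, one_smul]
      linear_combination MvPolynomial.C (g : GL (Fin n) ℂ).val.det * h1 +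
        polyAct (g : GL (Fin n) ℂ) (u w) * hJ g g.2
    · rw [twistMap_apply]
      simp only [LinearMap.comp_apply, LinearEquiv.coe_coe, TensorProduct.rid_tmul, one_smul]
      rfl

variable [FiniteDimensional ℂ W]

theorem isHomogMap_twistMap {J : MvPolynomial (Fin n) ℂ} {m : ℕ} (hJ : J.IsHomogeneous m) :
    (homGrading n (TensorProduct ℂ W ℂ)).IsHomogMap (homGrading n W) m (twistMap W J) :=
  fun i _ => LinearMap.ext fun _ => homogeneousComponent_mul_of_isHomogeneous hJ i _

theorem isHomog_divisibleCovariants {J : MvPolynomial (Fin n) ℂ} {m : ℕ} (hJh : J.IsHomogeneous m)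
    (hJ0 : J ≠ 0)
    (hJ : ∀ g ∈ G, polyAct g J * MvPolynomial.C g.val.det = J) (ρ : Representation ℂ G W) :
    (homGrading n W).IsHomog (divisibleCovariants ρ J) := by
  rw [← map_twistMap_covariants hJ0 hJ]
  exact (isHomog_covariants _).map (isHomogMap_twistMap hJh)

/-- The covariants of type `W` divisible by `J` are the covariants of type `W ⊗ det` shifted by
`deg J`. -/
theorem hilb_divisibleCovariants {J : MvPolynomial (Fin n) ℂ} {m : ℕ} (hJh : J.IsHomogeneous m)
    (hJ0 : J ≠ 0)
    (hJ : ∀ g ∈ G, polyAct g J * MvPolynomial.C g.val.det = J) (ρ : Representation ℂ G W) :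
    (homGrading n W).hilb (divisibleCovariants ρ J) =
      PowerSeries.X ^ m * hilbertSeries (ρ.tprod (detRep G)) := by
  have h := VGrading.hilb_sup_map_sub (isHomogMap_twistMap (W := W) hJh)
    (isHomog_covariants (ρ.tprod (detRep G))) (VGrading.isHomog_bot _)
  have hc : (⊥ : Submodule ℂ (W →ₗ[ℂ] MvPolynomial (Fin n) ℂ)).comap (twistMap W J) = ⊥ := by
    rw [eq_bot_iff]
    intro φ hφ
    refine LinearMap.ext fun x => ?_
    obtain ⟨w, rfl⟩ := exists_tmul_one x
    exact (mul_eq_zero.1 (LinearMap.congr_fun hφ w)).resolve_left hJ0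
  rw [bot_sup_eq, hc, inf_bot_eq, VGrading.hilb_bot, VGrading.hilb_bot, sub_zero, sub_zero,
    map_twistMap_covariants hJ0 hJ] at h
  rw [h, hilbertSeries_eq]

end Divisible

/-! ### The module `Hom_G(W, S/(J))` as a quotient of the covariants -/

section Quotient

variable {n : ℕ} {G : Subgroup (GL (Fin n) ℂ)} {W : Type*} [AddCommGroup W] [Module ℂ W]
  {f : Fin n → MvPolynomial (Fin n) ℂ} {d : Fin n → ℕ}

/-- The `R`-module of covariants of type `W`. -/
abbrev HomPoly (ρ : Representation ℂ G W) :=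
  HomRep (N := MvPolynomial (Fin n) ℂ) (invariantRing G) ρ (polyRep G) (by
    intro g r x
    change polyRep G g (r • x) = r • polyRep G g x
    exact polyRep_smul G g r x)

theorem val_sum_homPoly {ρ : Representation ℂ G W} {ι : Type*} (s : Finset ι) (φ : ι → HomPoly ρ) :
    (∑ i ∈ s, φ i).1 = ∑ i ∈ s, (φ i).1 :=
  map_sum (homRep (N := MvPolynomial (Fin n) ℂ) (invariantRing G) ρ (polyRep G) _).subtype _ _

/-- Reduction modulo `J` of covariants. -/
noncomputable def toHomQuot (hf : IsBasicInvariants G f d) (ρ : Representation ℂ G W) :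
    HomPoly ρ →ₗ[invariantRing G] HomQuot hf ρ where
  toFun φ := ⟨((Ideal.span {jacobian f}).restrictScalars ℂ).mkQ ∘ₗ φ.1, fun g w =>
    congrArg (Submodule.Quotient.mk (p := Ideal.span {jacobian f})) (φ.2 g w)⟩
  map_add' _ _ := Subtype.ext (LinearMap.comp_add _ _ _)
  map_smul' _ _ := Subtype.ext (LinearMap.ext fun _ => rfl)

theorem toHomQuot_eq_zero_iff (hf : IsBasicInvariants G f d) (ρ : Representation ℂ G W)
    (φ : HomPoly ρ) :
    toHomQuot hf ρ φ = 0 ↔ φ.1 ∈ divisibleCovariants ρ (jacobian f) := by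
  have key : ∀ w, Submodule.Quotient.mk (p := Ideal.span {jacobian f}) (φ.1 w) = 0 ↔
      jacobian f ∣ φ.1 w := fun w => by
    rw [Submodule.Quotient.mk_eq_zero, Ideal.mem_span_singleton]
  constructor
  · intro h
    refine ⟨φ.2, fun w => (key w).1 ?_⟩
    exact LinearMap.congr_fun (congrArg Subtype.val h) w
  · intro h
    exact Subtype.ext (LinearMap.ext fun w => (key w).2 (h.2 w))

/-- Every equivariant map to `S/(J)` lifts to a covariant, by averaging a linear lift. -/
theorem toHomQuot_surjective [Finite G] (hf : IsBasicInvariants G f d)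
    (ρ : Representation ℂ G W) : Function.Surjective (toHomQuot hf ρ) := by
  have := Fintype.ofFinite G
  rintro ⟨Ψ, hΨ⟩
  set π : MvPolynomial (Fin n) ℂ →ₗ[ℂ] MvPolynomial (Fin n) ℂ ⧸ Ideal.span {jacobian f} :=
    (Ideal.Quotient.mkₐ ℂ (Ideal.span {jacobian f})).toLinearMap with hπ
  obtain ⟨φ, hφ⟩ := Module.projective_lifting_property π Ψ
    (Ideal.Quotient.mkₐ_surjective ℂ (Ideal.span {jacobian f}))
  have hφ' : ∀ w, π (φ w) = Ψ w := LinearMap.congr_fun hφ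
  refine ⟨⟨reynolds ρ φ, reynolds_mem ρ φ⟩, Subtype.ext (LinearMap.ext fun w => ?_)⟩
  change π (reynolds ρ φ w) = Ψ w
  have h : ∀ g : G, π (polyRep G g (φ (ρ g⁻¹ w))) = Ψ w := by
    intro g
    have h1 := hΨ g (ρ g⁻¹ w)
    rw [← Module.End.mul_apply, ← map_mul, mul_inv_cancel, map_one, Module.End.one_apply] at h1
    rw [h1, ← hφ']
    rfl
  rw [reynolds_apply, map_smul, map_sum, Finset.sum_congr rfl fun g _ => h g, Finset.sum_const,
    Finset.card_univ, ← Nat.cast_smul_eq_nsmul ℂ, smul_smul, inv_mul_cancel₀ card_cast_ne_zero,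
    one_smul]

end Quotient

/-! ### The rank formula -/

section RankFormula

variable {n : ℕ} {G : Subgroup (GL (Fin n) ℂ)} {W : Type*} [AddCommGroup W] [Module ℂ W]
  [FiniteDimensional ℂ W]

/-- If a homogeneous `y` is multiplied into the homogeneous submodule `P` by an invariant not
divisible by the homogeneous `Δ`, then also by a homogeneous such invariant. -/
theorem exists_homogeneous_multiplier {Δ : invariantRing G}
    {P : Submodule ℂ (W →ₗ[ℂ] MvPolynomial (Fin n) ℂ)} (hP : (homGrading n W).IsHomog P)
    {y : W →ₗ[ℂ] MvPolynomial (Fin n) ℂ} {a : ℕ} (hy : y ∈ (homGrading n W).piece a)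
    {c : invariantRing G}
    (hc : ¬ Δ ∣ c) (hcy : c • y ∈ P) :
    ∃ (b : invariantRing G) (e : ℕ), (b : MvPolynomial (Fin n) ℂ).IsHomogeneous e ∧ ¬ Δ ∣ b ∧
      b • y ∈ P := by
  obtain ⟨N, hN⟩ := (invGrading G).exists_sum c
  obtain ⟨i, hi⟩ : ∃ i, ¬ Δ ∣ (invGrading G).proj i c := by
    by_contra hcon
    push Not at hcon
    refine hc ?_
    rw [← hN]
    exact Finset.dvd_sum fun i _ => hcon i
  refine ⟨_, i, mem_invGrading_piece.1 ((invGrading G).proj_mem_piece i c), hi, ?_⟩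
  have h := hP (i + a) _ hcy
  rwa [← orbitMap_apply, isHomogMap_orbitMap G hy, orbitMap_apply] at h

/-- If every homogeneous element of the graded module `Q` is multiplied into `P` by an invariant not
divisible by the prime `Δ`, then one homogeneous such invariant does so for all of `Q`. -/
theorem exists_common_multiplier [IsNoetherian (invariantRing G) (W →ₗ[ℂ] MvPolynomial (Fin n) ℂ)]
    {Δ : invariantRing G} (hΔ : Prime Δ) {P Q : Submodule ℂ (W →ₗ[ℂ] MvPolynomial (Fin n) ℂ)}
    (hP : (homGrading n W).IsHomog P) (hPs : IsStable (invariantRing G) P)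
    (hQ : (homGrading n W).IsHomog Q) (hQs : IsStable (invariantRing G) Q)
    (h : ∀ y ∈ Q, ∀ a, y ∈ (homGrading n W).piece a → ∃ c : invariantRing G, ¬ Δ ∣ c ∧ c • y ∈ P) :
    ∃ (b : invariantRing G) (e : ℕ), (b : MvPolynomial (Fin n) ℂ).IsHomogeneous e ∧ ¬ Δ ∣ b ∧
      ∀ y ∈ Q, b • y ∈ P := by
  classical
  -- a common multiplier of finitely many elements is the product of their multipliers
  have hfin : ∀ (T : Finset (W →ₗ[ℂ] MvPolynomial (Fin n) ℂ)),
      (∀ t ∈ T, ∃ (b : invariantRing G) (e : ℕ),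
      (b : MvPolynomial (Fin n) ℂ).IsHomogeneous e ∧ ¬ Δ ∣ b ∧ b • t ∈ P) →
      ∃ (b : invariantRing G) (e : ℕ), (b : MvPolynomial (Fin n) ℂ).IsHomogeneous e ∧ ¬ Δ ∣ b ∧
        ∀ t ∈ T, b • t ∈ P := by
    intro T
    induction T using Finset.induction_on with
    | empty =>
      intro _
      exact ⟨1, 0, MvPolynomial.isHomogeneous_one _ _, fun h => hΔ.not_isUnit (isUnit_of_dvd_one h),
        by simp⟩
    | insert t T ht ih =>
      intro hT
      obtain ⟨b, e, hb, hbΔ, hbT⟩ := ih fun t ht => hT t (Finset.mem_insert_of_mem ht)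
      obtain ⟨b', e', hb', hbΔ', hbT'⟩ := hT t (Finset.mem_insert_self t T)
      refine ⟨b * b', e + e', hb.mul hb', fun hdvd => (hΔ.dvd_or_dvd hdvd).elim hbΔ hbΔ', ?_⟩
      intro u hu
      rcases Finset.mem_insert.1 hu with rfl | hu
      · rw [mul_smul]
        exact hPs _ _ hbT'
      · rw [mul_comm, mul_smul]
        exact hPs _ _ (hbT u hu)
  have hone : ∀ y ∈ Q, ∃ (b : invariantRing G) (e : ℕ),
      (b : MvPolynomial (Fin n) ℂ).IsHomogeneous e ∧ ¬ Δ ∣ b ∧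
      b • y ∈ P := by
    intro y hy
    obtain ⟨N, hN⟩ := (homGrading n W).exists_sum y
    obtain ⟨b, e, hb, hbΔ, hbT⟩ := hfin
      ((Finset.range N).image fun i => (homGrading n W).proj i y) (by
        intro t ht
        obtain ⟨i, -, rfl⟩ := Finset.mem_image.1 ht
        obtain ⟨c, hc, hcy⟩ := h _ (hQ i y hy) i ((homGrading n W).proj_mem_piece i y)
        exact exists_homogeneous_multiplier hP ((homGrading n W).proj_mem_piece i y) hc hcy)
    refine ⟨b, e, hb, hbΔ, ?_⟩
    rw [← hN, Finset.smul_sum]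
    exact Submodule.sum_mem _ fun i hi => hbT _ (Finset.mem_image_of_mem _ hi)
  obtain ⟨T, hT⟩ := (isNoetherian_def.1
    ‹IsNoetherian (invariantRing G) (W →ₗ[ℂ] MvPolynomial (Fin n) ℂ)›) hQs.toSubmodule
  obtain ⟨b, e, hb, hbΔ, hbT⟩ := hfin T fun t ht => hone t (by
    have : t ∈ hQs.toSubmodule := hT ▸ Submodule.subset_span ht
    exact this)
  refine ⟨b, e, hb, hbΔ, fun y hy => ?_⟩
  have hy' : y ∈ Submodule.span (invariantRing G) (T : Set (W →ₗ[ℂ] MvPolynomial (Fin n) ℂ)) := by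
    rw [hT]
    exact hy
  have hle : Submodule.span (invariantRing G) (T : Set (W →ₗ[ℂ] MvPolynomial (Fin n) ℂ)) ≤
      hPs.toSubmodule.comap
        (LinearMap.lsmul (invariantRing G) (W →ₗ[ℂ] MvPolynomial (Fin n) ℂ) b) :=
    Submodule.span_le.2 hbT
  exact hle hy'

/-- The Hilbert series of `Hom(W, S)/(Δ, b)` for coprime homogeneous invariants `Δ` and `b`. -/
theorem hilb_top_sub_of_isRelPrime {Δ b : invariantRing G} (hΔ0 : Δ ≠ 0)
    (hrel : IsRelPrime (Δ : MvPolynomial (Fin n) ℂ) (b : MvPolynomial (Fin n) ℂ)) {δ e : ℕ}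
    (hΔ : (Δ : MvPolynomial (Fin n) ℂ).IsHomogeneous δ)
    (hb : (b : MvPolynomial (Fin n) ℂ).IsHomogeneous e) :
    (homGrading n W).hilb ⊤ - (homGrading n W).hilb
      ((⊤ : Submodule ℂ (W →ₗ[ℂ] MvPolynomial (Fin n) ℂ)).map
          (Algebra.lsmul ℂ ℂ (W →ₗ[ℂ] MvPolynomial (Fin n) ℂ) Δ) ⊔
        (⊤ : Submodule ℂ (W →ₗ[ℂ] MvPolynomial (Fin n) ℂ)).map
          (Algebra.lsmul ℂ ℂ (W →ₗ[ℂ] MvPolynomial (Fin n) ℂ) b)) =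
      (1 - PowerSeries.X ^ e) * ((1 - PowerSeries.X ^ δ) * (homGrading n W).hilb ⊤) := by
  have h1 := hilb_map_lsmul (W := W) hΔ0 hΔ (VGrading.isHomog_top _)
  have h2 := VGrading.hilb_sup_map_sub (isHomogMap_lsmul_hom (W := W) b hb)
    (VGrading.isHomog_top _)
    ((VGrading.isHomog_top (homGrading n W)).map (isHomogMap_lsmul_hom (W := W) Δ hΔ))
  have hc : ((⊤ : Submodule ℂ (W →ₗ[ℂ] MvPolynomial (Fin n) ℂ)).map
        (Algebra.lsmul ℂ ℂ (W →ₗ[ℂ] MvPolynomial (Fin n) ℂ) Δ)).comap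
      (Algebra.lsmul ℂ ℂ (W →ₗ[ℂ] MvPolynomial (Fin n) ℂ) b) =
      (⊤ : Submodule ℂ (W →ₗ[ℂ] MvPolynomial (Fin n) ℂ)).map
        (Algebra.lsmul ℂ ℂ (W →ₗ[ℂ] MvPolynomial (Fin n) ℂ) Δ) := by
    refine le_antisymm ?_ ?_
    · rintro φ ⟨u, -, hu⟩
      have hdvd : ∀ w, (Δ : MvPolynomial (Fin n) ℂ) ∣ φ w := fun w =>
        hrel.dvd_of_dvd_mul_left ⟨u w, (LinearMap.congr_fun hu w).symm⟩
      obtain ⟨u', rfl⟩ := exists_eq_smul_of_dvd (fun h => hΔ0 (Subtype.ext h)) hdvd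
      exact ⟨u', trivial, rfl⟩
    · rintro _ ⟨u, -, rfl⟩
      exact ⟨b • u, trivial, smul_comm Δ b u⟩
  rw [hc, top_inf_eq] at h2
  linear_combination -h2 - (1 - PowerSeries.X ^ e) * h1

variable {f : Fin n → MvPolynomial (Fin n) ℂ} {d : Fin n → ℕ}

theorem isNoetherian_homQuot [Finite G] (hf : IsBasicInvariants G f d)
    (ρ : Representation ℂ G W) : IsNoetherian (invariantRing G) (HomQuot hf ρ) := by
  have := hf.isNoetherian_hom W
  have : IsNoetherian (invariantRing G) (HomPoly ρ) :=
    isNoetherian_of_injective (homRep _ _ _ _).subtype Subtype.val_injective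
  exact isNoetherian_of_surjective (toHomQuot hf ρ)
    (LinearMap.range_eq_top.2 (toHomQuot_surjective hf ρ))

/-- The homogeneous covariants of type `W`. -/
abbrev HomogCovariant (ρ : Representation ℂ G W) :=
  {y : W →ₗ[ℂ] MvPolynomial (Fin n) ℂ // y ∈ covariants ρ ∧ ∃ a, y ∈ (homGrading n W).piece a}

/-- A homogeneous covariant, as an element of the module of covariants. -/
def HomogCovariant.toHomPoly {ρ : Representation ℂ G W} (y : HomogCovariant ρ) : HomPoly ρ :=
  ⟨y.1, y.2.1⟩

theorem span_range_toHomQuot [Finite G] (hf : IsBasicInvariants G f d)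
    (ρ : Representation ℂ G W) :
    Submodule.span (invariantRing G) (Set.range fun y : HomogCovariant ρ =>
      toHomQuot hf ρ y.toHomPoly) = ⊤ := by
  rw [eq_top_iff]
  intro Ψ _
  obtain ⟨φ, rfl⟩ := toHomQuot_surjective hf ρ Ψ
  obtain ⟨N, hN⟩ := (homGrading n W).exists_sum φ.1
  let y : ℕ → HomogCovariant ρ := fun i =>
    ⟨(homGrading n W).proj i φ.1, isHomog_covariants ρ i _ φ.2, i,
      (homGrading n W).proj_mem_piece i φ.1⟩
  have hφ : φ = ∑ i ∈ Finset.range N, (y i).toHomPoly :=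
    Subtype.ext (hN.symm.trans (val_sum_homPoly _ fun i => (y i).toHomPoly).symm)
  rw [hφ, map_sum]
  exact Submodule.sum_mem _ fun i _ => Submodule.subset_span ⟨y i, rfl⟩

/-- The rank of `Hom_G(W, S/(J))` is the size of a finite set of homogeneous covariants that is
maximal independent over `R/(Δ)` modulo the covariants divisible by `J`. -/
theorem exists_finset_rankHomQuot [Finite G] (hf : IsBasicInvariants G f d)
    (ρ : Representation ℂ G W) {z : MvPolynomial (Fin n) ℂ} {Δ : invariantRing G}
    (hΔ : (Δ : MvPolynomial (Fin n) ℂ) = z * jacobian f) (hprime : Prime Δ) :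
    ∃ s : Finset (HomogCovariant ρ), rankHomQuot hf ρ hΔ = s.card ∧
      (∀ r : HomogCovariant ρ → invariantRing G,
        ∑ i ∈ s, r i • i.1 ∈ divisibleCovariants ρ (jacobian f) → ∀ i ∈ s, Δ ∣ r i) ∧
      ∀ y : HomogCovariant ρ, ∃ c : invariantRing G, ¬ Δ ∣ c ∧
        c • y.1 ∈ adjoinSpan (divisibleCovariants ρ (jacobian f))
          (fun y : HomogCovariant ρ => y.1) s G := by
  classical
  have := isNoetherian_homQuot hf ρ
  let v : HomogCovariant ρ → HomQuot hf ρ := fun y => toHomQuot hf ρ y.toHomPoly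
  have hval : ∀ (s : Finset (HomogCovariant ρ)) (r : HomogCovariant ρ → invariantRing G),
      (∑ i ∈ s, r i • i.toHomPoly : HomPoly ρ).1 = ∑ i ∈ s, r i • i.1 :=
    fun s r => val_sum_homPoly s _
  obtain ⟨s, hrank, hind, htors⟩ := exists_finset_rankOverQuotient hprime
    (isTorsionBy_homRep _ _ _ _ Δ (smul_quot_eq_zero hΔ)) v (span_range_toHomQuot hf ρ)
  refine ⟨s, hrank, fun r hr => hind r ?_, fun y => ?_⟩
  · have h1 : toHomQuot hf ρ (∑ i ∈ s, r i • i.toHomPoly) = 0 := by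
      rw [toHomQuot_eq_zero_iff, hval]
      exact hr
    rw [map_sum] at h1
    simpa only [map_smul] using h1
  · obtain ⟨c, hc, hcv⟩ := htors y
    refine ⟨c, hc, ?_⟩
    obtain ⟨r, hr⟩ : ∃ r : HomogCovariant ρ → invariantRing G,
        ∑ i ∈ s, r i • v i = c • v y := by
      obtain ⟨r, hr⟩ := (Submodule.mem_span_image_finset_iff_exists_fun _).1 hcv
      refine ⟨fun i => if h : i ∈ s then r ⟨i, h⟩ else 0, Eq.trans ?_ hr⟩
      rw [← Finset.sum_coe_sort s]
      exact Finset.sum_congr rfl fun i _ => by simp only [i.2, dif_pos]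
    have h1 : toHomQuot hf ρ (c • y.toHomPoly - ∑ i ∈ s, r i • i.toHomPoly) = 0 := by
      rw [map_sub, map_sum, sub_eq_zero, map_smul]
      refine hr.symm.trans (Finset.sum_congr rfl fun i _ => ?_)
      rw [map_smul]
    have h2 : c • y.1 - (∑ i ∈ s, r i • i.toHomPoly : HomPoly ρ).1 ∈
        divisibleCovariants ρ (jacobian f) := (toHomQuot_eq_zero_iff hf ρ _).1 h1
    rw [hval] at h2
    exact mem_adjoinSpan.2 ⟨_, h2, r, (sub_add_cancel _ _).symm⟩

/-- The rank of `Hom_G(W, S/(J))` over `R/(Δ)`, in terms of the numerators of the Hilbert series. -/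
theorem exists_rankHomQuot_eq [Finite G] (hf : IsBasicInvariants G f d)
    (ρ : Representation ℂ G W) {z : MvPolynomial (Fin n) ℂ} (hz : IsSquarefreePart z (jacobian f))
    {Δ : invariantRing G} (hΔ : (Δ : MvPolynomial (Fin n) ℂ) = z * jacobian f)
    (hirr : Irreducible Δ) {K K' : ℤ[X]}
    (hK : IsHilbertNumerator d ρ K) (hK' : IsHilbertNumerator d (ρ.tprod (detRep G)) K') :
    ∃ r : ℕ, rankHomQuot hf ρ hΔ = r ∧
      (r : ℤ) * (∑ i, (d i - 1) + z.totalDegree : ℕ) =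
        (∑ i, (d i - 1) : ℕ) * Module.finrank ℂ W +
          (K'.derivative.eval 1 - K.derivative.eval 1) := by
  classical
  have := Fintype.ofFinite G
  have := hf.uniqueFactorizationMonoid
  have := hf.isNoetherian_hom W
  have := isNoetherian_homQuot hf ρ
  have hprime : Prime Δ := hirr.prime
  have hJ0 : jacobian f ≠ 0 := hz.jacobian_ne_zero
  set m := ∑ i, (d i - 1) with hm
  have hJh : (jacobian f).IsHomogeneous m := hf.isHomogeneous_jacobian
  have hJ : ∀ g ∈ G, polyAct g (jacobian f) * MvPolynomial.C g.val.det = jacobian f :=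
    fun g hg => polyAct_jacobian g (hf.polyAct_eq g hg)
  have hzh : z.IsHomogeneous z.totalDegree := isHomogeneous_of_dvd hJh hJ0 hz.dvd
  set δ := m + z.totalDegree with hδ
  have hΔh : (Δ : MvPolynomial (Fin n) ℂ).IsHomogeneous δ := by
    rw [hΔ, hδ, add_comm]
    exact hzh.mul hJh
  set Q := covariants ρ with hQdef
  set P := divisibleCovariants ρ (jacobian f) with hPdef
  have hQ : (homGrading n W).IsHomog Q := isHomog_covariants ρ
  have hQs : IsStable (invariantRing G) Q := isStable_covariants ρ
  have hP : (homGrading n W).IsHomog P := isHomog_divisibleCovariants hJh hJ0 hJ ρ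
  have hPs : IsStable (invariantRing G) P := isStable_divisibleCovariants ρ _
  have hΔP : ∀ y ∈ Q, Δ • y ∈ P := fun y hy => ⟨hQs Δ y hy, fun w => by
    change jacobian f ∣ (Δ : MvPolynomial (Fin n) ℂ) * y w
    rw [hΔ, mul_assoc, mul_left_comm]
    exact Dvd.intro _ rfl⟩
  obtain ⟨s, hrank, hind, htors⟩ := exists_finset_rankHomQuot hf ρ hΔ hprime
  choose a ha using fun y : HomogCovariant ρ => y.2.2
  -- the submodule generated by `P` and the chosen covariants; it has full rank in `Q` modulo `P`
  set P' := adjoinSpan P (fun y : HomogCovariant ρ => y.1) s G with hP'def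
  have hP' : (homGrading n W).IsHomog P' := isHomog_adjoinSpan hP ha s
  have hP's : IsStable (invariantRing G) P' := isStable_adjoinSpan hPs s
  have hP'Q : P' ≤ Q := by
    intro y hy
    obtain ⟨p, hp, r, rfl⟩ := mem_adjoinSpan.1 hy
    exact add_mem hp.1 (Submodule.sum_mem _ fun i _ => hQs _ _ i.2.1)
  -- the Hilbert series of `P'/P`
  have hser := hilb_adjoinSpan_sub (G := G) hP ha
    (I := (⊤ : Submodule ℂ (invariantRing G)).map (Algebra.lsmul ℂ ℂ (invariantRing G) Δ))
    (by
      rintro _ ⟨c, -, rfl⟩ i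
      change (Δ * c) • i.1 ∈ P
      rw [mul_smul]
      exact hΔP _ (hQs _ _ i.2.1)) s (by
      intro r hr i hi
      obtain ⟨c, hc⟩ := hind r hr i hi
      exact ⟨c, trivial, hc.symm⟩)
  have hI : (invGrading G).hilb ((⊤ : Submodule ℂ (invariantRing G)).map
      (Algebra.lsmul ℂ ℂ (invariantRing G) Δ)) = PowerSeries.X ^ δ * (invGrading G).hilb ⊤ := by
    have h := VGrading.hilb_sup_map_sub (isHomogMap_lsmul_inv Δ hΔh) (VGrading.isHomog_top _)
      (VGrading.isHomog_bot _)
    have hc : (⊥ : Submodule ℂ (invariantRing G)).comap (Algebra.lsmul ℂ ℂ (invariantRing G) Δ) =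
        ⊥ := by
      rw [eq_bot_iff]
      intro c hc
      exact (mul_eq_zero.1 (show Δ * c = 0 from hc)).resolve_left hprime.ne_zero
    rwa [bot_sup_eq, hc, inf_bot_eq, VGrading.hilb_bot, sub_zero, sub_zero] at h
  -- a homogeneous multiplier of `Q` into `P'` that is coprime to `Δ`
  obtain ⟨b, e, hb, hbΔ, hbQ⟩ := exists_common_multiplier hprime hP' hP's hQ hQs
    (fun y hy a hya => htors ⟨y, hy, a, hya⟩)
  have hrel := isRelPrime_of_not_dvd hprime hbΔ
  have hZ := hilb_top_sub_of_isRelPrime (W := W) hprime.ne_zero hrel hΔh hb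
  have hQZ : Q ⊓ ((⊤ : Submodule ℂ (W →ₗ[ℂ] MvPolynomial (Fin n) ℂ)).map
          (Algebra.lsmul ℂ ℂ (W →ₗ[ℂ] MvPolynomial (Fin n) ℂ) Δ) ⊔
        (⊤ : Submodule ℂ (W →ₗ[ℂ] MvPolynomial (Fin n) ℂ)).map
          (Algebra.lsmul ℂ ℂ (W →ₗ[ℂ] MvPolynomial (Fin n) ℂ) b)) ≤ P' := by
    rintro φ ⟨hφ, hφZ⟩
    obtain ⟨_, ⟨u, -, rfl⟩, _, ⟨u', -, rfl⟩, rfl⟩ := Submodule.mem_sup.1 hφZ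
    -- the Reynolds operator turns `u` and `u'` into covariants
    have h1 : Δ • u + b • u' = Δ • reynolds ρ u + b • reynolds ρ u' := by
      rw [← reynolds_smul, ← reynolds_smul, ← reynolds_add]
      exact (reynolds_eq hφ).symm
    change Δ • u + b • u' ∈ P'
    rw [h1]
    exact add_mem (le_adjoinSpan s (hΔP _ (reynolds_mem ρ u))) (hbQ _ (reynolds_mem ρ u'))
  obtain ⟨C, hC⟩ := hf.exists_numerator (W := W) (VGrading.isHomog_bot _) (VGrading.isHomog_top _)
    isStable_bot (fun _ _ _ => trivial) bot_le
  rw [VGrading.hilb_bot, sub_zero] at hC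
  -- the numerator of the Hilbert series of `Q/P'` vanishes to second order at `1`, as `Q/P'` is
  -- annihilated by the coprime `Δ` and `b`; the derivative of this numerator gives the formula
  have hQP : (homGrading n W).hilb Q - (homGrading n W).hilb P' =
      hilbertSeries ρ - PowerSeries.X ^ m * hilbertSeries (ρ.tprod (detRep G)) -
        (∑ i ∈ s, PowerSeries.X ^ a i) * ((1 - PowerSeries.X ^ δ) * (invGrading G).hilb ⊤) := by
    rw [hI] at hser
    rw [← hilb_divisibleCovariants hJh hJ0 hJ, hilbertSeries_eq]
    linear_combination -hser
  have hnum : ((homGrading n W).hilb Q - (homGrading n W).hilb P') *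
      ∏ i, (1 - PowerSeries.X ^ d i) =
      ((K - Polynomial.X ^ m * K' - (∑ i ∈ s, Polynomial.X ^ a i) * (1 - Polynomial.X ^ δ) : ℤ[X]) :
        ℤ⟦X⟧) := by
    have h1 := hf.hilb_invariantRing
    rw [IsHilbertNumerator] at hK hK'
    rw [hQP, Polynomial.coe_sub, Polynomial.coe_sub, Polynomial.coe_mul, Polynomial.coe_mul,
      coe_sum_X_pow, ← hK, ← hK']
    push_cast
    linear_combination (-(∑ i ∈ s, PowerSeries.X ^ a i) * (1 - PowerSeries.X ^ δ)) * h1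
  have key := derivative_eval_one_eq_zero_of_coeff_le d hf.one_le_degree hnum hC e δ
    (fun i => by
      rw [map_sub]
      exact sub_nonneg.2 ((homGrading n W).coeff_hilb_mono hP'Q i))
    (fun i => by
      rw [← hZ]
      exact (homGrading n W).coeff_hilb_sub_le hQZ i)
  refine ⟨s.card, hrank, ?_⟩
  have hK1 : K'.eval 1 = Module.finrank ℂ W := by
    rw [hf.eval_one_numerator hK', Module.finrank_tensorProduct, Module.finrank_self, mul_one]
  simp only [Polynomial.derivative_sub, Polynomial.derivative_mul, Polynomial.derivative_X_pow,
    Polynomial.eval_sub, Polynomial.eval_add, Polynomial.eval_mul, Polynomial.eval_pow,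
    Polynomial.eval_X, one_pow, Polynomial.derivative_one, Polynomial.eval_one, sub_self, mul_zero,
    zero_add, Polynomial.eval_finsetSum, Finset.sum_const, hK1, mul_one, one_mul, zero_sub] at key
  simp at key
  linear_combination key

end RankFormula

end ReflGroup

theorem mainTheorem10 {n : ℕ} (G : Subgroup (GL (Fin n) ℂ)) [Finite G]
    (hG : ReflGroup.IsPseudoReflectionGroup G)
    (f : Fin n → MvPolynomial (Fin n) ℂ) (d : Fin n → ℕ)
    (hf : ReflGroup.IsBasicInvariants G f d)
    (z : MvPolynomial (Fin n) ℂ) (hz : ReflGroup.IsSquarefreePart z (ReflGroup.jacobian f))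
    (m m₁ : ℕ) (hm : m = ∑ i, (d i - 1)) (hm₁ : m₁ = z.totalDegree)
    {W : Type*} [AddCommGroup W] [Module ℂ W] [FiniteDimensional ℂ W]
    (ρ : Representation ℂ G W) (hρ : ρ.IsIrreducible) :
    ∃ (Δ : ReflGroup.invariantRing G)
      (hΔ : (Δ : MvPolynomial (Fin n) ℂ) = z * ReflGroup.jacobian f) (K K' : ℤ[X]),
      ReflGroup.IsHilbertNumerator d ρ K ∧
      ReflGroup.IsHilbertNumerator d (ρ.tprod (ReflGroup.detRep G)) K' ∧
      (Irreducible Δ → ∃ r : ℕ, ReflGroup.rankHomQuot hf ρ hΔ = r ∧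
        (r : ℚ) = 1 / ((m : ℚ) + m₁) *
          (m * Module.finrank ℂ (TensorProduct ℂ W ℂ)
            + (K'.derivative.eval 1 : ℤ) - (K.derivative.eval 1 : ℤ)) ∧
        (ReflGroup.IsTrueReflectionGroup G →
          (r : ℚ) = 1 / 2 * (Module.finrank ℂ (TensorProduct ℂ W ℂ)
            + ((K'.derivative.eval 1 : ℤ) - (K.derivative.eval 1 : ℤ)) / m))) := by
  obtain ⟨K, hK⟩ := hf.exists_isHilbertNumerator ρ
  obtain ⟨K', hK'⟩ := hf.exists_isHilbertNumerator (ρ.tprod (ReflGroup.detRep G))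
  refine ⟨⟨z * ReflGroup.jacobian f, ReflGroup.discriminant_mem hG hf hz⟩, rfl, K, K', hK, hK',
    fun hirr => ?_⟩
  obtain ⟨r, hr, hrank⟩ := ReflGroup.exists_rankHomQuot_eq hf ρ hz rfl hirr hK hK'
  rw [← hm, ← hm₁] at hrank
  have hJdeg : (ReflGroup.jacobian f).totalDegree = m := by
    rw [hm]
    exact hf.isHomogeneous_jacobian.totalDegree hz.jacobian_ne_zero
  -- `Δ` is not a constant, so its degree is positive
  have hpos : 0 < m + m₁ := by
    by_contra hcon
    refine hirr.not_isUnit (ReflGroup.isUnit_of_isUnit_val ?_)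
    have hdeg : (z * ReflGroup.jacobian f).totalDegree = 0 := by
      rw [MvPolynomial.totalDegree_mul_of_isDomain hz.ne_zero hz.jacobian_ne_zero, hJdeg, ← hm₁]
      omega
    change IsUnit (z * ReflGroup.jacobian f)
    have hne := mul_ne_zero hz.ne_zero hz.jacobian_ne_zero
    rw [MvPolynomial.totalDegree_eq_zero_iff_eq_C.1 hdeg] at hne ⊢
    exact (IsUnit.mk0 _ fun h => hne (by rw [h, map_zero])).map MvPolynomial.C
  have hdim : Module.finrank ℂ (TensorProduct ℂ W ℂ) = Module.finrank ℂ W := by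
    rw [Module.finrank_tensorProduct, Module.finrank_self, mul_one]
  have hposQ : ((m : ℚ) + m₁) ≠ 0 := by exact_mod_cast hpos.ne'
  have hrankQ : (r : ℚ) * (m + m₁) = m * Module.finrank ℂ W +
      ((K'.derivative.eval 1 : ℤ) - (K.derivative.eval 1 : ℤ)) := by exact_mod_cast hrank
  rw [hdim]
  refine ⟨r, hr, ?_, fun hG' => ?_⟩
  · field_simp
    linear_combination hrankQ
  · have h1 : m₁ = m := by
      rw [hm₁, ← hJdeg]
      exact ReflGroup.totalDegree_eq_of_isTrueReflectionGroup hG hG' hf hz rfl hirr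
    subst h1
    have hm0 : (m₁ : ℚ) ≠ 0 := by
      have : m₁ ≠ 0 := by omega
      exact_mod_cast this
    field_simp
    linear_combination hrankQ
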